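/- **Setting.** A *$C^1$ density* is a function $f:\mathbb R\to[0,\infty)$ with $\int f=1$ that vanishes outside some open interval $X\subseteq\mathbb R$ and is continuously differentiable on $X$, except possibly at the point $0$ (every probability density that is continuously differentiable on $\mathbb R$ is one). For $\gamma>0$ put $W_{\gamma}[f](x)=\left|\int_0^x f(t)^{1-\gamma}\,dt\right|\in[0,\infty]$ (with $0^s=\infty$ for $s<0$ and $0^0=1$). For $q\in[0,\infty]$ the *cumulative deviation* is $$\sigma_{q,\gamma}[f]=\Big(\int_{\mathbb R} W_\gamma[f](x)^q f(x)\,dx\Big)^{\frac1{q\gamma}}\ (0<q<\infty),\quad \sigma_{0,\gamma}[f]=\exp\Big(\tfrac1\gamma\int_{\mathbb R} f\log W_\gamma[f]\Big),\quad \sigma_{\infty,\gamma}[f]=\Big(\operatorname*{ess\,sup}_{f>0}W_\gamma[f]\Big)^{\frac1\gamma},$$ and the *Rényi entropy power* is $N_\lambda[f]=\big(\int_{\{f>0\}} f^{\lambda}\big)^{\frac1{1-\lambda}}$ for $\lambda\ne1$, $N_1[f]=\exp\big(-\int f\log f\big)$. All of these take values in $[0,\infty]$; in the exponentials, an integral whose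 positive and negative parts are both infinite is read as $-\infty$. **Parameters.** Let $p^*\in[0,\infty]$, write $\frac1p=1-\frac1{p^*}$ for $0<p^*<\infty$, and let $\lambda,\beta\in\mathbb R$ satisfy $\beta>\lambda-1$ and $p^*\beta>1-\lambda$ (that is, $\beta>\max(\lambda-1,\frac{1-\lambda}{p^*})$ if $0<p^*<\infty$; $\beta>\lambda-1$ and $\lambda>1$ if $p^*=0$; for $p^*=\infty$ the second condition is read as $\beta>0$). Put $\gamma=1+\beta-\lambda>0$ and $\lambda_0=\beta/\gamma$. **Constants.** For $0<p^*<\infty$ let $a_{p,\mu}=\frac{p^*|1-\mu|^{1/p^*}}{2B\left(\frac1{p^*},\,\frac{\mu}{|1-\mu|}+\frac1p\mathbf 1_{\mu\le1}\right)}$ for $\mu\neq1$, $a_{p,1}=\frac{p^*}{2\Gamma(1/p^*)}$, $a_{p,\beta,\lambda}=a_{p,\lambda_0}$, $\kappa_{p,\beta,\lambda}=\left|\frac{\lambda-1}{\gamma}\right|^{1/p^*}$. **Densities.** Let $\arcsin_{v,w}(y)=\int_0^y(1-|t|^w)^{-1/v}dt$ on $(-1,1)$ and $\operatorname{arsinh}_{v,w}(y)=\int_0^y(1+|t|^w)^{-1/v}dt$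 on $\mathbb R$; let $\sin_{v,w},\sinh_{v,w}$ be their inverse functions, defined on their ranges, and $\cos_{v,w}=\sin_{v,w}'$, $\cosh_{v,w}=\sinh_{v,w}'$. For $0<p^*<\infty$ define $\rho_{p,\beta,\lambda}$ as follows: * if $\beta=\lambda$ (stretched Gaussian): $\rho_{p,\beta,\lambda}(x)=a_{p,\lambda}\,(1+(1-\lambda)|x|^{p^*})_+^{\frac1{\lambda-1}}$, and $a_{p,1}e^{-|x|^{p^*}}$ when $\lambda=1$; * if $\lambda=1\ne\beta$: $\rho_{p,\beta,1}(x)=\mathfrak G_{p,\beta}(x)=a_{p,\beta,1}\exp\Big(-\frac{1}{|\beta-1|}G^{-1}\big(p^*|1-\tfrac1\beta|^{1/p^*}|x|\big)\Big)$, where $G(z)=\int_0^z t^{\frac1{p^*}-1}e^{-\operatorname{sign}(\beta-1)t}dt$ on $[0,\infty)$, and $\mathfrak G_{p,\beta}(x)=0$ if the argument of $G^{-1}$ is not in the range of $G$; * otherwise (generalized trigonometric density): $\rho_{p,\beta,\lambda}(y)=a_{p,\beta,\lambda}\big[\cosh_{\frac{1-\lambda}{\beta-\lambda},p^*}(\kappa_{p,\beta,\lambda}y)\big]^{\frac1{\lambda-\beta}}$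 if $\lambda<1$ and $\rho_{p,\beta,\lambda}(y)=a_{p,\beta,\lambda}\big[\cos_{\frac{\lambda-1}{\lambda-\beta},p^*}(\kappa_{p,\beta,\lambda}y)\big]^{\frac1{\lambda-\beta}}$ if $\lambda>1$, and $0$ where $\kappa_{p,\beta,\lambda}y$ is outside the domain of the generalized (hyperbolic) sine. For $p^*=\infty$, $\rho_{p,\beta,\lambda}=\mathbf 1_{(-1/2,1/2)}$. For $p^*=0$ (so $\lambda_0>1$) let $g(x)=\frac{1}{2\Gamma(\lambda_0/(\lambda_0-1))}(-\log|x|)_+^{\frac1{\lambda_0-1}}$, $y(x)=\int_0^x g(t)^{1-\frac1\gamma}dt$ for $|x|<1$, and $\rho_{p,\beta,\lambda}(y(x))=g(x)^{1/\gamma}$, $\rho_{p,\beta,\lambda}=0$ outside the range of $y(\cdot)$. **Theorem.** Define, for $0<p^*<\infty$, $$\overline K_{p,\beta,\lambda}=\begin{cases}\dfrac{(p^*\beta)^{\frac1{\lambda-1}}(1+\beta-\lambda)^{\frac1{p^*(1+\beta-\lambda)}}}{(p^*\beta+\lambda-1)^{\frac1{\lambda-1}+\frac1{p^*(1+\beta-\lambda)}}}\;a_{p,\beta,\lambda}^{\frac1{1+\beta-\lambda}}&\lambda\ne1,\\[4mm]\left(\dfrac{(p^*)^{1/p}e^{-1/p^*}}{2\Gamma(1/p^*)}\right)^{1/\beta}&\lambda=1,\end{cases}$$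 and the limiting values $\overline K=\Big(\frac{e^{-m}m^{\gamma/(\lambda-1)}}{2\Gamma(m)}\Big)^{1/\gamma}$ with $m=\frac{\beta}{\lambda-1}$ for $p^*=0$, and $\overline K=2^{-1/\gamma}$ for $p^*=\infty$. Then $\overline K_{p,\beta,\lambda}>0$; $\rho_{p,\beta,\lambda}$ is a $C^1$ density with $0<N_\lambda[\rho_{p,\beta,\lambda}]<\infty$ and $$\frac{\sigma_{p^*,1+\beta-\lambda}[\rho_{p,\beta,\lambda}]}{N_\lambda[\rho_{p,\beta,\lambda}]}=\overline K_{p,\beta,\lambda}.$$ For every $C^1$ density $f$, $\ \overline K_{p,\beta,\lambda}\,N_\lambda[f]\le\sigma_{p^*,1+\beta-\lambda}[f]$ in $[0,\infty]$; and if $0<N_\lambda[f]<\infty$, then $$\frac{\sigma_{p^*,1+\beta-\lambda}[f]}{N_\lambda[f]}\ \ge\ \overline K_{p,\beta,\lambda},$$ with equality if and only if there is $\kappa>0$ with $f(x)=\kappa\,\rho_{p,\beta,\lambda}(\kappa x)$ for almost every $x$. -/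

import Mathlib

open MeasureTheory Set
open scoped ENNReal

noncomputable section

namespace CumulativeMoments

/-- A continuously differentiable probability density: a nonnegative function of total mass one
which vanishes outside some open interval `X` and is `C¹` on `X`, except possibly at the origin.
Every density that is `C¹` on the whole line qualifies (with `X = ℝ`); the wider class also holds
the extremal densities, which may have a kink at the origin (such as the Laplace density) or fail
to be `C¹` at the ends of a bounded support. -/
structure IsC1Density (f : ℝ → ℝ) : Prop where
  nonneg : ∀ x, 0 ≤ f x
  mass_one : ∫⁻ x, ENNReal.ofReal (f x) = 1
  contDiff : ∃ X : Set ℝ, IsOpen X ∧ X.OrdConnected ∧ ContDiffOn ℝ 1 f (X \ {0}) ∧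
    ∀ x, x ∉ X → f x = 0

/-! ### Functionals of a density, with values in `[0, ∞]` -/

/-- The mean of an extended real valued function under `f`: mean of the positive part minus mean
of the negative part. -/
def mean (φ : ℝ → EReal) (f : ℝ → ℝ) : EReal :=
  ((∫⁻ x, (φ x).toENNReal * ENNReal.ofReal (f x) : ℝ≥0∞) : EReal) -
    ((∫⁻ x, (-φ x).toENNReal * ENNReal.ofReal (f x) : ℝ≥0∞) : EReal)

/-- The Rényi entropy power, the mean of `f ^ (lam - 1)` under `f` to the power `1 / (1 - lam)`;
for `lam = 1` the exponential of the Shannon entropy. -/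
def entropyPower (lam : ℝ) (f : ℝ → ℝ) : ℝ≥0∞ :=
  if lam = 1 then EReal.exp (mean (fun x => -(ENNReal.ofReal (f x)).log) f)
  else (∫⁻ x, ENNReal.ofReal (f x) ^ (lam - 1) * ENNReal.ofReal (f x)) ^ (1 / (1 - lam))

/-- `|∫₀ˣ f(t) ^ (1 - γ) dt|`, with the conventions `0 ^ s = ∞` for `s < 0` and `0 ^ 0 = 1`. -/
def absCumulative (γ : ℝ) (f : ℝ → ℝ) (x : ℝ) : ℝ≥0∞ :=
  ∫⁻ t in Set.uIoc 0 x, ENNReal.ofReal (f t) ^ (1 - γ)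

/-- The generalized absolute cumulative moment of order `(q, γ)`. -/
def absCumulativeMoment (q γ : ℝ) (f : ℝ → ℝ) : ℝ≥0∞ :=
  ∫⁻ x, absCumulative γ f x ^ q * ENNReal.ofReal (f x)

/-- The cumulative deviation of order `(q, γ)`, where `q = 0` is the geometric mean and `q = ∞`
the essential supremum on the support. -/
def cumulativeDeviation (q : ℝ≥0∞) (γ : ℝ) (f : ℝ → ℝ) : ℝ≥0∞ :=
  if q = 0 then EReal.exp (mean (fun x => (absCumulative γ f x).log) f) ^ (1 / γ)
  else if q = ∞ then (essSup (absCumulative γ f) (volume.restrict {x | 0 < f x})) ^ (1 / γ)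
  else absCumulativeMoment q.toReal γ f ^ (1 / (q.toReal * γ))

/-! ### Generalized trigonometric functions -/

def arcsinGen (v w y : ℝ) : ℝ := ∫ t in (0 : ℝ)..y, (1 - |t| ^ w) ^ (-(1 / v))

/-- The generalized sine, on its primary domain `arcsinGen v w '' (-1, 1)`. -/
def sinGen (v w : ℝ) : ℝ → ℝ := Function.invFunOn (arcsinGen v w) (Ioo (-1) 1)

def cosGen (v w : ℝ) : ℝ → ℝ := deriv (sinGen v w)

def arsinhGen (v w y : ℝ) : ℝ := ∫ t in (0 : ℝ)..y, (1 + |t| ^ w) ^ (-(1 / v))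

/-- The generalized hyperbolic sine, on its domain, the range of `arsinhGen v w`. -/
def sinhGen (v w : ℝ) : ℝ → ℝ := Function.invFunOn (arsinhGen v w) univ

def coshGen (v w : ℝ) : ℝ → ℝ := deriv (sinhGen v w)

/-! ### The extremal densities

Throughout, a real `q > 0` is the Hölder conjugate `p*` of `p`, so that `1 / p = 1 - 1 / q`. -/

/-- The Tsallis exponential. -/
def tsallisExp (lam x : ℝ) : ℝ :=
  if lam = 1 then Real.exp x else (max 0 (1 + (1 - lam) * x)) ^ (1 / (1 - lam))

/-- The normalization constant of the stretched deformed Gaussian. -/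
def gaussConst (q lam : ℝ) : ℝ :=
  if lam = 1 then q / (2 * Real.Gamma (1 / q))
  else q * |1 - lam| ^ (1 / q) /
    (2 * ProbabilityTheory.beta (1 / q)
      (lam / |1 - lam| + if lam ≤ 1 then 1 - 1 / q else 0))

/-- The stretched deformed Gaussian density. -/
def stretchedGaussian (q lam x : ℝ) : ℝ := gaussConst q lam * tsallisExp (2 - lam) (-(|x| ^ q))

/-- The normalization constant of the three-parameter family. -/
def triConst (q β lam : ℝ) : ℝ := gaussConst q (β / (1 + β - lam))

def triScale (q β lam : ℝ) : ℝ := |(lam - 1) / (1 + β - lam)| ^ (1 / q)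

open Classical in
/-- The generalized trigonometric density (for `lam ≠ 1`, `lam ≠ β`), extended by zero. -/
def trigDensity (q β lam y : ℝ) : ℝ :=
  if lam < 1 then
    if triScale q β lam * y ∈ range (arsinhGen ((1 - lam) / (β - lam)) q) then
      triConst q β lam *
        coshGen ((1 - lam) / (β - lam)) q (triScale q β lam * y) ^ (1 / (lam - β))
    else 0
  else
    if triScale q β lam * y ∈ arcsinGen ((lam - 1) / (lam - β)) q '' Ioo (-1) 1 then
      triConst q β lam *
        cosGen ((lam - 1) / (lam - β)) q (triScale q β lam * y) ^ (1 / (lam - β))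
    else 0

/-- The lower incomplete Gamma function when `s = 1`, and its analogue with the growing
exponential when `s = -1`. -/
def incGamma (s a z : ℝ) : ℝ := ∫ t in (0 : ℝ)..z, t ^ (a - 1) * Real.exp (-(s * t))

open Classical in
/-- The density `𝔊` of the case `lam = 1` (for `β ≠ 1`), extended by zero. For `β > 1` it is
`a * exp (-G (q * (1 - 1 / β) ^ (1 / q) * |x|) / (β - 1))`, with `G` the inverse of the lower
incomplete Gamma function of parameter `1 / q`. -/
def gammaDensity (q β x : ℝ) : ℝ :=
  if q * |1 - 1 / β| ^ (1 / q) * |x| ∈ incGamma (SignType.sign (β - 1)) (1 / q) '' Ici 0 then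
    triConst q β 1 *
      Real.exp (-(Function.invFunOn (incGamma (SignType.sign (β - 1)) (1 / q)) (Ici 0)
        (q * |1 - 1 / β| ^ (1 / q) * |x|) / |β - 1|))
  else 0

/-- The extremal density in the limit case `q = 0`, `lam > 1`, of the stretched Gaussian. -/
def logDensity (lam x : ℝ) : ℝ :=
  1 / (2 * Real.Gamma (lam / (lam - 1))) * (max 0 (-Real.log |x|)) ^ (1 / (lam - 1))

open Classical in
/-- The differential-escort transform of order `α` of a density `f` on the interval `X ∋ 0`,
extended by zero. -/
def diffEscort (α : ℝ) (X : Set ℝ) (f : ℝ → ℝ) (y : ℝ) : ℝ :=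
  if y ∈ (fun x => ∫ t in (0 : ℝ)..x, f t ^ (1 - α)) '' X then
    f (Function.invFunOn (fun x => ∫ t in (0 : ℝ)..x, f t ^ (1 - α)) X y) ^ α
  else 0

/-- The minimizing density `ρ_{p,β,lam}`, in terms of `q = p* ∈ [0, ∞]`. For `q = 0` it is the
differential-escort transform of the logarithmic density, for `q = ∞` it is uniform. -/
def minDensity (q : ℝ≥0∞) (β lam : ℝ) : ℝ → ℝ :=
  if q = 0 then
    diffEscort (1 / (1 + β - lam)) (Ioo (-1) 1) (logDensity (β / (1 + β - lam)))
  else if q = ∞ then (Ioo (-(1 / 2)) (1 / 2)).indicator 1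
  else if β = lam then stretchedGaussian q.toReal lam
  else if lam = 1 then gammaDensity q.toReal β
  else trigDensity q.toReal β lam

/-- The optimal constant; for `q = 0` and `q = ∞` the limits of the general expression. -/
def optConst (q : ℝ≥0∞) (β lam : ℝ) : ℝ :=
  if q = 0 then
    (Real.exp (-(β / (lam - 1))) * (β / (lam - 1)) ^ ((1 + β - lam) / (lam - 1)) /
      (2 * Real.Gamma (β / (lam - 1)))) ^ (1 / (1 + β - lam))
  else if q = ∞ then (1 / 2) ^ (1 / (1 + β - lam))
  else if lam = 1 then
    (q.toReal ^ (1 - 1 / q.toReal) * Real.exp (-(1 / q.toReal)) /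
      (2 * Real.Gamma (1 / q.toReal))) ^ (1 / β)
  else
    (q.toReal * β) ^ (1 / (lam - 1)) *
        (1 + β - lam) ^ (1 / (q.toReal * (1 + β - lam))) /
      (q.toReal * β + lam - 1) ^ (1 / (lam - 1) + 1 / (q.toReal * (1 + β - lam))) *
      triConst q.toReal β lam ^ (1 / (1 + β - lam))

end CumulativeMoments

end

/-! Write `W` for the cumulative function of `f` and take `y = W(x)`, with `dy = f ^ (1 - γ) dx`, as
a new variable on each half-line. Then `f dx = f ^ γ dy`, so `f ^ γ`, read as a function of `y`, is
again a density. The cumulative deviation becomes an ordinary absolute moment in `y`, and `∫ f ^ lam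
dx` becomes the integral of the `s`-th power of the new density, where `γ * s = lam + γ - 1`, that
is `s = β / γ`. The theorem is thereby the classical moment-entropy inequality of exponent `s`,
whose extremals are the stretched Gaussian (`0 < q < ∞`), the uniform density (`q = ∞`) and a
logarithmic density (`q = 0`).

The change of variables is not carried out for a general `f`, whose `W` may be infinite, constant on
intervals or bounded. Instead `f ^ γ` is compared pointwise with `v(W)`, where `v` is the extremal
profile on the half-line. The tangent inequality for `u ↦ u ^ s` (for the logarithm if `s = 1`) at
`u = f ^ γ`, `w = v(W)`, multiplied by `f ^ (1 - γ)` and integrated, has three terms. The first is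
`∫ f ^ lam`. The second is at most a multiple of `2 ∫ v ^ s`, since `W` sends `f ^ (1 - γ) dx` on
each half-line to Lebesgue measure on an initial segment (`lintegral_comp_absCumulative_le`). The
cross term `∫ v(W) ^ (s - 1) f` is controlled by the deviation, because `v ^ (s - 1)` is, on the
support of `v`, affine in `y ^ q`, proportional to `-log y`, or constant. This yields the maximum
entropy principles `entropyPower_le_of_one_lt`, `entropyPower_le_of_lt_one` and
`entropyPower_le_of_eq_one` at fixed deviation. Both functionals scale alike under dilations, so
`sharp_of_normalized` turns them into the sharp inequality for the quotient.

Equality forces `f ^ γ = v(W)` almost everywhere, a separable equation for `W`. Its solution is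
inverted by `escortMap`, with `dx = v ^ ((γ - 1) / γ) dy`, and is unique among the admissible
densities (`IsC1Density.ae_eq_of_ae_eq_profile`). It remains to recognize the explicit densities, up
to a dilation, as the escort densities of the profiles: for the stretched Gaussian the escort map is
a generalized (hyperbolic) arcsine, or an incomplete Gamma function when `lam = 1`. -/

namespace CumulativeMoments

/-! ### Change of variables along a cumulative integral -/

/-- The cumulative integral of `h` from the origin. -/
noncomputable def cumul (h : ℝ → ℝ≥0∞) (x : ℝ) : ℝ≥0∞ := ∫⁻ t in Ioc 0 x, h t

theorem cumul_mono (h : ℝ → ℝ≥0∞) : Monotone (cumul h) := fun _ _ hxy =>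
  lintegral_mono_set (Ioc_subset_Ioc_right hxy)

theorem measurable_cumul (h : ℝ → ℝ≥0∞) : Measurable (cumul h) := (cumul_mono h).measurable

theorem cumul_zero (h : ℝ → ℝ≥0∞) : cumul h 0 = 0 := by simp [cumul]

theorem continuousOn_toReal_cumul {h : ℝ → ℝ≥0∞} (hm : Measurable h) {X : ℝ}
    (hX : cumul h X ≠ ∞) : ContinuousOn (fun x => (cumul h x).toReal) (Icc 0 X) := by
  have hi : IntegrableOn (fun t => (h t).toReal) (Icc 0 X) := by
    rw [integrableOn_Icc_iff_integrableOn_Ioc]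
    exact integrable_toReal_of_lintegral_ne_top hm.aemeasurable hX
  refine (intervalIntegral.continuousOn_primitive hi).congr fun x hx => ?_
  have hfin : cumul h x ≠ ∞ := ne_top_of_le_ne_top hX (cumul_mono h hx.2)
  exact (integral_toReal hm.aemeasurable (ae_lt_top hm hfin)).symm

/-- Both measures are finite, so half-lines `Iic c` suffice. The sublevel set of the continuous
monotone function `cumul h` at level `c` is an interval `(0, x₂]`, whose `h`-mass is the value at
`x₂`, namely `c`. No injectivity is involved: `h` may vanish on intervals. -/
theorem map_cumul {h : ℝ → ℝ≥0∞} (hm : Measurable h) {X : ℝ} (hX0 : 0 ≤ X)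
    (hX : cumul h X ≠ ∞) :
    ((volume.restrict (Ioc 0 X)).withDensity h).map (fun x => (cumul h x).toReal) =
      volume.restrict (Ioc 0 (cumul h X).toReal) := by
  have hHm : Measurable fun x => (cumul h x).toReal := (measurable_cumul h).ennreal_toReal
  have hfin : ∀ x ≤ X, cumul h x ≠ ∞ := fun x hx => ne_top_of_le_ne_top hX (cumul_mono h hx)
  have hmono : ∀ x y, x ≤ y → y ≤ X → (cumul h x).toReal ≤ (cumul h y).toReal := fun x y hxy hy =>
    ENNReal.toReal_mono (hfin y hy) (cumul_mono h hxy)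
  have : IsFiniteMeasure ((volume.restrict (Ioc 0 X)).withDensity h) :=
    isFiniteMeasure_withDensity hX
  refine Measure.ext_of_Iic _ _ fun c => ?_
  rw [Measure.map_apply hHm measurableSet_Iic, withDensity_apply _ (hHm measurableSet_Iic),
    Measure.restrict_restrict (hHm measurableSet_Iic), Measure.restrict_apply measurableSet_Iic]
  rcases lt_or_ge c 0 with hc | hc
  · have h1 : (fun x => (cumul h x).toReal) ⁻¹' Iic c ∩ Ioc 0 X = ∅ := by
      ext x
      simp only [mem_inter_iff, mem_preimage, mem_Iic, mem_empty_iff_false, iff_false, not_and]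
      intro h2
      exact absurd (h2.trans_lt hc) (not_lt.2 ENNReal.toReal_nonneg)
    have h2 : Iic c ∩ Ioc 0 (cumul h X).toReal = ∅ := by
      ext y
      simp only [mem_inter_iff, mem_Iic, mem_Ioc, mem_empty_iff_false, iff_false]
      rintro ⟨h3, h4, -⟩
      linarith
    simp [h1, h2]
  rcases le_or_gt (cumul h X).toReal c with hcX | hcX
  · have h1 : (fun x => (cumul h x).toReal) ⁻¹' Iic c ∩ Ioc 0 X = Ioc 0 X :=
      inter_eq_right.2 fun x hx => (hmono x X hx.2 le_rfl).trans hcX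
    have h2 : Iic c ∩ Ioc 0 (cumul h X).toReal = Ioc 0 (cumul h X).toReal :=
      inter_eq_right.2 fun y hy => hy.2.trans hcX
    rw [h1, h2, Real.volume_Ioc, sub_zero, ENNReal.ofReal_toReal hX, cumul]
  · have hcont := continuousOn_toReal_cumul hm hX
    have hA : IsCompact (Icc 0 X ∩ (fun x => (cumul h x).toReal) ⁻¹' Iic c) :=
      isCompact_Icc.of_isClosed_subset (hcont.preimage_isClosed_of_isClosed isClosed_Icc
        isClosed_Iic) inter_subset_left
    obtain ⟨x₁, hx₁, hx₁c⟩ := intermediate_value_Icc hX0 hcont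
      (show c ∈ Icc _ _ from ⟨by simpa [cumul_zero] using hc, hcX.le⟩)
    -- The level set may be a whole interval; its greatest point makes the sublevel set exactly `(0,
    -- x₂]`.
    obtain ⟨x₂, ⟨hx₂, hx₂c⟩, hub⟩ := hA.exists_isGreatest ⟨x₁, hx₁, hx₁c.le⟩
    have h1 : (fun x => (cumul h x).toReal) ⁻¹' Iic c ∩ Ioc 0 X = Ioc 0 x₂ := by
      ext x
      refine ⟨fun hx => ⟨hx.2.1, hub ⟨Ioc_subset_Icc_self hx.2, hx.1⟩⟩, fun hx => ⟨?_, hx.1,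
        hx.2.trans hx₂.2⟩⟩
      exact (hmono x x₂ hx.2 hx₂.2).trans hx₂c
    have h2 : Iic c ∩ Ioc 0 (cumul h X).toReal = Ioc 0 c := by
      ext y
      simp only [mem_inter_iff, mem_Iic, mem_Ioc]
      exact ⟨fun hy => ⟨hy.2.1, hy.1⟩, fun hy => ⟨hy.2, hy.1, hy.2.trans hcX.le⟩⟩
    have h3 : (cumul h x₂).toReal = c :=
      le_antisymm hx₂c (hx₁c ▸ hmono x₁ x₂ (hub ⟨hx₁, hx₁c.le⟩) hx₂.2)
    rw [h1, h2, Real.volume_Ioc, sub_zero, ← h3, ENNReal.ofReal_toReal (hfin x₂ hx₂.2), cumul]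

theorem lintegral_comp_cumul_Ioc {h : ℝ → ℝ≥0∞} (hm : Measurable h) {X : ℝ} (hX0 : 0 ≤ X)
    (hX : cumul h X ≠ ∞) {g : ℝ → ℝ≥0∞} (hg : Measurable g) :
    ∫⁻ x in Ioc 0 X, g (cumul h x).toReal * h x = ∫⁻ y in Ioc 0 (cumul h X).toReal, g y := by
  have hHm : Measurable fun x => (cumul h x).toReal := (measurable_cumul h).ennreal_toReal
  rw [← map_cumul hm hX0 hX, lintegral_map hg hHm]
  refine ((lintegral_withDensity_eq_lintegral_mul _ hm (hg.comp hHm)).trans ?_).symm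
  simp_rw [Pi.mul_apply, mul_comm, Function.comp_def]

/-- Only a greatest element of `J` can be missed. The countable directed union reduces integrals
over `J` to intervals `(0, r]` by monotone convergence. -/
theorem ae_eq_iUnion_Ioc_rat {J : Set ℝ} (hJ0 : J ⊆ Ioi 0)
    (hJ : ∀ y ∈ J, ∀ x, 0 < x → x ≤ y → x ∈ J) :
    J =ᵐ[volume] ⋃ r : {r : ℚ // (r : ℝ) ∈ J}, Ioc (0 : ℝ) r := by
  have h1 : (⋃ r : {r : ℚ // (r : ℝ) ∈ J}, Ioc (0 : ℝ) r) ⊆ J :=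
    iUnion_subset fun r x hx => hJ _ r.2 _ hx.1 hx.2
  have h2 : (J \ ⋃ r : {r : ℚ // (r : ℝ) ∈ J}, Ioc (0 : ℝ) r).Subsingleton := by
    intro x hx y hy
    by_contra hne
    wlog hxy : x < y generalizing x y
    · exact this hy hx (Ne.symm hne) (lt_of_le_of_ne (not_lt.1 hxy) (Ne.symm hne))
    obtain ⟨r, hr1, hr2⟩ := exists_rat_btwn hxy
    have hx0 : 0 < x := hJ0 hx.1
    exact hx.2 (mem_iUnion.2 ⟨⟨r, hJ y hy.1 r (hx0.trans hr1) hr2.le⟩, hx0, hr1.le⟩)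
  refine (ae_eq_set.2 ⟨h2.measure_zero _, ?_⟩)
  rw [sdiff_eq_empty.2 h1, measure_empty]

theorem directed_Ioc_image {J : Set ℝ} {H : ℝ → ℝ} (hH : MonotoneOn H J) :
    Directed (· ⊆ ·) fun r : {r : ℚ // (r : ℝ) ∈ J} => Ioc (0 : ℝ) (H r) := by
  intro a b
  rcases le_total a.1 b.1 with hab | hab
  · exact ⟨b, Ioc_subset_Ioc_right (hH a.2 b.2 (by exact_mod_cast hab)), subset_rfl⟩
  · exact ⟨a, subset_rfl, Ioc_subset_Ioc_right (hH b.2 a.2 (by exact_mod_cast hab))⟩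

/-- The change of variables `y = ∫₀ˣ h` on an initial segment `J` of the positive half-line. -/
theorem lintegral_comp_cumul {h : ℝ → ℝ≥0∞} (hm : Measurable h) {J : Set ℝ} (hJ0 : J ⊆ Ioi 0)
    (hJ : ∀ y ∈ J, ∀ x, 0 < x → x ≤ y → x ∈ J) (hfin : ∀ x ∈ J, cumul h x ≠ ∞)
    {g : ℝ → ℝ≥0∞} (hg : Measurable g) :
    ∫⁻ x in J, g (cumul h x).toReal * h x =
      ∫⁻ y in ⋃ r : {r : ℚ // (r : ℝ) ∈ J}, Ioc 0 (cumul h r).toReal, g y := by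
  have hmono : MonotoneOn (fun x => (cumul h x).toReal) J := fun x _ y hy hxy =>
    ENNReal.toReal_mono (hfin y hy) (cumul_mono h hxy)
  rw [setLIntegral_congr (ae_eq_iUnion_Ioc_rat hJ0 hJ),
    setLIntegral_iUnion_of_directed _ (directed_Ioc_image (H := fun x => x) monotoneOn_id),
    setLIntegral_iUnion_of_directed _ (directed_Ioc_image hmono)]
  exact iSup_congr fun r => lintegral_comp_cumul_Ioc hm (hJ0 r.2).le (hfin _ r.2) hg

/-- Only an inequality, since the cumulative integral may stay bounded and then covers an initial
segment only. -/
theorem lintegral_comp_cumul_le {h : ℝ → ℝ≥0∞} (hm : Measurable h)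
    {g : ℝ → ℝ≥0∞} (hg : Measurable g) :
    ∫⁻ x in {x | 0 < x ∧ cumul h x ≠ ∞}, g (cumul h x).toReal * h x ≤ ∫⁻ y in Ioi 0, g y := by
  rw [lintegral_comp_cumul hm (J := {x | 0 < x ∧ cumul h x ≠ ∞}) (fun x hx => hx.1)
    (fun y hy x hx hxy => ⟨hx, ne_top_of_le_ne_top hy.2 (cumul_mono h hxy)⟩) (fun x hx => hx.2) hg]
  exact lintegral_mono_set (iUnion_subset fun r y hy => hy.1)

/-- A primitive, as an increasing change of variables. -/
theorem lintegral_comp_cumul_surj {h : ℝ → ℝ≥0∞} (hm : Measurable h) {J R : Set ℝ} (hJ0 : J ⊆ Ioi 0)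
    (hJ : ∀ y ∈ J, ∀ x, 0 < x → x ≤ y → x ∈ J) (hJo : IsOpen J) (hfin : ∀ x ∈ J, cumul h x ≠ ∞)
    (hR : (fun x => (cumul h x).toReal) '' J = R) (hR0 : R ⊆ Ioi 0)
    {g : ℝ → ℝ≥0∞} (hg : Measurable g) :
    ∫⁻ x in J, g (cumul h x).toReal * h x = ∫⁻ y in R, g y := by
  rw [lintegral_comp_cumul hm hJ0 hJ hfin hg]
  congr 2
  have hmono : ∀ x y, x ≤ y → y ∈ J → (cumul h x).toReal ≤ (cumul h y).toReal := fun x y hxy hy =>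
    ENNReal.toReal_mono (hfin y hy) (cumul_mono h hxy)
  apply subset_antisymm
  · refine iUnion_subset fun r y hy => ?_
    have h0 : (0 : ℝ) ≤ (r : ℚ) := (hJ0 r.2).le
    have hcont := continuousOn_toReal_cumul hm (hfin _ r.2)
    obtain ⟨x, hx, hxy⟩ := intermediate_value_Icc h0 hcont
      (show y ∈ Icc _ _ from ⟨by simpa [cumul_zero] using hy.1.le, hy.2⟩)
    have hx0 : 0 < x := by
      rcases hx.1.eq_or_lt with h1 | h1
      · rw [← h1] at hxy
        simp only [cumul_zero, ENNReal.toReal_zero] at hxy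
        exact absurd hy.1 (by rw [← hxy]; exact lt_irrefl _)
      · exact h1
    rw [← hR]
    exact ⟨x, hJ _ r.2 x hx0 hx.2, hxy⟩
  · rw [← hR]
    rintro _ ⟨x, hx, rfl⟩
    obtain ⟨ε, hε, hball⟩ := Metric.isOpen_iff.1 hJo x hx
    obtain ⟨r, hr1, hr2⟩ := exists_rat_btwn (show x < x + ε by linarith)
    have hrJ : (r : ℝ) ∈ J := hball (by
      rw [Metric.mem_ball, Real.dist_eq, abs_lt]; constructor <;> linarith)
    exact mem_iUnion.2 ⟨⟨r, hrJ⟩, hR0 (hR ▸ mem_image_of_mem _ hx), hmono _ _ hr1.le hrJ⟩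

/-! ### Splitting along the two half-lines -/

theorem lintegral_eq_Ioi_add_neg (F : ℝ → ℝ≥0∞) :
    ∫⁻ x, F x = (∫⁻ x in Ioi 0, F x) + ∫⁻ x in Ioi 0, F (-x) := by
  have h1 := (Measure.measurePreserving_neg (volume : Measure ℝ)).setLIntegral_comp_preimage_emb
    (Homeomorph.neg ℝ).measurableEmbedding F (Iio 0)
  have h2 : Neg.neg ⁻¹' Iio (0 : ℝ) = Ioi 0 := by ext; simp
  rw [h2] at h1
  rw [h1, ← setLIntegral_congr Iio_ae_eq_Iic.symm,
    ← lintegral_add_compl F (measurableSet_Ioi (a := (0 : ℝ))), compl_Ioi]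

theorem absCumulative_of_nonneg (γ : ℝ) (f : ℝ → ℝ) {x : ℝ} (hx : 0 ≤ x) :
    absCumulative γ f x = cumul (fun t => ENNReal.ofReal (f t) ^ (1 - γ)) x := by
  rw [absCumulative, uIoc_of_le hx, cumul]

/-- Carries every statement about the positive half-line over to the negative one. -/
theorem absCumulative_neg (γ : ℝ) (f : ℝ → ℝ) (x : ℝ) :
    absCumulative γ f (-x) = absCumulative γ (fun t => f (-t)) x := by
  have h1 := (Measure.measurePreserving_neg (volume : Measure ℝ)).setLIntegral_comp_preimage_emb
    (Homeomorph.neg ℝ).measurableEmbedding (fun t => ENNReal.ofReal (f t) ^ (1 - γ)) (uIoc 0 (-x))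
  rw [absCumulative, ← h1, absCumulative]
  refine setLIntegral_congr ?_
  rcases le_total 0 x with hx | hx
  · rw [uIoc_of_ge (neg_nonpos.2 hx), uIoc_of_le hx]
    have : Neg.neg ⁻¹' Ioc (-x) 0 = Ico 0 x := by ext; simp [and_comm]
    rw [this]
    exact Ico_ae_eq_Ioc
  · rw [uIoc_of_le (neg_nonneg.2 hx), uIoc_of_ge hx]
    have : Neg.neg ⁻¹' Ioc 0 (-x) = Ico x 0 := by ext; simp
    rw [this]
    exact Ico_ae_eq_Ioc

theorem measurable_absCumulative (γ : ℝ) (f : ℝ → ℝ) : Measurable (absCumulative γ f) := by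
  have h1 : ∀ g : ℝ → ℝ, Measurable fun x => cumul (fun t => ENNReal.ofReal (g t) ^ (1 - γ)) x :=
    fun g => measurable_cumul _
  have h2 : absCumulative γ f = fun x => if 0 ≤ x then
      cumul (fun t => ENNReal.ofReal (f t) ^ (1 - γ)) x else
      cumul (fun t => ENNReal.ofReal (f (-t)) ^ (1 - γ)) (-x) := by
    ext x
    split_ifs with hx
    · exact absCumulative_of_nonneg γ f hx
    · rw [← neg_neg x, absCumulative_neg, absCumulative_of_nonneg _ _ (by linarith), neg_neg]
  rw [h2]
  exact Measurable.ite measurableSet_Ici (h1 _) ((h1 _).comp measurable_neg)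

/-- Each half-line sends the weight `f ^ (1 - γ) dx` to Lebesgue measure on a part of `(0, ∞)`,
hence the factor two. -/
theorem lintegral_comp_absCumulative_le (γ : ℝ) {f : ℝ → ℝ} (hf : Measurable f)
    {g : ℝ → ℝ≥0∞} (hg : Measurable g) :
    ∫⁻ x in {x | absCumulative γ f x ≠ ∞},
        g (absCumulative γ f x).toReal * ENNReal.ofReal (f x) ^ (1 - γ) ≤
      2 * ∫⁻ y in Ioi 0, g y := by
  have hS : MeasurableSet {x | absCumulative γ f x ≠ ∞} :=
    (measurable_absCumulative γ f) (measurableSet_singleton ∞).compl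
  have key : ∀ f : ℝ → ℝ, Measurable f → ∫⁻ x in Ioi 0, {x | absCumulative γ f x ≠ ∞}.indicator
      (fun x => g (absCumulative γ f x).toReal * ENNReal.ofReal (f x) ^ (1 - γ)) x ≤
      ∫⁻ y in Ioi 0, g y := by
    intro f hf
    have hS : MeasurableSet {x | absCumulative γ f x ≠ ∞} :=
      (measurable_absCumulative γ f) (measurableSet_singleton ∞).compl
    have h1 := lintegral_comp_cumul_le (h := fun t => ENNReal.ofReal (f t) ^ (1 - γ))
      (hf.ennreal_ofReal.pow_const _) hg
    refine le_trans (le_of_eq ?_) h1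
    rw [setLIntegral_indicator hS]
    have h2 : {x | absCumulative γ f x ≠ ∞} ∩ Ioi 0 =
        {x | 0 < x ∧ cumul (fun t => ENNReal.ofReal (f t) ^ (1 - γ)) x ≠ ∞} := by
      ext x
      simp only [mem_inter_iff, mem_ofPred_eq, mem_Ioi]
      constructor
      · rintro ⟨h, hx⟩
        exact ⟨hx, by rwa [absCumulative_of_nonneg _ _ hx.le] at h⟩
      · rintro ⟨hx, h⟩
        exact ⟨by rwa [absCumulative_of_nonneg _ _ hx.le], hx⟩
    rw [h2]
    refine setLIntegral_congr_fun (h2 ▸ hS.inter measurableSet_Ioi) fun x hx => ?_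
    simp only [absCumulative_of_nonneg _ _ hx.1.le]
  rw [← lintegral_indicator hS, lintegral_eq_Ioi_add_neg, two_mul]
  refine add_le_add (key f hf) (le_trans (le_of_eq ?_) (key (fun x => f (-x))
    (hf.comp measurable_neg)))
  refine lintegral_congr fun x => ?_
  simp only [indicator, mem_ofPred_eq, absCumulative_neg]

theorem ofReal_max_zero (x : ℝ) : ENNReal.ofReal (max x 0) = ENNReal.ofReal x := by
  rcases le_total 0 x with h | h
  · rw [max_eq_left h]
  · rw [max_eq_right h, ENNReal.ofReal_of_nonpos h, ENNReal.ofReal_zero]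

/-! ### Pointwise Bernoulli inequalities -/

/-- The strictly convex function `u ↦ u ^ s` lies above its tangent at `w` and touches it only
there. The value `w = 0` is admitted because for `s > 1` the profiles vanish outside a bounded set.
-/
theorem bernoulli_of_one_lt {s u w : ℝ} (hs : 1 < s) (hu : 0 < u) (hw : 0 ≤ w) :
    s * (u * w ^ (s - 1)) ≤ u ^ s + (s - 1) * w ^ s ∧
      (s * (u * w ^ (s - 1)) = u ^ s + (s - 1) * w ^ s → u = w) := by
  rcases hw.eq_or_lt with rfl | hw
  · rw [Real.zero_rpow (by linarith), Real.zero_rpow (by linarith)]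
    have := Real.rpow_pos_of_pos hu s
    constructor
    · nlinarith
    · intro h; nlinarith
  by_cases h : u = w
  · subst h
    have : u * u ^ (s - 1) = u ^ s := by rw [mul_comm, Real.rpow_sub_one hu.ne']; field_simp
    rw [this]
    exact ⟨by linarith, fun _ => rfl⟩
  have h1 : u / w - 1 ≠ 0 := by
    rw [sub_ne_zero, ne_eq, div_eq_one_iff_eq hw.ne']; exact h
  have h2 := one_add_mul_self_lt_rpow_one_add (s := u / w - 1) (by
    have := div_pos hu hw; linarith) h1 hs
  have h3 : 1 + (u / w - 1) = u / w := by ring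
  rw [h3, Real.div_rpow hu.le hw.le, lt_div_iff₀ (Real.rpow_pos_of_pos hw _)] at h2
  have h4 : (1 + s * (u / w - 1)) * w ^ s = s * (u * w ^ (s - 1)) - (s - 1) * w ^ s := by
    rw [Real.rpow_sub_one hw.ne']; field_simp; ring
  rw [h4] at h2
  exact ⟨by linarith, fun h => by linarith⟩

/-- The concave counterpart. Here `w > 0` is needed, the exponent `s - 1` being negative. -/
theorem bernoulli_of_lt_one {s u w : ℝ} (hs0 : 0 < s) (hs : s < 1) (hu : 0 < u) (hw : 0 < w) :
    u ^ s ≤ s * (u * w ^ (s - 1)) + (1 - s) * w ^ s ∧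
      (u ^ s = s * (u * w ^ (s - 1)) + (1 - s) * w ^ s → u = w) := by
  by_cases h : u = w
  · subst h
    have : u * u ^ (s - 1) = u ^ s := by rw [mul_comm, Real.rpow_sub_one hu.ne']; field_simp
    rw [this]
    exact ⟨by linarith, fun _ => rfl⟩
  have h1 : u / w - 1 ≠ 0 := by
    rw [sub_ne_zero, ne_eq, div_eq_one_iff_eq hw.ne']; exact h
  have h2 := rpow_one_add_lt_one_add_mul_self (s := u / w - 1) (by
    have := div_pos hu hw; linarith) h1 hs0 hs
  have h3 : 1 + (u / w - 1) = u / w := by ring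
  rw [h3, Real.div_rpow hu.le hw.le, div_lt_iff₀ (Real.rpow_pos_of_pos hw _)] at h2
  have h4 : (1 + s * (u / w - 1)) * w ^ s = s * (u * w ^ (s - 1)) + (1 - s) * w ^ s := by
    rw [Real.rpow_sub_one hw.ne']; field_simp; ring
  rw [h4] at h2
  exact ⟨by linarith, fun h => by linarith⟩

/-- The tangent of the logarithm at one, evaluated at `w / u`; it replaces the Bernoulli inequality
when `s = 1`. -/
theorem log_tangent {u w : ℝ} (hu : 0 < u) (hw : 0 < w) :
    u * (Real.log w - Real.log u) ≤ w - u ∧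
      (u * (Real.log w - Real.log u) = w - u → u = w) := by
  by_cases h : u = w
  · subst h; simp
  have h1 := Real.log_lt_sub_one_of_pos (div_pos hw hu) (by
    rw [ne_eq, div_eq_one_iff_eq hu.ne']; exact fun h' => h h'.symm)
  rw [Real.log_div hw.ne' hu.ne'] at h1
  have h2 : u * (Real.log w - Real.log u) < u * (w / u - 1) := mul_lt_mul_of_pos_left h1 hu
  have h3 : u * (w / u - 1) = w - u := by field_simp
  rw [h3] at h2
  exact ⟨h2.le, fun h => by linarith⟩

/-! ### Comparison of entropies -/

theorem measurableSet_pos {f : ℝ → ℝ} (hf : Measurable f) : MeasurableSet {x | 0 < f x} :=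
  measurableSet_lt measurable_const hf

theorem lintegral_mul_ofReal_eq {f : ℝ → ℝ} (hf : Measurable f) (F : ℝ → ℝ≥0∞) :
    ∫⁻ x, F x * ENNReal.ofReal (f x) = ∫⁻ x in {x | 0 < f x}, F x * ENNReal.ofReal (f x) := by
  rw [← lintegral_indicator (measurableSet_pos hf)]
  refine lintegral_congr fun x => ?_
  by_cases hx : 0 < f x
  · rw [indicator_of_mem (show x ∈ {x | 0 < f x} from hx)]
  · rw [indicator_of_notMem (show x ∉ {x | 0 < f x} from hx),
      ENNReal.ofReal_of_nonpos (not_lt.1 hx), mul_zero]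

section comparison

variable {γ s lam : ℝ} {f v : ℝ → ℝ}

theorem lintegral_profile_le (γ : ℝ) (hf : Measurable f) (hv : Measurable v) (r : ℝ)
    (hW : ∀ᵐ x, 0 < f x → absCumulative γ f x ≠ ∞) :
    ∫⁻ x in {x | 0 < f x}, ENNReal.ofReal (v (absCumulative γ f x).toReal) ^ r *
        ENNReal.ofReal (f x) ^ (1 - γ) ≤ 2 * ∫⁻ y in Ioi 0, ENNReal.ofReal (v y) ^ r :=
  (lintegral_mono_set' hW).trans
    (lintegral_comp_absCumulative_le γ hf (hv.ennreal_ofReal.pow_const r))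

/-- The Bernoulli inequality for a density `f` compared with the profile `v` evaluated at its
cumulative function, integrated; the case of exponents above one. -/
theorem lintegral_bernoulli_of_one_lt (hs : 1 < s) (hγ : γ * s = lam + γ - 1)
    (hf : Measurable f) (hv : Measurable v) (hv0 : ∀ y, 0 ≤ v y)
    (hW : ∀ᵐ x, 0 < f x → absCumulative γ f x ≠ ∞) :
    ENNReal.ofReal s * ∫⁻ x in {x | 0 < f x},
        ENNReal.ofReal (v (absCumulative γ f x).toReal) ^ (s - 1) * ENNReal.ofReal (f x) ≤
      (∫⁻ x, ENNReal.ofReal (f x) ^ (lam - 1) * ENNReal.ofReal (f x)) +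
        ENNReal.ofReal (s - 1) * (2 * ∫⁻ y in Ioi 0, ENNReal.ofReal (v y) ^ s) ∧
    ((2 * ∫⁻ y in Ioi 0, ENNReal.ofReal (v y) ^ s) ≠ ∞ →
      2 * ∫⁻ y in Ioi 0, ENNReal.ofReal (v y) ^ s ≤ ∫⁻ x in {x | 0 < f x},
        ENNReal.ofReal (v (absCumulative γ f x).toReal) ^ (s - 1) * ENNReal.ofReal (f x) →
      2 * ∫⁻ y in Ioi 0, ENNReal.ofReal (v y) ^ s ≤
        (∫⁻ x, ENNReal.ofReal (f x) ^ (lam - 1) * ENNReal.ofReal (f x)) ∧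
      ((∫⁻ x, ENNReal.ofReal (f x) ^ (lam - 1) * ENNReal.ofReal (f x)) =
          2 * ∫⁻ y in Ioi 0, ENNReal.ofReal (v y) ^ s →
        ∀ᵐ x, 0 < f x → f x ^ γ = v (absCumulative γ f x).toReal)) := by
  have hT := measurableSet_pos hf
  have hWm : Measurable fun x => v (absCumulative γ f x).toReal :=
    hv.comp (measurable_absCumulative γ f).ennreal_toReal
  -- The two sides of the Bernoulli inequality at `u = f ^ γ`, `w = v(W)`, times `f ^ (1 - γ)`. The
  -- relation `γ * s = lam + γ - 1` turns `f ^ (1 - γ) * (f ^ γ) ^ s` into `f ^ lam`.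
  set a : ℝ → ℝ≥0∞ := fun x => ENNReal.ofReal s *
    (ENNReal.ofReal (v (absCumulative γ f x).toReal) ^ (s - 1) * ENNReal.ofReal (f x)) with ha
  set b : ℝ → ℝ≥0∞ := fun x => ENNReal.ofReal (f x) ^ (lam - 1) * ENNReal.ofReal (f x) +
    ENNReal.ofReal (s - 1) * (ENNReal.ofReal (v (absCumulative γ f x).toReal) ^ s *
      ENNReal.ofReal (f x) ^ (1 - γ)) with hb
  have hbm₁ : Measurable fun x => ENNReal.ofReal (f x) ^ (lam - 1) * ENNReal.ofReal (f x) :=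
    (hf.ennreal_ofReal.pow_const _).mul hf.ennreal_ofReal
  have hbm : Measurable b := by
    refine hbm₁.add ?_
    · exact ((hWm.ennreal_ofReal.pow_const _).mul (hf.ennreal_ofReal.pow_const _)).const_mul _
  have haR : ∀ x, 0 < f x → a x = ENNReal.ofReal (f x ^ (1 - γ) *
      (s * (f x ^ γ * v (absCumulative γ f x).toReal ^ (s - 1)))) := by
    intro x hx
    simp only [ha]
    rw [ENNReal.ofReal_rpow_of_nonneg (hv0 _) (by linarith),
      ← ENNReal.ofReal_mul (Real.rpow_nonneg (hv0 _) _), ← ENNReal.ofReal_mul (by linarith)]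
    congr 1
    have : f x = f x ^ (1 - γ) * f x ^ γ := by
      rw [← Real.rpow_add hx]; simp
    conv_lhs => rw [this]
    ring
  have hbR : ∀ x, 0 < f x → b x = ENNReal.ofReal (f x ^ (1 - γ) *
      ((f x ^ γ) ^ s + (s - 1) * v (absCumulative γ f x).toReal ^ s)) := by
    intro x hx
    simp only [hb]
    have h1 := Real.rpow_nonneg (hv0 (absCumulative γ f x).toReal) s
    rw [ENNReal.ofReal_rpow_of_nonneg (hv0 _) (by linarith), ENNReal.ofReal_rpow_of_pos hx,
      ENNReal.ofReal_rpow_of_pos hx, ← ENNReal.ofReal_mul (by positivity),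
      ← ENNReal.ofReal_mul (by positivity), ← ENNReal.ofReal_mul (by linarith),
      ← ENNReal.ofReal_add (by positivity) (mul_nonneg (by linarith) (by positivity))]
    congr 1
    have : f x ^ (lam - 1) * f x = f x ^ (1 - γ) * (f x ^ γ) ^ s := by
      rw [← Real.rpow_mul hx.le, ← Real.rpow_add hx, ← Real.rpow_add_one hx.ne']
      congr 1; linarith
    rw [this]; ring
  have hbern := fun x (hx : 0 < f x) => bernoulli_of_one_lt hs (Real.rpow_pos_of_pos hx γ)
    (hv0 (absCumulative γ f x).toReal)
  have hab : ∀ᵐ x ∂(volume.restrict {x | 0 < f x}), a x ≤ b x := by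
    refine ae_restrict_of_forall_mem hT fun x hx => ?_
    rw [haR x hx, hbR x hx]
    exact ENNReal.ofReal_le_ofReal (mul_le_mul_of_nonneg_left (hbern x hx).1
      (Real.rpow_nonneg (le_of_lt hx) _))
  have hIa : ∫⁻ x in {x | 0 < f x}, a x = ENNReal.ofReal s * ∫⁻ x in {x | 0 < f x},
      ENNReal.ofReal (v (absCumulative γ f x).toReal) ^ (s - 1) * ENNReal.ofReal (f x) :=
    lintegral_const_mul' _ _ ENNReal.ofReal_ne_top
  have hIb : ∫⁻ x in {x | 0 < f x}, b x ≤
      (∫⁻ x, ENNReal.ofReal (f x) ^ (lam - 1) * ENNReal.ofReal (f x)) +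
        ENNReal.ofReal (s - 1) * (2 * ∫⁻ y in Ioi 0, ENNReal.ofReal (v y) ^ s) := by
    rw [lintegral_add_left hbm₁,
      lintegral_const_mul' _ _ ENNReal.ofReal_ne_top, ← lintegral_mul_ofReal_eq hf]
    gcongr
    exact lintegral_profile_le γ hf hv s hW
  have hmain : ∫⁻ x in {x | 0 < f x}, a x ≤ _ := (lintegral_mono_ae hab).trans hIb
  refine ⟨hIa ▸ hmain, fun hMv hle => ?_⟩
  set Mv := 2 * ∫⁻ y in Ioi 0, ENNReal.ofReal (v y) ^ s
  -- The part `(s - 1) * Mv` is finite and cancels, leaving `Mv` alone against the entropy integral.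
  have hsM : ENNReal.ofReal s * Mv = Mv + ENNReal.ofReal (s - 1) * Mv := by
    conv_lhs => rw [show s = 1 + (s - 1) by ring, ENNReal.ofReal_add zero_le_one (by linarith)]
    rw [add_mul, ENNReal.ofReal_one, one_mul]
  have h2 : ENNReal.ofReal s * Mv ≤ ∫⁻ x in {x | 0 < f x}, a x := by rw [hIa]; gcongr
  have hfin : ENNReal.ofReal (s - 1) * Mv ≠ ∞ := ENNReal.mul_ne_top ENNReal.ofReal_ne_top hMv
  refine ⟨?_, fun heq => ?_⟩
  · have h3 := h2.trans hmain
    rw [hsM] at h3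
    exact (ENNReal.add_le_add_iff_right hfin).1 h3
  · rw [heq, ← hsM] at hIb hmain
    -- In the equality case the integrals of `a ≤ b` coincide and are finite, so `a = b` almost
    -- everywhere and the tangent touches at almost every point.
    have h4 := ae_eq_of_ae_le_of_lintegral_le hab
      (ne_top_of_le_ne_top (ENNReal.mul_ne_top ENNReal.ofReal_ne_top hMv) hmain)
      hbm.aemeasurable (hIb.trans h2)
    filter_upwards [(ae_restrict_iff' hT).1 h4] with x hx hx0
    have h5 := hx hx0
    rw [haR x hx0, hbR x hx0] at h5
    have h6 : (0 : ℝ) < f x ^ (1 - γ) := Real.rpow_pos_of_pos hx0 _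
    have h7 := Real.rpow_nonneg (hv0 (absCumulative γ f x).toReal) s
    have h8 := Real.rpow_nonneg (hv0 (absCumulative γ f x).toReal) (s - 1)
    have h9 := Real.rpow_pos_of_pos hx0 γ
    have h10 := Real.rpow_pos_of_pos h9 s
    rw [ENNReal.ofReal_eq_ofReal_iff
      (mul_nonneg h6.le (mul_nonneg (by linarith) (mul_nonneg h9.le h8)))
      (mul_nonneg h6.le (add_nonneg h10.le (mul_nonneg (by linarith) h7)))] at h5
    exact (hbern x hx0).2 (mul_left_cancel₀ h6.ne' h5)

/-- For `s < 1` the cross term stands on the larger side, so an upper bound for it is required.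
Positivity of `v(W)` keeps its negative power finite. -/
theorem lintegral_bernoulli_of_lt_one (hs0 : 0 < s) (hs : s < 1) (hγ : γ * s = lam + γ - 1)
    (hf : Measurable f) (hv : Measurable v)
    (hW : ∀ᵐ x, 0 < f x → absCumulative γ f x ≠ ∞ ∧ 0 < v (absCumulative γ f x).toReal)
    (hMv : (2 * ∫⁻ y in Ioi 0, ENNReal.ofReal (v y) ^ s) ≠ ∞)
    (hle : ∫⁻ x in {x | 0 < f x},
        ENNReal.ofReal (v (absCumulative γ f x).toReal) ^ (s - 1) * ENNReal.ofReal (f x) ≤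
      2 * ∫⁻ y in Ioi 0, ENNReal.ofReal (v y) ^ s) :
    (∫⁻ x, ENNReal.ofReal (f x) ^ (lam - 1) * ENNReal.ofReal (f x)) ≤
        2 * ∫⁻ y in Ioi 0, ENNReal.ofReal (v y) ^ s ∧
      ((∫⁻ x, ENNReal.ofReal (f x) ^ (lam - 1) * ENNReal.ofReal (f x)) =
          2 * ∫⁻ y in Ioi 0, ENNReal.ofReal (v y) ^ s →
        ∀ᵐ x, 0 < f x → f x ^ γ = v (absCumulative γ f x).toReal) := by
  have hT := measurableSet_pos hf
  have hWm : Measurable fun x => v (absCumulative γ f x).toReal :=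
    hv.comp (measurable_absCumulative γ f).ennreal_toReal
  set a : ℝ → ℝ≥0∞ := fun x => ENNReal.ofReal (f x) ^ (lam - 1) * ENNReal.ofReal (f x) with ha
  set b : ℝ → ℝ≥0∞ := fun x => ENNReal.ofReal s *
    (ENNReal.ofReal (v (absCumulative γ f x).toReal) ^ (s - 1) * ENNReal.ofReal (f x)) +
    ENNReal.ofReal (1 - s) * (ENNReal.ofReal (v (absCumulative γ f x).toReal) ^ s *
      ENNReal.ofReal (f x) ^ (1 - γ)) with hb
  have hbm₁ : Measurable fun x => ENNReal.ofReal s *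
    (ENNReal.ofReal (v (absCumulative γ f x).toReal) ^ (s - 1) * ENNReal.ofReal (f x)) :=
    ((hWm.ennreal_ofReal.pow_const _).mul hf.ennreal_ofReal).const_mul _
  have hbm : Measurable b := hbm₁.add
    (((hWm.ennreal_ofReal.pow_const _).mul (hf.ennreal_ofReal.pow_const _)).const_mul _)
  have haR : ∀ x, 0 < f x → a x = ENNReal.ofReal (f x ^ (1 - γ) * (f x ^ γ) ^ s) := by
    intro x hx
    simp only [ha]
    rw [ENNReal.ofReal_rpow_of_pos hx, ← ENNReal.ofReal_mul (by positivity)]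
    congr 1
    rw [← Real.rpow_mul hx.le, ← Real.rpow_add hx, ← Real.rpow_add_one hx.ne']
    congr 1; linarith
  have hbR : ∀ x, 0 < f x → 0 < v (absCumulative γ f x).toReal →
      b x = ENNReal.ofReal (f x ^ (1 - γ) *
      (s * (f x ^ γ * v (absCumulative γ f x).toReal ^ (s - 1)) +
        (1 - s) * v (absCumulative γ f x).toReal ^ s)) := by
    intro x hx hvx
    simp only [hb]
    rw [ENNReal.ofReal_rpow_of_pos hvx, ENNReal.ofReal_rpow_of_pos hx,
      ENNReal.ofReal_rpow_of_pos hvx, ← ENNReal.ofReal_mul (by positivity),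
      ← ENNReal.ofReal_mul hs0.le, ← ENNReal.ofReal_mul (by positivity),
      ← ENNReal.ofReal_mul (by linarith : 0 ≤ 1 - s),
      ← ENNReal.ofReal_add (by positivity) (mul_nonneg (by linarith) (by positivity))]
    congr 1
    have : f x = f x ^ (1 - γ) * f x ^ γ := by
      rw [← Real.rpow_add hx]; simp
    rw [mul_comm _ (f x)]
    nth_rewrite 1 [this]
    ring
  have hbern := fun x (hx : 0 < f x) (hvx : 0 < v (absCumulative γ f x).toReal) =>
    bernoulli_of_lt_one hs0 hs (Real.rpow_pos_of_pos hx γ) hvx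
  have hab : ∀ᵐ x ∂(volume.restrict {x | 0 < f x}), a x ≤ b x := by
    rw [ae_restrict_iff' hT]
    filter_upwards [hW] with x hx hx0
    rw [haR x hx0, hbR x hx0 (hx hx0).2]
    exact ENNReal.ofReal_le_ofReal (mul_le_mul_of_nonneg_left (hbern x hx0 (hx hx0).2).1
      (Real.rpow_nonneg (le_of_lt hx0) _))
  have hIa : ∫⁻ x in {x | 0 < f x}, a x = ∫⁻ x, a x := (lintegral_mul_ofReal_eq hf _).symm
  set Mv := 2 * ∫⁻ y in Ioi 0, ENNReal.ofReal (v y) ^ s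
  have hIb : ∫⁻ x in {x | 0 < f x}, b x ≤ Mv := by
    rw [lintegral_add_left hbm₁, lintegral_const_mul' _ _ ENNReal.ofReal_ne_top,
      lintegral_const_mul' _ _ ENNReal.ofReal_ne_top]
    have h1 : Mv = ENNReal.ofReal s * Mv + ENNReal.ofReal (1 - s) * Mv := by
      rw [← add_mul, ← ENNReal.ofReal_add hs0.le (by linarith)]; simp
    rw [h1]
    gcongr
    exact lintegral_profile_le γ hf hv s (hW.mono fun x hx hx0 => (hx hx0).1)
  have hmain : ∫⁻ x in {x | 0 < f x}, a x ≤ Mv := (lintegral_mono_ae hab).trans hIb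
  refine ⟨hIa ▸ hmain, fun heq => ?_⟩
  have h4 := ae_eq_of_ae_le_of_lintegral_le hab (ne_top_of_le_ne_top hMv hmain)
    hbm.aemeasurable (hIb.trans (by rw [hIa, ← heq]))
  filter_upwards [(ae_restrict_iff' hT).1 h4, hW] with x hx hWx hx0
  have h5 := hx hx0
  have hvx := (hWx hx0).2
  rw [haR x hx0, hbR x hx0 hvx] at h5
  have h6 : (0 : ℝ) < f x ^ (1 - γ) := Real.rpow_pos_of_pos hx0 _
  have h9 := Real.rpow_pos_of_pos hx0 γ
  rw [ENNReal.ofReal_eq_ofReal_iff (by positivity)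
    (mul_nonneg h6.le (add_nonneg (by positivity) (mul_nonneg (by linarith) (by positivity))))] at h5
  exact (hbern x hx0 hvx).2 (mul_left_cancel₀ h6.ne' h5)

theorem mean_neg_log (hf : Measurable f) :
    mean (fun x => -(ENNReal.ofReal (f x)).log) f =
      ((∫⁻ x in {x | 0 < f x}, ENNReal.ofReal (-Real.log (f x)) * ENNReal.ofReal (f x) : ℝ≥0∞) :
        EReal) -
      ((∫⁻ x in {x | 0 < f x}, ENNReal.ofReal (Real.log (f x)) * ENNReal.ofReal (f x) : ℝ≥0∞) :
        EReal) := by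
  rw [mean, lintegral_mul_ofReal_eq hf, lintegral_mul_ofReal_eq hf]
  refine congrArg₂ (fun a b : ℝ≥0∞ => (a : EReal) - (b : EReal)) ?_ ?_
  · refine setLIntegral_congr_fun (measurableSet_pos hf) fun x hx => ?_
    simp only [ENNReal.log_ofReal_of_pos hx, ← EReal.coe_neg, EReal.real_coe_toENNReal]
  · refine setLIntegral_congr_fun (measurableSet_pos hf) fun x hx => ?_
    simp only [ENNReal.log_ofReal_of_pos hx, neg_neg, EReal.real_coe_toENNReal]

/-- The Gibbs inequality for the profile `exp (A - c)` evaluated at the cumulative function. -/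
theorem mean_neg_log_le (hγ : 0 < γ) (hf : Measurable f) (hf1 : ∫⁻ x, ENNReal.ofReal (f x) = 1)
    (hv : Measurable v) (hv1 : 2 * ∫⁻ y in Ioi 0, ENNReal.ofReal (v y) = 1)
    {A C : ℝ} {c : ℝ → ℝ} (hcm : Measurable c) (hC : 0 ≤ C)
    (hc0 : ∀ᵐ x, 0 < f x → 0 ≤ c (absCumulative γ f x).toReal)
    (hW : ∀ᵐ x, 0 < f x → absCumulative γ f x ≠ ∞ ∧
      v (absCumulative γ f x).toReal = Real.exp (A - c (absCumulative γ f x).toReal))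
    (hle : ∫⁻ x in {x | 0 < f x}, ENNReal.ofReal (c (absCumulative γ f x).toReal) *
      ENNReal.ofReal (f x) ≤ ENNReal.ofReal C) :
    mean (fun x => -(ENNReal.ofReal (f x)).log) f ≤ (((C - A) / γ : ℝ) : EReal) ∧
      (mean (fun x => -(ENNReal.ofReal (f x)).log) f = (((C - A) / γ : ℝ) : EReal) →
        ∀ᵐ x, 0 < f x → f x ^ γ = v (absCumulative γ f x).toReal) := by
  rw [mean_neg_log hf]
  have hT := measurableSet_pos hf
  have hWm := (measurable_absCumulative γ f).ennreal_toReal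
  have hf1' : ∫⁻ x in {x | 0 < f x}, ENNReal.ofReal (f x) = 1 := by
    rw [← hf1]; simpa using (lintegral_mul_ofReal_eq hf (fun _ => 1)).symm
  set P := ∫⁻ x in {x | 0 < f x}, ENNReal.ofReal (-Real.log (f x)) * ENNReal.ofReal (f x)
  set N := ∫⁻ x in {x | 0 < f x}, ENNReal.ofReal (Real.log (f x)) * ENNReal.ofReal (f x)
  -- The tangent inequality times `f ^ (1 - γ)` reads `-γ f log f + (1 + A) f ≤ c f + v f ^ (1 -
  -- γ)`. Negative parts of `log f` and of `A` are moved across, so that both sides are nonnegative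
  -- and no difference of integrals occurs.
  set a : ℝ → ℝ≥0∞ := fun x => ENNReal.ofReal γ * (ENNReal.ofReal (-Real.log (f x)) *
    ENNReal.ofReal (f x)) + ENNReal.ofReal (1 + max A 0) * ENNReal.ofReal (f x) with ha
  set b : ℝ → ℝ≥0∞ := fun x => ENNReal.ofReal γ * (ENNReal.ofReal (Real.log (f x)) *
    ENNReal.ofReal (f x)) + ENNReal.ofReal (max (-A) 0) * ENNReal.ofReal (f x) +
    (ENNReal.ofReal (c (absCumulative γ f x).toReal) * ENNReal.ofReal (f x) +
    ENNReal.ofReal (v (absCumulative γ f x).toReal) ^ (1 : ℝ) *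
      ENNReal.ofReal (f x) ^ (1 - γ)) with hb
  have hm1 : Measurable fun x => ENNReal.ofReal (Real.log (f x)) * ENNReal.ofReal (f x) :=
    (Real.measurable_log.comp hf).ennreal_ofReal.mul hf.ennreal_ofReal
  have hm2 : Measurable fun x => ENNReal.ofReal (-Real.log (f x)) * ENNReal.ofReal (f x) :=
    (Real.measurable_log.comp hf).neg.ennreal_ofReal.mul hf.ennreal_ofReal
  have hm3 : Measurable fun x => ENNReal.ofReal (c (absCumulative γ f x).toReal) *
    ENNReal.ofReal (f x) := (hcm.comp hWm).ennreal_ofReal.mul hf.ennreal_ofReal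
  have hm4 : Measurable fun x => ENNReal.ofReal (v (absCumulative γ f x).toReal) ^ (1 : ℝ) *
      ENNReal.ofReal (f x) ^ (1 - γ) := ((hv.comp hWm).ennreal_ofReal.pow_const _).mul
        (hf.ennreal_ofReal.pow_const _)
  have hm5 : Measurable fun x => ENNReal.ofReal γ * (ENNReal.ofReal (Real.log (f x)) *
    ENNReal.ofReal (f x)) + ENNReal.ofReal (max (-A) 0) * ENNReal.ofReal (f x) :=
    (hm1.const_mul _).add (hf.ennreal_ofReal.const_mul _)
  have hbm : Measurable b := hm5.add (hm3.add hm4)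
  have hIa : ∫⁻ x in {x | 0 < f x}, a x = ENNReal.ofReal γ * P + ENNReal.ofReal (1 + max A 0) := by
    rw [lintegral_add_left (hm2.const_mul _), lintegral_const_mul' _ _ ENNReal.ofReal_ne_top,
      lintegral_const_mul' _ _ ENNReal.ofReal_ne_top, hf1', mul_one]
  have hIb : ∫⁻ x in {x | 0 < f x}, b x ≤ ENNReal.ofReal γ * N +
      ENNReal.ofReal (max (-A) 0 + C + 1) := by
    rw [lintegral_add_left hm5, lintegral_add_left (hm1.const_mul _), lintegral_add_left hm3,
      lintegral_const_mul' _ _ ENNReal.ofReal_ne_top,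
      lintegral_const_mul' _ _ ENNReal.ofReal_ne_top, hf1', mul_one,
      ENNReal.ofReal_add (by positivity) zero_le_one,
      ENNReal.ofReal_add (by positivity) hC, ENNReal.ofReal_one, add_assoc, add_assoc]
    gcongr
    refine (lintegral_profile_le γ hf hv 1 (hW.mono fun x hx hx0 => (hx hx0).1)).trans ?_
    simp [hv1]
  -- the two sides differ by the defect in the tangent inequality for the logarithm
  have hR : ∀ᵐ x, 0 < f x → ∃ y z : ℝ, 0 ≤ y ∧ 0 ≤ z ∧ a x = ENNReal.ofReal y ∧
      b x = ENNReal.ofReal z ∧ z - y = f x ^ (1 - γ) * ((v (absCumulative γ f x).toReal - f x ^ γ) -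
        f x ^ γ * (Real.log (v (absCumulative γ f x).toReal) - Real.log (f x ^ γ))) := by
    filter_upwards [hW, hc0] with x hx hcx hx0
    have hvx := (hx hx0).2
    have hcx := hcx hx0
    have hv0 : 0 < v (absCumulative γ f x).toReal := hvx ▸ Real.exp_pos _
    refine ⟨γ * (max (-Real.log (f x)) 0 * f x) + (1 + max A 0) * f x,
      γ * (max (Real.log (f x)) 0 * f x) + max (-A) 0 * f x +
        (c (absCumulative γ f x).toReal * f x + v (absCumulative γ f x).toReal * f x ^ (1 - γ)),
      by positivity, by positivity, ?_, ?_, ?_⟩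
    · simp only [ha]
      rw [← ofReal_max_zero (-Real.log (f x)), ← ENNReal.ofReal_mul (by positivity),
        ← ENNReal.ofReal_mul (by positivity), ← ENNReal.ofReal_mul (by positivity),
        ← ENNReal.ofReal_add (by positivity) (by positivity)]
    · simp only [hb, ENNReal.rpow_one]
      rw [ENNReal.ofReal_rpow_of_pos hx0, ← ENNReal.ofReal_mul hv0.le,
        ← ENNReal.ofReal_mul hcx, ← ofReal_max_zero (Real.log (f x)),
        ← ENNReal.ofReal_mul (by positivity), ← ENNReal.ofReal_mul (by positivity), ← ENNReal.ofReal_mul (by positivity),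
        ← ENNReal.ofReal_add (by positivity) (by positivity),
        ← ENNReal.ofReal_add (by positivity) (by positivity),
        ← ENNReal.ofReal_add (by positivity) (by positivity)]
    · have h1 : Real.log (v (absCumulative γ f x).toReal) =
          A - c (absCumulative γ f x).toReal := by rw [hvx, Real.log_exp]
      have h2 : f x ^ (1 - γ) * f x ^ γ = f x := by rw [← Real.rpow_add hx0]; simp
      rw [h1, Real.log_rpow hx0]
      have h3 : max (Real.log (f x)) 0 = Real.log (f x) + max (-Real.log (f x)) 0 := by
        rcases le_total 0 (Real.log (f x)) with h | h
        · rw [max_eq_left h, max_eq_right (by linarith), add_zero]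
        · rw [max_eq_right h, max_eq_left (by linarith)]; ring
      have h4 : max A 0 = A + max (-A) 0 := by
        rcases le_total 0 A with h | h
        · rw [max_eq_left h, max_eq_right (by linarith), add_zero]
        · rw [max_eq_right h, max_eq_left (by linarith)]; ring
      rw [h3, h4]
      linear_combination (-1 - A + c (absCumulative γ f x).toReal + γ * Real.log (f x)) * (-h2)
  have hab : ∀ᵐ x ∂(volume.restrict {x | 0 < f x}), a x ≤ b x := by
    rw [ae_restrict_iff' hT]
    filter_upwards [hW, hR] with x hx hRx hx0
    obtain ⟨y, z, -, -, h1, h2, h3⟩ := hRx hx0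
    rw [h1, h2]
    have h4 := (log_tangent (Real.rpow_pos_of_pos hx0 γ) ((hx hx0).2 ▸ Real.exp_pos _)).1
    have h5 : 0 ≤ z - y := h3 ▸ mul_nonneg (Real.rpow_nonneg (le_of_lt hx0) _) (by linarith)
    exact ENNReal.ofReal_le_ofReal (by linarith)
  have hmain := (lintegral_mono_ae hab).trans hIb
  rw [hIa] at hmain
  have hdiff : max A 0 - max (-A) 0 = A := by
    rcases le_total 0 A with h | h
    · rw [max_eq_left h, max_eq_right (by linarith), sub_zero]
    · rw [max_eq_right h, max_eq_left (by linarith)]; ring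
  -- Here the entropy is `⊥`: the bound is trivial and equality with a real number impossible.
  by_cases hN : N = ∞
  · rw [hN]
    refine ⟨by simp, fun h => ?_⟩
    simp only [EReal.coe_ennreal_top, EReal.sub_top] at h
    exact absurd h.symm (EReal.coe_ne_bot _)
  have hP : P ≠ ∞ := by
    intro hP
    rw [hP, ENNReal.mul_top (by simpa using hγ), top_add, top_le_iff] at hmain
    exact ENNReal.add_ne_top.2 ⟨ENNReal.mul_ne_top ENNReal.ofReal_ne_top hN,
      ENNReal.ofReal_ne_top⟩ hmain
  have hlR : ENNReal.ofReal γ * P + ENNReal.ofReal (1 + max A 0) =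
      ENNReal.ofReal (γ * P.toReal + (1 + max A 0)) := by
    rw [ENNReal.ofReal_add (p := γ * P.toReal) (by positivity) (by positivity),
      ENNReal.ofReal_mul hγ.le, ENNReal.ofReal_toReal hP]
  have hrR : ENNReal.ofReal γ * N + ENNReal.ofReal (max (-A) 0 + C + 1) =
      ENNReal.ofReal (γ * N.toReal + (max (-A) 0 + C + 1)) := by
    rw [ENNReal.ofReal_add (p := γ * N.toReal) (by positivity) (by positivity),
      ENNReal.ofReal_mul hγ.le, ENNReal.ofReal_toReal hN]
  have hsub : (P : EReal) - (N : EReal) = ((P.toReal - N.toReal : ℝ) : EReal) := by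
    rw [EReal.coe_sub, EReal.coe_ennreal_toReal hP, EReal.coe_ennreal_toReal hN]
  rw [hsub]
  refine ⟨?_, fun heq => ?_⟩
  · rw [hlR, hrR, ENNReal.ofReal_le_ofReal_iff (by positivity)] at hmain
    rw [EReal.coe_le_coe_iff, le_div_iff₀ hγ]
    linarith
  · rw [EReal.coe_eq_coe_iff, eq_div_iff hγ.ne'] at heq
    have hle : γ * N.toReal + (max (-A) 0 + C + 1) ≤ γ * P.toReal + (1 + max A 0) := by linarith
    have h4 := ae_eq_of_ae_le_of_lintegral_le hab (by rw [hIa, hlR]; exact ENNReal.ofReal_ne_top)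
      hbm.aemeasurable (hIb.trans (by rw [hIa, hlR, hrR]; exact ENNReal.ofReal_le_ofReal hle))
    filter_upwards [(ae_restrict_iff' hT).1 h4, hW, hR] with x hx hWx hRx hx0
    obtain ⟨y, z, hy, hz, h1, h2, h3⟩ := hRx hx0
    have h5 := hx hx0
    rw [h1, h2, ENNReal.ofReal_eq_ofReal_iff hy hz] at h5
    rw [h5, sub_self] at h3
    have h6 := (mul_eq_zero.1 h3.symm).resolve_left (Real.rpow_pos_of_pos hx0 _).ne'
    exact (log_tangent (Real.rpow_pos_of_pos hx0 γ) ((hWx hx0).2 ▸ Real.exp_pos _)).2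
      (by linarith)

end comparison

/-! ### Profiles and the densities generated by them -/

/-- The open initial segment of the half-line on which the profile `v` is positive. -/
def core (v : ℝ → ℝ) : Set ℝ := {y | 0 < y ∧ 0 < v y}

/-- The inverse of the cumulative function of the density generated by the profile `v`. -/
noncomputable def escortMap (γ : ℝ) (v : ℝ → ℝ) (z : ℝ) : ℝ :=
  (cumul (fun y => ENNReal.ofReal (v y) ^ ((γ - 1) / γ)) z).toReal

/-- A nonincreasing density on the half-line, of mass one half. -/
structure IsProfile (γ : ℝ) (v : ℝ → ℝ) : Prop where
  measurable : Measurable v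
  nonneg : ∀ y, 0 ≤ v y
  isOpen : IsOpen (core v)
  antitone : AntitoneOn v (Ioi 0)
  contDiffOn : ContDiffOn ℝ 1 v (core v)
  mass : 2 * ∫⁻ y in Ioi 0, ENNReal.ofReal (v y) = 1
  cumul_ne_top : ∀ z ∈ core v, cumul (fun y => ENNReal.ofReal (v y) ^ ((γ - 1) / γ)) z ≠ ∞

/-- `f` is the even density whose differential-escort transform is the profile `v`. -/
structure IsEscort (γ : ℝ) (v f : ℝ → ℝ) : Prop where
  apply_pos : ∀ z ∈ core v, f (escortMap γ v z) = v z ^ (1 / γ)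
  apply_neg : ∀ z ∈ core v, f (-escortMap γ v z) = v z ^ (1 / γ)
  support : ∀ x, x ≠ 0 → f x ≠ 0 → |x| ∈ escortMap γ v '' core v
  apply_zero : 0 ≤ f 0

theorem exists_cumul_eq {h : ℝ → ℝ≥0∞} (hm : Measurable h) {X y : ℝ} (hX0 : 0 ≤ X)
    (hX : cumul h X ≠ ∞) (hy0 : 0 < y) (hy : y ≤ (cumul h X).toReal) :
    ∃ x, 0 < x ∧ x ≤ X ∧ (cumul h x).toReal = y := by
  obtain ⟨x, hx, hxy⟩ := intermediate_value_Icc hX0 (continuousOn_toReal_cumul hm hX)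
    (show y ∈ Icc _ _ from ⟨by simpa [cumul_zero] using hy0.le, hy⟩)
  refine ⟨x, lt_of_le_of_ne hx.1 fun h0 => ?_, hx.2, hxy⟩
  rw [← h0] at hxy
  simp only [cumul_zero, ENNReal.toReal_zero] at hxy
  exact hy0.ne hxy

/-- The change of variables applied to the indicator of `S` gives zero, and the weight `f ^ (1 - γ)`
is positive where `f` is. Used to discard single values of the cumulative function. -/
theorem ae_notMem_of_volume_eq_zero (γ : ℝ) {f : ℝ → ℝ} (hf : Measurable f) {S : Set ℝ}
    (hS : MeasurableSet S) (hS0 : volume (S ∩ Ioi 0) = 0) :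
    ∀ᵐ x, 0 < f x → absCumulative γ f x ≠ ∞ → (absCumulative γ f x).toReal ∉ S := by
  have h1 := lintegral_comp_absCumulative_le γ hf (g := S.indicator 1)
    (measurable_one.indicator hS)
  rw [setLIntegral_indicator hS] at h1
  simp only [Pi.one_apply, lintegral_const, Measure.restrict_apply MeasurableSet.univ, univ_inter,
    hS0, mul_zero, nonpos_iff_eq_zero] at h1
  have hWm := measurable_absCumulative γ f
  have hT : MeasurableSet {x | absCumulative γ f x ≠ ∞} := hWm (measurableSet_singleton ∞).compl
  have hm : Measurable fun x => S.indicator (1 : ℝ → ℝ≥0∞) (absCumulative γ f x).toReal *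
      ENNReal.ofReal (f x) ^ (1 - γ) :=
    ((measurable_one.indicator hS).comp hWm.ennreal_toReal).mul (hf.ennreal_ofReal.pow_const _)
  rw [lintegral_eq_zero_iff hm, Filter.EventuallyEq, ae_restrict_iff' hT] at h1
  filter_upwards [h1] with x hx hx0 hW hmem
  have h2 := hx hW
  simp only [Pi.zero_apply, mul_eq_zero, indicator_of_mem hmem, Pi.one_apply, one_ne_zero,
    false_or, ENNReal.ofReal_rpow_of_pos hx0, ENNReal.ofReal_eq_zero] at h2
  exact absurd (Real.rpow_pos_of_pos hx0 (1 - γ)) (not_lt.2 h2)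

section profile

variable {γ : ℝ} {v f : ℝ → ℝ}

namespace IsProfile

theorem mem_core_of_le (hv : IsProfile γ v) {x y : ℝ} (hy : y ∈ core v) (hx : 0 < x)
    (hxy : x ≤ y) : x ∈ core v :=
  ⟨hx, hy.2.trans_le (hv.antitone hx hy.1 hxy)⟩

theorem measurable_weight (hv : IsProfile γ v) :
    Measurable fun y => ENNReal.ofReal (v y) ^ ((γ - 1) / γ) :=
  hv.measurable.ennreal_ofReal.pow_const _

theorem core_nonempty (hv : IsProfile γ v) : (core v).Nonempty := by
  by_contra h
  have h1 : ∫⁻ y in Ioi 0, ENNReal.ofReal (v y) = 0 := by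
    rw [setLIntegral_congr_fun measurableSet_Ioi (g := fun _ => 0) fun y hy => ?_]
    · simp
    · exact ENNReal.ofReal_of_nonpos (not_lt.1 fun h2 => h ⟨y, hy, h2⟩)
  have := hv.mass
  simp [h1] at this

/-- On the core the profile is continuous and positive, so its power is continuous whatever the sign
of the exponent, and the fundamental theorem of calculus applies. -/
theorem hasStrictDerivAt_escortMap (hv : IsProfile γ v) {z : ℝ} (hz : z ∈ core v) :
    HasStrictDerivAt (escortMap γ v) (v z ^ ((γ - 1) / γ)) z := by
  set w : ℝ → ℝ := fun y => (ENNReal.ofReal (v y) ^ ((γ - 1) / γ)).toReal with hw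
  have hwm : Measurable w := hv.measurable_weight.ennreal_toReal
  have hweq : ∀ y ∈ core v, w y = v y ^ ((γ - 1) / γ) := fun y hy => by
    simp only [hw]
    rw [ENNReal.ofReal_rpow_of_pos hy.2, ENNReal.toReal_ofReal (Real.rpow_nonneg hy.2.le _)]
  have hcont : ContinuousAt w z := by
    have h1 : ContinuousAt (fun y => v y ^ ((γ - 1) / γ)) z :=
      (hv.contDiffOn.continuousOn.continuousAt (hv.isOpen.mem_nhds hz)).rpow_const
        (Or.inl hz.2.ne')
    exact h1.congr (Filter.eventually_of_mem (hv.isOpen.mem_nhds hz) fun y hy => (hweq y hy).symm)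
  have hint : IntervalIntegrable w volume 0 z := by
    rw [intervalIntegrable_iff_integrableOn_Ioc_of_le hz.1.le]
    exact integrable_toReal_of_lintegral_ne_top hv.measurable_weight.aemeasurable
      (hv.cumul_ne_top z hz)
  have h2 := intervalIntegral.integral_hasStrictDerivAt_right hint
    (hwm.stronglyMeasurable.stronglyMeasurableAtFilter) hcont
  rw [hweq z hz] at h2
  refine h2.congr_of_eventuallyEq (Filter.eventually_of_mem (hv.isOpen.mem_nhds hz)
    fun y hy => ?_)
  have h3 := hv.cumul_ne_top y hy
  dsimp only
  rw [intervalIntegral.integral_of_le hy.1.le, escortMap, hw,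
    integral_toReal hv.measurable_weight.aemeasurable (ae_lt_top hv.measurable_weight h3), cumul]

theorem strictMonoOn_escortMap (hv : IsProfile γ v) : StrictMonoOn (escortMap γ v) (core v) := by
  intro a ha b hb hab
  have hsub : Icc a b ⊆ core v := fun x hx => hv.mem_core_of_le hb (ha.1.trans_le hx.1) hx.2
  refine strictMonoOn_of_deriv_pos (convex_Icc a b)
    (fun x hx => (hv.hasStrictDerivAt_escortMap (hsub hx)).hasDerivAt.continuousAt.continuousWithinAt)
    (fun x hx => ?_) (left_mem_Icc.2 hab.le) (right_mem_Icc.2 hab.le) hab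
  have hx' := hsub (interior_subset hx)
  rw [(hv.hasStrictDerivAt_escortMap hx').hasDerivAt.deriv]
  exact Real.rpow_pos_of_pos hx'.2 _

theorem escortMap_pos (hv : IsProfile γ v) {z : ℝ} (hz : z ∈ core v) : 0 < escortMap γ v z := by
  have h2 : z / 2 ∈ core v := hv.mem_core_of_le hz (half_pos hz.1) (half_le_self hz.1.le)
  exact ENNReal.toReal_nonneg.trans_lt (hv.strictMonoOn_escortMap h2 hz (half_lt_self hz.1))

theorem isOpen_image (hv : IsProfile γ v) : IsOpen (escortMap γ v '' core v) := by
  rw [isOpen_iff_mem_nhds]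
  rintro _ ⟨z, hz, rfl⟩
  rw [← (hv.hasStrictDerivAt_escortMap hz).map_nhds_eq (Real.rpow_pos_of_pos hz.2 _).ne']
  exact Filter.image_mem_map (hv.isOpen.mem_nhds hz)

theorem mem_image_of_le (hv : IsProfile γ v) {x z : ℝ} (hz : z ∈ core v) (hx : 0 < x)
    (hxz : x ≤ escortMap γ v z) : x ∈ escortMap γ v '' core v := by
  obtain ⟨y, hy0, hyz, hy⟩ := exists_cumul_eq hv.measurable_weight hz.1.le (hv.cumul_ne_top z hz)
    hx hxz
  exact ⟨y, hv.mem_core_of_le hz hy0 hyz, hy⟩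

end IsProfile

namespace IsEscort

theorem comp_neg (hf : IsEscort γ v f) : IsEscort γ v fun x => f (-x) where
  apply_pos := hf.apply_neg
  apply_neg z hz := by simpa using hf.apply_pos z hz
  support x hx hfx := by simpa using hf.support (-x) (neg_ne_zero.2 hx) hfx
  apply_zero := by simpa using hf.apply_zero

/-- There `f` is `v ^ (1 / γ)` composed with the inverse of `escortMap`. The inverse function
theorem gives that inverse a derivative which is a power of `v` along it, hence continuous. -/
theorem contDiffOn_image (hf : IsEscort γ v f) (hv : IsProfile γ v) :
    ContDiffOn ℝ 1 f (escortMap γ v '' core v) := by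
  set Z := Function.invFunOn (escortMap γ v) (core v) with hZ
  have hleft : ∀ z ∈ core v, Z (escortMap γ v z) = z := fun z hz =>
    hv.strictMonoOn_escortMap.injOn.leftInvOn_invFunOn hz
  have hmem : ∀ x ∈ escortMap γ v '' core v, Z x ∈ core v ∧ escortMap γ v (Z x) = x := by
    rintro _ ⟨z, hz, rfl⟩
    rw [hleft z hz]
    exact ⟨hz, rfl⟩
  have hder : ∀ x ∈ escortMap γ v '' core v,
      HasStrictDerivAt Z (v (Z x) ^ ((γ - 1) / γ))⁻¹ x := by
    rintro _ ⟨z, hz, rfl⟩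
    rw [hleft z hz]
    exact (hv.hasStrictDerivAt_escortMap hz).to_local_left_inverse
      (Real.rpow_pos_of_pos hz.2 _).ne' (Filter.eventually_of_mem (hv.isOpen.mem_nhds hz) hleft)
  have hZc : ContinuousOn Z (escortMap γ v '' core v) := fun x hx =>
    (hder x hx).hasDerivAt.continuousAt.continuousWithinAt
  have hZ1 : ContDiffOn ℝ 1 Z (escortMap γ v '' core v) := by
    rw [show (1 : WithTop ℕ∞) = 0 + 1 by simp, contDiffOn_succ_iff_deriv_of_isOpen hv.isOpen_image]
    refine ⟨fun x hx => (hder x hx).hasDerivAt.differentiableAt.differentiableWithinAt, by simp, ?_⟩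
    rw [contDiffOn_zero]
    refine ContinuousOn.congr (f := fun x => (v (Z x) ^ ((γ - 1) / γ))⁻¹) ?_
      fun x hx => (hder x hx).hasDerivAt.deriv
    refine ContinuousOn.inv₀ (ContinuousOn.rpow_const ?_ fun x hx => ?_) fun x hx => ?_
    · exact hv.contDiffOn.continuousOn.comp hZc fun x hx => (hmem x hx).1
    · exact Or.inl (hmem x hx).1.2.ne'
    · exact (Real.rpow_pos_of_pos (hmem x hx).1.2 _).ne'
  have h1 : ContDiffOn ℝ 1 (fun x => v (Z x) ^ (1 / γ)) (escortMap γ v '' core v) :=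
    (hv.contDiffOn.comp hZ1 fun x hx => (hmem x hx).1).rpow_const_of_ne
      fun x hx => (hmem x hx).1.2.ne'
  refine h1.congr ?_
  rintro _ ⟨z, hz, rfl⟩
  simp only [hleft z hz]
  exact hf.apply_pos z hz

theorem nonneg (hf : IsEscort γ v f) (x : ℝ) : 0 ≤ f x := by
  by_cases hx : x = 0
  · exact hx ▸ hf.apply_zero
  by_cases h : f x = 0
  · exact h.ge
  obtain ⟨z, hz, hzx⟩ := hf.support x hx h
  rcases abs_choice x with h1 | h1
  · rw [show x = escortMap γ v z by rw [hzx, h1], hf.apply_pos z hz]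
    exact Real.rpow_nonneg hz.2.le _
  · rw [show x = -escortMap γ v z by rw [hzx, h1, neg_neg], hf.apply_neg z hz]
    exact Real.rpow_nonneg hz.2.le _

/-- The interval consists of the `x` with `|x|` below the supremum of `escortMap`; writing it as a
union covers finite and infinite length at once. -/
theorem exists_contDiffOn (hf : IsEscort γ v f) (hv : IsProfile γ v) :
    ∃ X : Set ℝ, IsOpen X ∧ X.OrdConnected ∧ ContDiffOn ℝ 1 f (X \ {0}) ∧
      ∀ x, x ∉ X → f x = 0 := by
  refine ⟨⋃ z ∈ core v, {x | |x| < escortMap γ v z}, isOpen_biUnion fun z _ =>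
    isOpen_lt continuous_abs continuous_const, ⟨fun a ha b hb c hc => ?_⟩, ?_, fun x hx => ?_⟩
  · simp only [mem_iUnion, mem_ofPred_eq, exists_prop] at ha hb ⊢
    obtain ⟨y, hy, hay⟩ := ha
    obtain ⟨z, hz, hbz⟩ := hb
    rw [abs_lt] at hay hbz
    rcases le_total (escortMap γ v y) (escortMap γ v z) with h | h
    · exact ⟨z, hz, abs_lt.2 ⟨by linarith [hc.1], by linarith [hc.2]⟩⟩
    · exact ⟨y, hy, abs_lt.2 ⟨by linarith [hc.1], by linarith [hc.2]⟩⟩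
  · rintro x ⟨hx, hx0⟩
    simp only [mem_iUnion, mem_ofPred_eq, exists_prop, mem_singleton_iff] at hx hx0
    obtain ⟨z, hz, hxz⟩ := hx
    have hmem := hv.mem_image_of_le hz (abs_pos.2 hx0) hxz.le
    rcases abs_choice x with h1 | h1
    · rw [h1] at hmem
      exact ((hf.contDiffOn_image hv).contDiffAt (hv.isOpen_image.mem_nhds hmem)).contDiffWithinAt
    · rw [h1] at hmem
      have h2 := (hf.comp_neg.contDiffOn_image hv).contDiffAt (hv.isOpen_image.mem_nhds hmem)
      have h3 := h2.comp x contDiff_neg.contDiffAt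
      simpa [Function.comp_def] using h3.contDiffWithinAt
  · by_contra h
    have hx0 : x ≠ 0 := by
      rintro rfl
      obtain ⟨z, hz⟩ := hv.core_nonempty
      exact hx (mem_biUnion hz (by simpa using hv.escortMap_pos hz))
    obtain ⟨z, hz, hzx⟩ := hf.support x hx0 h
    obtain ⟨ε, hε, hball⟩ := Metric.isOpen_iff.1 hv.isOpen z hz
    -- The core is open, so a larger parameter is available and `|x| = escortMap γ v z` lies
    -- strictly inside.
    have h2 : z + ε / 2 ∈ core v := hball (by
      rw [Metric.mem_ball, Real.dist_eq, abs_lt]; constructor <;> linarith)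
    refine hx (mem_biUnion h2 ?_)
    rw [mem_ofPred_eq, ← hzx]
    exact hv.strictMonoOn_escortMap hz h2 (by linarith)

end IsEscort

theorem measurable_of_contDiffOn {X : Set ℝ} (hX : IsOpen X) (hc : ContDiffOn ℝ 1 f (X \ {0}))
    (h0 : ∀ x, x ∉ X → f x = 0) : Measurable f := by
  classical
  have h1 : Measurable ((X \ {0}).piecewise f fun _ => 0) :=
    hc.continuousOn.measurable_piecewise continuousOn_const
      (hX.measurableSet.diff (measurableSet_singleton 0))
  have h2 : f = fun x => if x = 0 then f 0 else (X \ {0}).piecewise f (fun _ => 0) x := by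
    ext x
    split_ifs with hx
    · rw [hx]
    · by_cases hxX : x ∈ X
      · rw [piecewise_eq_of_mem (X \ {0}) f _ (show x ∈ X \ {0} from ⟨hxX, hx⟩)]
      · rw [piecewise_eq_of_notMem (X \ {0}) f _ fun h => hxX h.1, h0 x hxX]
  rw [h2]
  exact Measurable.ite (measurableSet_singleton 0) measurable_const h1

theorem IsC1Density.measurable (hf : IsC1Density f) : Measurable f := by
  obtain ⟨X, hX, -, hc, h0⟩ := hf.contDiff
  exact measurable_of_contDiffOn hX hc h0

namespace IsEscort

theorem measurable (hf : IsEscort γ v f) (hv : IsProfile γ v) : Measurable f := by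
  obtain ⟨X, hX, -, hc, h0⟩ := hf.exists_contDiffOn hv
  exact measurable_of_contDiffOn hX hc h0

/-- With `dx = v ^ ((γ - 1) / γ) dy` and `f = v ^ (1 / γ)`, the weight `f ^ (1 - γ) dx` is just
`dy`. -/
theorem absCumulative_escortMap (hf : IsEscort γ v f) (hv : IsProfile γ v) (hγ : 0 < γ) {z : ℝ}
    (hz : z ∈ core v) : absCumulative γ f (escortMap γ v z) = ENNReal.ofReal z := by
  rw [absCumulative_of_nonneg _ _ (hv.escortMap_pos hz).le, cumul, escortMap,
    ← lintegral_comp_cumul_Ioc hv.measurable_weight hz.1.le (hv.cumul_ne_top z hz)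
      ((hf.measurable hv).ennreal_ofReal.pow_const (1 - γ))]
  rw [setLIntegral_congr_fun measurableSet_Ioc (g := fun _ => 1) fun y hy => ?_]
  · simp
  · have hy' := hv.mem_core_of_le hz hy.1 hy.2
    have h1 := hf.apply_pos y hy'
    rw [escortMap] at h1
    dsimp only
    rw [h1, ENNReal.ofReal_rpow_of_pos (Real.rpow_pos_of_pos hy'.2 _), ENNReal.ofReal_rpow_of_pos
      hy'.2, ← ENNReal.ofReal_mul (Real.rpow_nonneg (Real.rpow_nonneg hy'.2.le _) _),
      ← Real.rpow_mul hy'.2.le, ← Real.rpow_add hy'.2]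
    have : 1 / γ * (1 - γ) + (γ - 1) / γ = 0 := by field_simp; ring
    rw [this]
    simp

theorem absCumulative_eq (hf : IsEscort γ v f) (hv : IsProfile γ v) (hγ : 0 < γ) {x : ℝ}
    (hx : x ≠ 0) (hfx : f x ≠ 0) :
    ∃ z ∈ core v, absCumulative γ f x = ENNReal.ofReal z ∧ f x = v z ^ (1 / γ) := by
  obtain ⟨z, hz, hzx⟩ := hf.support x hx hfx
  refine ⟨z, hz, ?_⟩
  rcases abs_choice x with h1 | h1
  · rw [show x = escortMap γ v z by rw [hzx, h1]]
    exact ⟨hf.absCumulative_escortMap hv hγ hz, hf.apply_pos z hz⟩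
  · rw [show x = -escortMap γ v z by rw [hzx, h1, neg_neg]]
    rw [absCumulative_neg]
    exact ⟨hf.comp_neg.absCumulative_escortMap hv hγ hz, hf.apply_neg z hz⟩

/-- In the variable `y` one has `f dx = v ^ (1 / γ) v ^ ((γ - 1) / γ) dy = v dy`. -/
theorem lintegral_Ioi (hf : IsEscort γ v f) (hv : IsProfile γ v) (hγ : 0 < γ)
    {φ : ℝ≥0∞ → ℝ≥0∞} (hφ : Measurable φ) :
    ∫⁻ x in Ioi 0, φ (absCumulative γ f x) * ENNReal.ofReal (f x) =
      ∫⁻ y in Ioi 0, φ (ENNReal.ofReal y) * ENNReal.ofReal (v y) := by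
  have h1 : ∫⁻ x in Ioi 0, φ (absCumulative γ f x) * ENNReal.ofReal (f x) =
      ∫⁻ x in escortMap γ v '' core v, φ (absCumulative γ f x) * ENNReal.ofReal (f x) := by
    rw [← lintegral_indicator measurableSet_Ioi,
      ← lintegral_indicator hv.isOpen_image.measurableSet]
    refine lintegral_congr fun x => ?_
    by_cases hx : x ∈ escortMap γ v '' core v
    · have : x ∈ Ioi 0 := by
        obtain ⟨z, hz, rfl⟩ := hx
        exact hv.escortMap_pos hz
      rw [indicator_of_mem hx, indicator_of_mem this]
    · rw [indicator_of_notMem hx]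
      by_cases hx0 : x ∈ Ioi 0
      · rw [indicator_of_mem hx0]
        have : f x = 0 := by
          by_contra h
          have := hf.support x (ne_of_gt hx0) h
          rw [abs_of_pos hx0] at this
          exact hx this
        simp [this]
      · rw [indicator_of_notMem hx0]
  have h2 : ∫⁻ y in Ioi 0, φ (ENNReal.ofReal y) * ENNReal.ofReal (v y) =
      ∫⁻ y in core v, φ (ENNReal.ofReal y) * ENNReal.ofReal (v y) := by
    rw [← lintegral_indicator measurableSet_Ioi, ← lintegral_indicator hv.isOpen.measurableSet]
    refine lintegral_congr fun y => ?_
    by_cases hy : y ∈ core v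
    · rw [indicator_of_mem hy, indicator_of_mem (show y ∈ Ioi 0 from hy.1)]
    · rw [indicator_of_notMem hy]
      by_cases hy0 : y ∈ Ioi 0
      · rw [indicator_of_mem hy0, ENNReal.ofReal_of_nonpos (not_lt.1 fun h => hy ⟨hy0, h⟩),
          mul_zero]
      · rw [indicator_of_notMem hy0]
  have hm : Measurable fun x => φ (absCumulative γ f x) * ENNReal.ofReal (f x) :=
    (hφ.comp (measurable_absCumulative γ f)).mul (hf.measurable hv).ennreal_ofReal
  rw [h1, h2, ← lintegral_comp_cumul_surj hv.measurable_weight (J := core v)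
    (R := escortMap γ v '' core v) (fun y hy => hy.1)
    (fun y hy x hx hxy => hv.mem_core_of_le hy hx hxy) hv.isOpen hv.cumul_ne_top rfl
    (by rintro _ ⟨z, hz, rfl⟩; exact hv.escortMap_pos hz) hm]
  refine setLIntegral_congr_fun hv.isOpen.measurableSet fun y hy => ?_
  have h3 := hf.apply_pos y hy
  have h4 := hf.absCumulative_escortMap hv hγ hy
  rw [escortMap] at h3 h4
  rw [h3, h4, mul_assoc, ENNReal.ofReal_rpow_of_pos hy.2,
    ← ENNReal.ofReal_mul (Real.rpow_nonneg hy.2.le _), ← Real.rpow_add hy.2]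
  have : 1 / γ + (γ - 1) / γ = 1 := by field_simp; ring
  rw [this, Real.rpow_one]

/-- Under the density generated by `v`, the cumulative function is distributed according to the
profile `v`. -/
theorem lintegral_comp_absCumulative (hf : IsEscort γ v f) (hv : IsProfile γ v) (hγ : 0 < γ)
    {φ : ℝ≥0∞ → ℝ≥0∞} (hφ : Measurable φ) :
    ∫⁻ x, φ (absCumulative γ f x) * ENNReal.ofReal (f x) =
      2 * ∫⁻ y in Ioi 0, φ (ENNReal.ofReal y) * ENNReal.ofReal (v y) := by
  rw [lintegral_eq_Ioi_add_neg, two_mul, hf.lintegral_Ioi hv hγ hφ]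
  congr 1
  simp_rw [absCumulative_neg]
  exact hf.comp_neg.lintegral_Ioi hv hγ hφ

theorem isC1Density (hf : IsEscort γ v f) (hv : IsProfile γ v) (hγ : 0 < γ) : IsC1Density f where
  nonneg := hf.nonneg
  mass_one := by
    have h := hf.lintegral_comp_absCumulative hv hγ (φ := fun _ => 1) measurable_const
    simp only [one_mul] at h
    rw [h, hv.mass]
  contDiff := hf.exists_contDiffOn hv

end IsEscort

end profile

/-! ### Uniqueness of the density generated by a profile -/

section uniqueness

variable {γ : ℝ} {v f E : ℝ → ℝ}

theorem two_mul_eq_one_of_add_eq_one {a b : ℝ≥0∞} (ha : 2 * a ≤ 1) (hb : 2 * b ≤ 1)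
    (hab : a + b = 1) : 2 * a = 1 ∧ 2 * b = 1 := by
  have h : 2 * a + 2 * b = 1 + 1 := by rw [← mul_add, hab, one_add_one_eq_two, mul_one]
  constructor
  · by_contra hne
    exact (ENNReal.add_lt_add_of_lt_of_le (ne_top_of_le_ne_top ENNReal.one_ne_top hb)
      (lt_of_le_of_ne ha hne) hb).ne h
  · by_contra hne
    exact (ENNReal.add_lt_add_of_le_of_lt (ne_top_of_le_ne_top ENNReal.one_ne_top ha) ha
      (lt_of_le_of_ne hb hne)).ne h

/-- Since `f = v(W) f ^ (1 - γ)`, the mass of `f` on the half-line is an integral of `v` over a part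
of `(0, ∞)`, at most one half. As the total mass is one, both half-lines will carry exactly one
half. -/
theorem two_mul_lintegral_Ioi_le (hv : IsProfile γ v) (hf : Measurable f)
    (hae : ∀ᵐ x, 0 < x → 0 < f x → absCumulative γ f x ≠ ∞ ∧
      f x ^ γ = v (absCumulative γ f x).toReal) :
    2 * ∫⁻ x in Ioi 0, ENNReal.ofReal (f x) ≤ 1 := by
  have hwm : Measurable fun t => ENNReal.ofReal (f t) ^ (1 - γ) := hf.ennreal_ofReal.pow_const _
  have hD : MeasurableSet {x | 0 < x ∧ cumul (fun t => ENNReal.ofReal (f t) ^ (1 - γ)) x ≠ ∞} :=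
    measurableSet_Ioi.inter ((measurable_cumul _) (measurableSet_singleton ∞).compl)
  rw [← hv.mass]
  gcongr 2 * ?_
  refine le_trans ?_ (lintegral_comp_cumul_le hwm hv.measurable.ennreal_ofReal)
  rw [← lintegral_indicator measurableSet_Ioi, ← lintegral_indicator hD]
  refine lintegral_mono_ae ?_
  filter_upwards [hae] with x hx
  by_cases hx0 : 0 < x
  · rw [indicator_of_mem (show x ∈ Ioi 0 from hx0)]
    by_cases hfx : 0 < f x
    · obtain ⟨h1, h2⟩ := hx hx0 hfx
      rw [absCumulative_of_nonneg _ _ hx0.le] at h1 h2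
      rw [indicator_of_mem (show x ∈ {x | 0 < x ∧
        cumul (fun t => ENNReal.ofReal (f t) ^ (1 - γ)) x ≠ ∞} from ⟨hx0, h1⟩), ← h2,
        ENNReal.ofReal_rpow_of_pos hfx, ← ENNReal.ofReal_mul (Real.rpow_nonneg hfx.le _),
        ← Real.rpow_add hfx]
      simp
    · simp [ENNReal.ofReal_of_nonpos (not_lt.1 hfx)]
  · simp [hx0]

/-- The equation `f ^ γ = v(W)` makes `escortMap ∘ W` the identity where `f > 0`, which determines
`f` there. The danger is a gap in the support: for `γ < 1` the cumulative function does not see an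
interval on which `f` vanishes. Gaps are excluded by the continuity of `f` on `X` together with the
monotonicity of `v`; the mass one half then shows that the whole profile is used. -/
theorem ae_eq_Ioi_of_ae_eq_profile (hv : IsProfile γ v) (hγ : 0 < γ) (hE : IsEscort γ v E)
    {X : Set ℝ} (hX : IsOpen X) (hXc : X.OrdConnected) (h0X : (0 : ℝ) ∈ X)
    (hcont : ContinuousOn f (X \ {0})) (hfX : ∀ x, x ∉ X → f x = 0) (hf0 : ∀ x, 0 ≤ f x)
    (hf : Measurable f) (hmass : 2 * ∫⁻ x in Ioi 0, ENNReal.ofReal (f x) = 1)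
    (hae : ∀ᵐ x, 0 < x → 0 < f x → absCumulative γ f x ≠ ∞ ∧
      f x ^ γ = v (absCumulative γ f x).toReal) :
    ∀ᵐ x, 0 < x → f x = E x := by
  set h : ℝ → ℝ≥0∞ := fun t => ENNReal.ofReal (f t) ^ (1 - γ) with hh
  have hm : Measurable h := hf.ennreal_ofReal.pow_const _
  set P : Set ℝ := {x | 0 < x ∧ 0 < f x} with hP
  have hXmem : ∀ x, 0 < f x → x ∈ X := fun x hx => by
    by_contra hxX; exact hx.ne' (hfX x hxX)
  have hcont' : ContinuousOn f (X ∩ Ioi 0) := hcont.mono fun x hx => ⟨hx.1, hx.2.ne'⟩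
  have hPeq : P = (X ∩ Ioi 0) ∩ f ⁻¹' Ioi 0 := by
    ext x
    exact ⟨fun hx => ⟨⟨hXmem x hx.2, hx.1⟩, hx.2⟩, fun hx => ⟨hx.1.2, hx.2⟩⟩
  have hPo : IsOpen P := hPeq ▸ hcont'.isOpen_inter_preimage (hX.inter isOpen_Ioi) isOpen_Ioi
  -- almost every point of `P` is good
  set good : Set ℝ := {x | x ∈ P → cumul h x ≠ ∞ ∧ f x ^ γ = v (cumul h x).toReal ∧
    (cumul h x).toReal ∈ core v}
  have hgood : ∀ᵐ x, x ∈ good := by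
    filter_upwards [hae, ae_notMem_of_volume_eq_zero γ hf (measurableSet_singleton 0)
      (by simp)] with x hx hx' hxP
    obtain ⟨h1, h2⟩ := hx hxP.1 hxP.2
    have h3 := hx' hxP.2 h1
    rw [absCumulative_of_nonneg _ _ hxP.1.le] at h1 h2 h3
    exact ⟨h1, h2, lt_of_le_of_ne ENNReal.toReal_nonneg fun h4 => h3 h4.symm,
      h2 ▸ Real.rpow_pos_of_pos hxP.2 γ⟩
  have hdense : ∀ U : Set ℝ, IsOpen U → U.Nonempty → ∃ x ∈ U, x ∈ good := fun U hU hne => by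
    obtain ⟨x, hx1, hx2⟩ := (Measure.dense_of_ae hgood).exists_mem_open hU hne
    exact ⟨x, hx2, hx1⟩
  have hball : ∀ x ∈ P, ∃ ε > 0, Ioo (x - ε) (x + ε) ⊆ P := fun x hx => by
    obtain ⟨ε, hε, h1⟩ := Metric.isOpen_iff.1 hPo x hx
    exact ⟨ε, hε, Real.ball_eq_Ioo x ε ▸ h1⟩
  have habove : ∀ x ∈ P, ∃ x' ∈ P, x < x' ∧ x' ∈ good := fun x hx => by
    obtain ⟨ε, hε, h1⟩ := hball x hx
    obtain ⟨x', hx', hg⟩ := hdense (Ioo x (x + ε)) isOpen_Ioo ⟨x + ε / 2, by constructor <;> linarith⟩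
    exact ⟨x', h1 ⟨by linarith [hx'.1], hx'.2⟩, hx'.1, hg⟩
  have hbelow : ∀ x ∈ P, ∃ x' ∈ P, x' < x ∧ x' ∈ good := fun x hx => by
    obtain ⟨ε, hε, h1⟩ := hball x hx
    obtain ⟨x', hx', hg⟩ := hdense (Ioo (x - ε) x) isOpen_Ioo ⟨x - ε / 2, by constructor <;> linarith⟩
    exact ⟨x', h1 ⟨hx'.1, by linarith [hx'.2]⟩, hx'.2, hg⟩
  have hfin : ∀ x ∈ P, cumul h x ≠ ∞ := fun x hx => by
    obtain ⟨x', hx', hlt, hg⟩ := habove x hx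
    exact ne_top_of_le_ne_top (hg hx').1 (cumul_mono h hlt.le)
  have hmono : ∀ x y, x ≤ y → y ∈ P → (cumul h x).toReal ≤ (cumul h y).toReal := fun x y hxy hy =>
    ENNReal.toReal_mono (hfin y hy) (cumul_mono h hxy)
  have hpos : ∀ x ∈ P, 0 < (cumul h x).toReal := fun x hx => by
    obtain ⟨x', hx', hlt, hg⟩ := hbelow x hx
    exact (hg hx').2.2.1.trans_le (hmono x' x hlt.le hx)
  have hcore : ∀ x ∈ P, (cumul h x).toReal ∈ core v := fun x hx => by
    obtain ⟨x', hx', hlt, hg⟩ := habove x hx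
    exact hv.mem_core_of_le (hg hx').2.2 (hpos x hx) (hmono x x' hlt.le hx')
  -- `f` is bounded below on `P ∩ (0, x)`, so there are no gaps
  have hsub : ∀ x ∈ P, Ioo 0 x ⊆ P := by
    intro x hx
    obtain ⟨x', hx', hlt, hg⟩ := habove x hx
    -- At good points `f` is nonincreasing, since `W` increases and `v` decreases. A violation at
    -- any point of `P` would persist on an open set, which contains a good point.
    have hlow : ∀ y ∈ P, y < x' → f x' ≤ f y := by
      intro y hy hyx
      by_contra hcon
      rw [not_le] at hcon
      have hU : IsOpen ((X ∩ Ioi 0) ∩ f ⁻¹' Iio (f x') ∩ P ∩ Iio x') :=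
        ((hcont'.isOpen_inter_preimage (hX.inter isOpen_Ioi) isOpen_Iio).inter hPo).inter isOpen_Iio
      obtain ⟨w, ⟨⟨⟨-, hw1⟩, hw2⟩, hw3⟩, hw4⟩ :=
        hdense _ hU ⟨y, ⟨⟨⟨hXmem y hy.2, hy.1⟩, hcon⟩, hy⟩, hyx⟩
      have h1 : v (cumul h x').toReal ≤ v (cumul h w).toReal :=
        hv.antitone (hpos w hw2) (hpos x' hx') (hmono w x' (le_of_lt hw3) hx')
      rw [← (hg hx').2.1, ← (hw4 hw2).2.1] at h1
      exact absurd hw1 (not_lt.2 ((Real.rpow_le_rpow_iff hx'.2.le hw2.2.le hγ).1 h1))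
    -- By `hlow`, the sets `f > 0` and `f < f x'` are disjoint to the left of `x'`. They are open
    -- and cover the connected interval `(0, x)`, so `f` never vanishes on it.
    refine isPreconnected_Ioo.subset_left_of_subset_union hPo
      (hcont'.isOpen_inter_preimage (hX.inter isOpen_Ioi) (isOpen_Iio (a := f x'))
        |>.inter (isOpen_Iio (a := x'))) ?_ ?_ ?_
    · rw [disjoint_left]
      exact fun y hy hy' => absurd hy'.1.2 (not_lt.2 (hlow y hy hy'.2))
    · intro y hy
      have hyX : y ∈ X := hXc.out h0X (hXmem x hx.2) (Ioo_subset_Icc_self hy)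
      rcases (hf0 y).eq_or_lt with h1 | h1
      · exact Or.inr ⟨⟨⟨hyX, hy.1⟩, by rw [mem_preimage, ← h1]; exact hx'.2⟩, hy.2.trans hlt⟩
      · exact Or.inl ⟨hy.1, h1⟩
    · obtain ⟨w, hw, hwx, -⟩ := hbelow x hx
      exact ⟨w, ⟨hw.1, hwx⟩, hw⟩
  have hPdown : ∀ y ∈ P, ∀ x, 0 < x → x ≤ y → x ∈ P := fun y hy x hx hxy => by
    rcases hxy.eq_or_lt with rfl | hlt
    · exact hy
    · exact hsub y hy ⟨hx, hlt⟩
  -- the cumulative function exhausts the profile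
  have hIP : ∫⁻ y in (fun x => (cumul h x).toReal) '' P, ENNReal.ofReal (v y) =
      ∫⁻ y in Ioi 0, ENNReal.ofReal (v y) := by
    rw [← lintegral_comp_cumul_surj hm (fun x hx => hx.1) hPdown hPo hfin rfl
      (by rintro _ ⟨x, hx, rfl⟩; exact hpos x hx) hv.measurable.ennreal_ofReal]
    have h1 : ∫⁻ x in P, ENNReal.ofReal (v (cumul h x).toReal) * h x =
        ∫⁻ x in Ioi 0, ENNReal.ofReal (f x) := by
      rw [← lintegral_indicator hPo.measurableSet, ← lintegral_indicator measurableSet_Ioi]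
      refine lintegral_congr_ae ?_
      filter_upwards [hgood] with x hx
      by_cases hxP : x ∈ P
      · rw [indicator_of_mem hxP, indicator_of_mem (show x ∈ Ioi 0 from hxP.1), ← (hx hxP).2.1, hh]
        dsimp only
        rw [ENNReal.ofReal_rpow_of_pos hxP.2, ← ENNReal.ofReal_mul (Real.rpow_nonneg hxP.2.le _),
          ← Real.rpow_add hxP.2]
        simp
      · rw [indicator_of_notMem hxP]
        by_cases hx0 : x ∈ Ioi 0
        · rw [indicator_of_mem hx0, ENNReal.ofReal_of_nonpos (not_lt.1 fun h2 => hxP ⟨hx0, h2⟩)]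
        · rw [indicator_of_notMem hx0]
    rw [h1]
    exact (ENNReal.mul_right_inj two_ne_zero ENNReal.ofNat_ne_top).1 (hmass.trans hv.mass.symm)
  have hex : ∀ z ∈ core v, ∃ x ∈ P, z ≤ (cumul h x).toReal := by
    intro z hz
    by_contra! hcon
    have hR : MeasurableSet ((fun x => (cumul h x).toReal) '' P) := by
      refine OrdConnected.measurableSet ⟨?_⟩
      rintro _ ⟨a, ha, rfl⟩ _ ⟨b, hb, rfl⟩ c hc
      obtain ⟨x, hx0, hxb, hxc⟩ := exists_cumul_eq hm hb.1.le (hfin b hb)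
        ((hpos a ha).trans_le hc.1) hc.2
      exact ⟨x, hPdown b hb x hx0 hxb, hxc⟩
    have hU : IsOpen (core v ∩ Ioi z) := hv.isOpen.inter isOpen_Ioi
    have hdisj : Disjoint ((fun x => (cumul h x).toReal) '' P) (core v ∩ Ioi z) := by
      rw [disjoint_left]
      rintro _ ⟨x, hx, rfl⟩ hx2
      exact absurd (hcon x hx) (not_lt.2 (le_of_lt hx2.2))
    -- The image of `P` already carries the full mass of `v`. If it stopped below `z`, the profile
    -- would have no mass beyond `z`, although it is positive on a nonempty open set there.
    have h1 : (∫⁻ y in Ioi 0, ENNReal.ofReal (v y)) +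
        ∫⁻ y in core v ∩ Ioi z, ENNReal.ofReal (v y) ≤ ∫⁻ y in Ioi 0, ENNReal.ofReal (v y) := by
      conv_lhs => rw [← hIP, ← lintegral_union hU.measurableSet hdisj]
      refine lintegral_mono_set (union_subset ?_ fun y hy => hy.1.1)
      rintro _ ⟨x, hx, rfl⟩
      exact hpos x hx
    have h2 : ∫⁻ y in Ioi 0, ENNReal.ofReal (v y) ≠ ∞ := fun h3 => by
      have := hv.mass
      rw [h3] at this
      simp at this
    have h3 : ∫⁻ y in core v ∩ Ioi z, ENNReal.ofReal (v y) = 0 := by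
      by_contra h4
      exact absurd h1 (not_le.2 (ENNReal.lt_add_right h2 h4))
    rw [lintegral_eq_zero_iff hv.measurable.ennreal_ofReal, Filter.EventuallyEq,
      ae_restrict_iff' hU.measurableSet] at h3
    obtain ⟨ε, hε, hb⟩ := Metric.isOpen_iff.1 hv.isOpen z hz
    obtain ⟨y, hy, hy2⟩ := (Measure.dense_of_ae h3).exists_mem_open hU ⟨z + ε / 2, hb (by
      rw [Metric.mem_ball, Real.dist_eq, abs_lt]; constructor <;> linarith), by
      rw [mem_Ioi]; linarith⟩
    have h4 := hy hy2
    simp only [Pi.zero_apply, ENNReal.ofReal_eq_zero] at h4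
    exact absurd hy2.1.2 (not_lt.2 h4)
  -- the cumulative function inverts the escort map
  have hinv : ∀ x ∈ P, escortMap γ v (cumul h x).toReal = x := by
    intro x hx
    rw [escortMap, cumul, ← lintegral_comp_cumul_Ioc hm hx.1.le (hfin x hx) hv.measurable_weight]
    -- Along the solution the escort weight is `f ^ (γ - 1)`, which cancels against `f ^ (1 - γ)`.
    have h1 : ∫⁻ t in Ioc 0 x, ENNReal.ofReal (v (cumul h t).toReal) ^ ((γ - 1) / γ) * h t =
        ∫⁻ t in Ioc 0 x, 1 := by
      refine setLIntegral_congr_fun_ae measurableSet_Ioc ?_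
      filter_upwards [hgood] with t ht htx
      have htP := hPdown x hx t htx.1 htx.2
      rw [← (ht htP).2.1, hh]
      dsimp only
      rw [ENNReal.ofReal_rpow_of_pos (Real.rpow_pos_of_pos htP.2 _),
        ENNReal.ofReal_rpow_of_pos htP.2,
        ← ENNReal.ofReal_mul (Real.rpow_nonneg (Real.rpow_nonneg htP.2.le _) _),
        ← Real.rpow_mul htP.2.le, ← Real.rpow_add htP.2]
      have : γ * ((γ - 1) / γ) + (1 - γ) = 0 := by field_simp; ring
      rw [this]
      simp
    rw [h1]
    simp [hx.1.le]
  filter_upwards [hgood] with x hx hx0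
  by_cases hxP : x ∈ P
  · have h1 := hE.apply_pos _ (hcore x hxP)
    rw [hinv x hxP, ← (hx hxP).2.1, ← Real.rpow_mul hxP.2.le, mul_one_div_cancel hγ.ne',
      Real.rpow_one] at h1
    exact h1.symm
  -- If `E x ≠ 0`, then `x` is the image of some `z` in the core, and `W` exceeds `z` at some `y ∈
  -- P`. Hence `x ≤ y`, and `x ∈ P` after all.
  · have h1 : f x = 0 := le_antisymm (not_lt.1 fun h2 => hxP ⟨hx0, h2⟩) (hf0 x)
    rw [h1]
    by_contra h2
    obtain ⟨z, hz, hzx⟩ := hE.support x hx0.ne' (Ne.symm h2)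
    obtain ⟨y, hy, hzy⟩ := hex z hz
    refine hxP (hPdown y hy x hx0 ?_)
    rw [← hinv y hy, ← abs_of_pos hx0, ← hzx]
    exact hv.strictMonoOn_escortMap.monotoneOn hz (hcore y hy) hzy

theorem IsC1Density.ae_eq_of_ae_eq_profile (hf : IsC1Density f) (hv : IsProfile γ v) (hγ : 0 < γ)
    (hE : IsEscort γ v E)
    (hae : ∀ᵐ x, 0 < f x → absCumulative γ f x ≠ ∞ ∧ f x ^ γ = v (absCumulative γ f x).toReal) :
    f =ᵐ[volume] E := by
  obtain ⟨X, hX, hXc, hcont, hfX⟩ := hf.contDiff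
  have hm := hf.measurable
  have hqm : Measure.QuasiMeasurePreserving (fun x : ℝ => -x) volume volume :=
    (Measure.measurePreserving_neg volume).quasiMeasurePreserving
  have hae1 : ∀ᵐ x, 0 < x → 0 < f x → absCumulative γ f x ≠ ∞ ∧
      f x ^ γ = v (absCumulative γ f x).toReal := hae.mono fun x hx _ => hx
  have hae2 : ∀ᵐ x, 0 < x → 0 < f (-x) → absCumulative γ (fun t => f (-t)) x ≠ ∞ ∧
      f (-x) ^ γ = v (absCumulative γ (fun t => f (-t)) x).toReal := by
    filter_upwards [hqm.ae hae] with x hx _ hfx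
    rw [← absCumulative_neg]
    exact hx hfx
  have h1 := two_mul_lintegral_Ioi_le hv hm hae1
  have h2 := two_mul_lintegral_Ioi_le hv (hm.comp measurable_neg) hae2
  have h3 := hf.mass_one
  rw [lintegral_eq_Ioi_add_neg] at h3
  simp only [Function.comp_apply] at h2
  set a := ∫⁻ x in Ioi 0, ENNReal.ofReal (f x)
  set b := ∫⁻ x in Ioi 0, ENNReal.ofReal (f (-x))
  have hab := two_mul_eq_one_of_add_eq_one h1 h2 h3
  have hex : ∀ g : ℝ → ℝ, 2 * ∫⁻ x in Ioi 0, ENNReal.ofReal (g x) = 1 → ∃ x, 0 < x ∧ 0 < g x := by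
    intro g hg
    by_contra! hcon
    rw [setLIntegral_congr_fun measurableSet_Ioi (g := fun _ => 0) fun y hy =>
      ENNReal.ofReal_of_nonpos (hcon y hy)] at hg
    simp at hg
  -- Both half-lines carry mass, so the interval `X` meets both and contains the origin; this
  -- anchors the connectedness argument on each side.
  have h0X : (0 : ℝ) ∈ X := by
    obtain ⟨x, hx0, hx⟩ := hex f hab.1
    obtain ⟨y, hy0, hy⟩ := hex (fun y => f (-y)) hab.2
    have hxX : x ∈ X := by by_contra h; exact hx.ne' (hfX x h)
    have hyX : -y ∈ X := by by_contra h; exact hy.ne' (hfX _ h)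
    exact hXc.out hyX hxX ⟨by linarith, hx0.le⟩
  have h4 := ae_eq_Ioi_of_ae_eq_profile hv hγ hE hX hXc h0X hcont.continuousOn hfX hf.nonneg hm
    hab.1 hae1
  have hX' : OrdConnected ((fun x : ℝ => -x) ⁻¹' X) :=
    ⟨fun a ha b hb c hc => hXc.out hb ha ⟨neg_le_neg hc.2, neg_le_neg hc.1⟩⟩
  have h5 := ae_eq_Ioi_of_ae_eq_profile hv hγ hE.comp_neg (hX.preimage continuous_neg) hX'
    (by simpa using h0X) (hcont.continuousOn.comp continuous_neg.continuousOn
      fun x hx => ⟨hx.1, by simpa using hx.2⟩)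
    (fun x hx => hfX _ hx) (fun x => hf.nonneg _) (hm.comp measurable_neg) hab.2 hae2
  filter_upwards [h4, hqm.ae h5, Measure.ae_ne volume (0 : ℝ)] with x hx hx' hx0
  rcases lt_or_gt_of_ne hx0 with h | h
  · simpa using hx' (neg_pos.2 h)
  · exact hx h

end uniqueness

/-! ### Means of extended real functions -/

/-- The identity `t⁺ - t⁻ = t` for `x + c`, `x` and `c`, in additive form so that it also holds for
`x = ±∞`. -/
theorem toENNReal_add_coe_add (x : EReal) (c : ℝ) :
    (x + c).toENNReal + ((-x).toENNReal + ENNReal.ofReal (-c)) =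
      (-(x + c)).toENNReal + (x.toENNReal + ENNReal.ofReal c) := by
  induction x with
  | bot => simp
  | top => simp
  | coe r =>
    rw [← EReal.coe_add, ← EReal.coe_neg, ← EReal.coe_neg]
    simp only [EReal.real_coe_toENNReal, ← ofReal_max_zero (r + c), ← ofReal_max_zero (-r),
      ← ofReal_max_zero (-c), ← ofReal_max_zero (-(r + c)), ← ofReal_max_zero r,
      ← ofReal_max_zero c]
    have key : ∀ t : ℝ, max t 0 = t + max (-t) 0 := fun t => by
      rcases le_total 0 t with h | h
      · rw [max_eq_left h, max_eq_right (by linarith), add_zero]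
      · rw [max_eq_right h, max_eq_left (by linarith)]; ring
    rw [← ENNReal.ofReal_add (by positivity) (by positivity),
      ← ENNReal.ofReal_add (by positivity) (by positivity),
      ← ENNReal.ofReal_add (by positivity) (by positivity),
      ← ENNReal.ofReal_add (by positivity) (by positivity)]
    congr 1
    linarith [key (r + c), key r, key c]

/-- A finite shift changes the integrals of the positive and the negative part by a finite amount,
so infinite ones remain infinite; the convention `⊤ - ⊤ = ⊥` agrees on both sides. When both are
finite the identity is an ordinary subtraction. -/
theorem mean_add_const {f : ℝ → ℝ} (hf : Measurable f) (hf1 : ∫⁻ x, ENNReal.ofReal (f x) = 1)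
    {φ : ℝ → EReal} (hφ : Measurable φ) (c : ℝ) :
    mean (fun x => φ x + c) f = mean φ f + c := by
  have hF := hf.ennreal_ofReal
  have hφc : Measurable fun x => φ x + c := hφ.add measurable_const
  have m1 : Measurable fun x => (φ x + c).toENNReal * ENNReal.ofReal (f x) :=
    hφc.ereal_toENNReal.mul hF
  have m2 : Measurable fun x => (-(φ x + c)).toENNReal * ENNReal.ofReal (f x) :=
    hφc.neg.ereal_toENNReal.mul hF
  have m3 : Measurable fun x => (φ x).toENNReal * ENNReal.ofReal (f x) := hφ.ereal_toENNReal.mul hF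
  have m4 : Measurable fun x => (-φ x).toENNReal * ENNReal.ofReal (f x) :=
    hφ.neg.ereal_toENNReal.mul hF
  have hadd : ∀ g h : ℝ → ℝ≥0∞, Measurable g → ∀ t : ℝ≥0∞, t ≠ ∞ →
      ∫⁻ x, (g x + (h x + t * ENNReal.ofReal (f x))) = (∫⁻ x, g x) + ((∫⁻ x, h x) + t) := by
    intro g h hg t ht
    rw [lintegral_add_left hg, lintegral_add_right _ (hF.const_mul t), lintegral_const_mul' _ _ ht,
      hf1, mul_one]
  have hle : ∀ g h : ℝ → ℝ≥0∞, ∀ t : ℝ≥0∞, t ≠ ∞ → (∀ x, g x ≤ h x + t) →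
      ∫⁻ x, g x * ENNReal.ofReal (f x) ≤ (∫⁻ x, h x * ENNReal.ofReal (f x)) + t := by
    intro g h t ht hgh
    calc ∫⁻ x, g x * ENNReal.ofReal (f x)
        ≤ ∫⁻ x, (h x * ENNReal.ofReal (f x) + t * ENNReal.ofReal (f x)) :=
          lintegral_mono fun x => by rw [← add_mul]; gcongr; exact hgh x
      _ = _ := by
          rw [lintegral_add_right _ (hF.const_mul t), lintegral_const_mul' _ _ ht, hf1, mul_one]
  rw [mean, mean]
  have h1 : (∫⁻ x, (φ x + c).toENNReal * ENNReal.ofReal (f x)) +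
      ((∫⁻ x, (-φ x).toENNReal * ENNReal.ofReal (f x)) + ENNReal.ofReal (-c)) =
      (∫⁻ x, (-(φ x + c)).toENNReal * ENNReal.ofReal (f x)) +
      ((∫⁻ x, (φ x).toENNReal * ENNReal.ofReal (f x)) + ENNReal.ofReal c) := by
    rw [← hadd _ _ m1 _ ENNReal.ofReal_ne_top, ← hadd _ _ m2 _ ENNReal.ofReal_ne_top]
    refine lintegral_congr fun x => ?_
    rw [← add_mul, ← add_mul, ← add_mul, ← add_mul, toENNReal_add_coe_add]
  have h2 : ∫⁻ x, (φ x + c).toENNReal * ENNReal.ofReal (f x) ≤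
      (∫⁻ x, (φ x).toENNReal * ENNReal.ofReal (f x)) + ENNReal.ofReal c :=
    hle _ _ _ ENNReal.ofReal_ne_top fun x => EReal.toENNReal_add_le
  have hsub : ∀ x, φ x = φ x + c + (-c : ℝ) := fun x => by
    rw [EReal.coe_neg, ← sub_eq_add_neg, EReal.add_sub_cancel_right]
  have h3 : ∫⁻ x, (φ x).toENNReal * ENNReal.ofReal (f x) ≤
      (∫⁻ x, (φ x + c).toENNReal * ENNReal.ofReal (f x)) + ENNReal.ofReal (-c) :=
    hle _ _ _ ENNReal.ofReal_ne_top fun x => by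
      conv_lhs => rw [hsub x]
      exact EReal.toENNReal_add_le
  have hneg : ∀ x, -(φ x + c) = -φ x + (-c : ℝ) := fun x => by
    rw [EReal.neg_add (Or.inr (EReal.coe_ne_top c)) (Or.inr (EReal.coe_ne_bot c)), EReal.coe_neg,
      sub_eq_add_neg]
  have h4 : ∫⁻ x, (-(φ x + c)).toENNReal * ENNReal.ofReal (f x) ≤
      (∫⁻ x, (-φ x).toENNReal * ENNReal.ofReal (f x)) + ENNReal.ofReal (-c) :=
    hle _ _ _ ENNReal.ofReal_ne_top fun x => by
      rw [hneg]
      exact EReal.toENNReal_add_le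
  have h5 : ∫⁻ x, (-φ x).toENNReal * ENNReal.ofReal (f x) ≤
      (∫⁻ x, (-(φ x + c)).toENNReal * ENNReal.ofReal (f x)) + ENNReal.ofReal c :=
    hle _ _ _ ENNReal.ofReal_ne_top fun x => by
      have : -φ x = -(φ x + c) + (c : ℝ) := by
        rw [hneg, EReal.coe_neg, ← sub_eq_add_neg, EReal.sub_add_cancel]
      conv_lhs => rw [this]
      exact EReal.toENNReal_add_le
  set P := ∫⁻ x, (φ x).toENNReal * ENNReal.ofReal (f x)
  set N := ∫⁻ x, (-φ x).toENNReal * ENNReal.ofReal (f x)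
  set P' := ∫⁻ x, (φ x + c).toENNReal * ENNReal.ofReal (f x)
  set N' := ∫⁻ x, (-(φ x + c)).toENNReal * ENNReal.ofReal (f x)
  by_cases hN : N = ∞
  · have hN' : N' = ∞ := by
      by_contra h
      exact ENNReal.add_ne_top.2 ⟨h, ENNReal.ofReal_ne_top⟩ (top_le_iff.1 (hN ▸ h5))
    simp [hN, hN']
  have hN' : N' ≠ ∞ := ne_top_of_le_ne_top (ENNReal.add_ne_top.2 ⟨hN, ENNReal.ofReal_ne_top⟩) h4
  by_cases hP : P = ∞
  · have hP' : P' = ∞ := by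
      by_contra h
      exact ENNReal.add_ne_top.2 ⟨h, ENNReal.ofReal_ne_top⟩ (top_le_iff.1 (hP ▸ h3))
    rw [hP, hP', ← EReal.coe_ennreal_toReal hN, ← EReal.coe_ennreal_toReal hN',
      EReal.coe_ennreal_top, EReal.top_sub_coe, EReal.top_sub_coe, EReal.top_add_coe]
  have hP' : P' ≠ ∞ := ne_top_of_le_ne_top (ENNReal.add_ne_top.2 ⟨hP, ENNReal.ofReal_ne_top⟩) h2
  rw [← EReal.coe_ennreal_toReal hN, ← EReal.coe_ennreal_toReal hN', ← EReal.coe_ennreal_toReal hP,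
    ← EReal.coe_ennreal_toReal hP', ← EReal.coe_sub, ← EReal.coe_sub, ← EReal.coe_add,
    EReal.coe_eq_coe_iff]
  have h6 := congrArg ENNReal.toReal h1
  have hc1 : (ENNReal.ofReal c).toReal = max c 0 := ENNReal.toReal_ofReal'
  have hc2 : (ENNReal.ofReal (-c)).toReal = max (-c) 0 := ENNReal.toReal_ofReal'
  rw [ENNReal.toReal_add hP' (ENNReal.add_ne_top.2 ⟨hN, ENNReal.ofReal_ne_top⟩),
    ENNReal.toReal_add hN ENNReal.ofReal_ne_top,
    ENNReal.toReal_add hN' (ENNReal.add_ne_top.2 ⟨hP, ENNReal.ofReal_ne_top⟩),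
    ENNReal.toReal_add hP ENNReal.ofReal_ne_top, hc1, hc2] at h6
  have h7 : max c 0 = c + max (-c) 0 := by
    rcases le_total 0 c with h | h
    · rw [max_eq_left h, max_eq_right (by linarith), add_zero]
    · rw [max_eq_right h, max_eq_left (by linarith)]; ring
  linarith

theorem mean_congr_ae {f g : ℝ → ℝ} {φ ψ : ℝ → EReal} (hfg : f =ᵐ[volume] g)
    (h : ∀ᵐ x, 0 < f x → φ x = ψ x) : mean φ f = mean ψ g := by
  rw [mean, mean]
  refine congrArg₂ (fun a b : ℝ≥0∞ => (a : EReal) - (b : EReal)) (lintegral_congr_ae ?_)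
    (lintegral_congr_ae ?_) <;>
  · filter_upwards [hfg, h] with x hx hφ
    by_cases h0 : 0 < f x
    · rw [hφ h0, hx]
    · rw [← hx, ENNReal.ofReal_of_nonpos (not_lt.1 h0), mul_zero, mul_zero]

/-! ### Dependence on the equivalence class, and scaling -/

theorem absCumulative_congr_ae {f g : ℝ → ℝ} (hfg : f =ᵐ[volume] g) (γ : ℝ) :
    absCumulative γ f = absCumulative γ g := by
  ext x
  refine setLIntegral_congr_fun_ae measurableSet_uIoc ?_
  filter_upwards [hfg] with t ht _
  rw [ht]

theorem entropyPower_congr_ae {f g : ℝ → ℝ} (hfg : f =ᵐ[volume] g) (lam : ℝ) :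
    entropyPower lam f = entropyPower lam g := by
  rw [entropyPower, entropyPower]
  split_ifs
  · refine congrArg _ (mean_congr_ae hfg ?_)
    filter_upwards [hfg] with x hx _
    rw [hx]
  · congr 1
    refine lintegral_congr_ae ?_
    filter_upwards [hfg] with x hx
    rw [hx]

theorem cumulativeDeviation_congr_ae {f g : ℝ → ℝ} (hfg : f =ᵐ[volume] g) (q : ℝ≥0∞) (γ : ℝ) :
    cumulativeDeviation q γ f = cumulativeDeviation q γ g := by
  rw [cumulativeDeviation, cumulativeDeviation, absCumulative_congr_ae hfg]
  split_ifs
  · rw [mean_congr_ae hfg (Filter.Eventually.of_forall fun _ _ => rfl)]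
  · have : ({x | 0 < f x} : Set ℝ) =ᵐ[volume] {x | 0 < g x} := by
      filter_upwards [hfg] with x hx
      change (0 < f x) = (0 < g x)
      rw [hx]
    rw [Measure.restrict_congr_set this]
  · rw [absCumulativeMoment, absCumulativeMoment, absCumulative_congr_ae hfg]
    congr 1
    refine lintegral_congr_ae ?_
    filter_upwards [hfg] with x hx
    rw [hx]

/-- The rescaled density `κ f (κ x)`. -/
def scale (κ : ℝ) (f : ℝ → ℝ) (x : ℝ) : ℝ := κ * f (κ * x)

section scale

variable {κ : ℝ} {f : ℝ → ℝ}

theorem scale_scale (a b : ℝ) (f : ℝ → ℝ) : scale a (scale b f) = scale (a * b) f := by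
  ext x
  simp only [scale]
  rw [show b * (a * x) = a * b * x by ring]
  ring

theorem scale_one (f : ℝ → ℝ) : scale 1 f = f := by
  ext x; simp [scale]

theorem quasiMeasurePreserving_mul_left (hκ : 0 < κ) :
    Measure.QuasiMeasurePreserving (fun x : ℝ => κ * x) volume volume := by
  refine ⟨measurable_const_mul κ, ?_⟩
  rw [Real.map_volume_mul_left hκ.ne']
  exact Measure.smul_absolutelyContinuous

theorem lintegral_comp_mul_left (hκ : 0 < κ) (F : ℝ → ℝ≥0∞) :
    ENNReal.ofReal κ * ∫⁻ x, F (κ * x) = ∫⁻ x, F x := by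
  have h1 : MeasurableEmbedding fun x : ℝ => κ * x :=
    (Homeomorph.mulLeft₀ κ hκ.ne').measurableEmbedding
  rw [← h1.lintegral_map, Real.map_volume_mul_left hκ.ne', lintegral_smul_measure, smul_eq_mul,
    ← mul_assoc, ← ENNReal.ofReal_mul hκ.le, abs_of_pos (inv_pos.2 hκ), mul_inv_cancel₀ hκ.ne',
    ENNReal.ofReal_one, one_mul]

theorem lintegral_mul_scale (hκ : 0 < κ) (F : ℝ → ℝ≥0∞) :
    ∫⁻ x, F (κ * x) * ENNReal.ofReal (scale κ f x) = ∫⁻ x, F x * ENNReal.ofReal (f x) := by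
  rw [← lintegral_comp_mul_left hκ fun x => F x * ENNReal.ofReal (f x),
    ← lintegral_const_mul' _ _ ENNReal.ofReal_ne_top]
  refine lintegral_congr fun x => ?_
  rw [scale, ENNReal.ofReal_mul hκ.le]
  ring

theorem mean_scale (hκ : 0 < κ) (φ : ℝ → EReal) :
    mean (fun x => φ (κ * x)) (scale κ f) = mean φ f := by
  rw [mean, mean, lintegral_mul_scale hκ (fun x => (φ x).toENNReal),
    lintegral_mul_scale hκ (fun x => (-φ x).toENNReal)]

/-- The integrand contributes `κ ^ (1 - γ)` and the substitution `κ⁻¹`. -/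
theorem absCumulative_scale (hκ : 0 < κ) (γ : ℝ) (x : ℝ) :
    absCumulative γ (scale κ f) x = ENNReal.ofReal (κ ^ (-γ)) * absCumulative γ f (κ * x) := by
  have hc := ENNReal.ofReal_pos.2 hκ
  have h1 : absCumulative γ f (κ * x) =
      ENNReal.ofReal κ * ∫⁻ t in uIoc 0 x, ENNReal.ofReal (f (κ * t)) ^ (1 - γ) := by
    rw [absCumulative, ← lintegral_indicator measurableSet_uIoc,
      ← lintegral_indicator measurableSet_uIoc, ← lintegral_comp_mul_left hκ]
    congr 1
    refine lintegral_congr fun t => ?_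
    have : κ * t ∈ uIoc 0 (κ * x) ↔ t ∈ uIoc 0 x := by
      simp only [mem_uIoc]
      rw [mul_pos_iff_of_pos_left hκ, mul_le_mul_iff_right₀ hκ, mul_lt_mul_iff_right₀ hκ,
        show κ * t ≤ 0 ↔ t ≤ 0 by rw [← mul_le_mul_iff_right₀ hκ (b := t) (c := 0), mul_zero]]
    by_cases ht : t ∈ uIoc 0 x
    · rw [indicator_of_mem ht, indicator_of_mem (this.2 ht)]
    · rw [indicator_of_notMem ht, indicator_of_notMem fun h => ht (this.1 h)]
  rw [h1, absCumulative, ← mul_assoc, ← ENNReal.ofReal_mul (Real.rpow_nonneg hκ.le _),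
    ← Real.rpow_add_one hκ.ne', ← lintegral_const_mul' _ _ ENNReal.ofReal_ne_top]
  refine lintegral_congr fun t => ?_
  rw [scale, ENNReal.ofReal_mul hκ.le, ENNReal.mul_rpow_of_ne_top ENNReal.ofReal_ne_top
    ENNReal.ofReal_ne_top, ENNReal.ofReal_rpow_of_pos hκ, neg_add_eq_sub]

theorem IsC1Density.scale (hf : IsC1Density f) (hκ : 0 < κ) : IsC1Density (scale κ f) where
  nonneg x := mul_nonneg hκ.le (hf.nonneg _)
  mass_one := by
    have h := lintegral_mul_scale (f := f) hκ (fun _ => 1)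
    simp only [one_mul] at h
    rw [h, hf.mass_one]
  contDiff := by
    obtain ⟨X, hX, hXc, hc, h0⟩ := hf.contDiff
    refine ⟨(fun x => κ * x) ⁻¹' X, hX.preimage (continuous_const_mul κ),
      ⟨fun a ha b hb c hc => hXc.out ha hb ⟨by dsimp only; gcongr; exact hc.1,
        by dsimp only; gcongr; exact hc.2⟩⟩, ?_, fun x hx => ?_⟩
    · refine contDiffOn_const.mul (hc.comp (contDiff_const.mul contDiff_id).contDiffOn ?_)
      exact fun x hx => ⟨hx.1, by simpa [hκ.ne'] using hx.2⟩
    · rw [CumulativeMoments.scale, h0 _ hx, mul_zero]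

/-- For negative exponents multiplicativity can fail at `0 * ∞`; a finite positive factor avoids
this. -/
theorem ofReal_mul_rpow {a : ℝ} (ha : 0 < a) (x : ℝ≥0∞) (r : ℝ) :
    (ENNReal.ofReal a * x) ^ r = ENNReal.ofReal (a ^ r) * x ^ r := by
  rw [← ENNReal.ofReal_rpow_of_pos ha]
  by_cases hx : x = ∞
  · rcases lt_or_ge r 0 with hr | hr
    · rw [hx, ENNReal.mul_top (ENNReal.ofReal_pos.2 ha).ne', ENNReal.top_rpow_of_neg hr, mul_zero]
    · rw [ENNReal.mul_rpow_of_nonneg _ _ hr]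
  · rw [ENNReal.mul_rpow_of_ne_top ENNReal.ofReal_ne_top hx]

theorem entropyPower_scale (hκ : 0 < κ) (lam : ℝ) (hf : Measurable f)
    (hf1 : ∫⁻ x, ENNReal.ofReal (f x) = 1) :
    entropyPower lam (scale κ f) = ENNReal.ofReal κ⁻¹ * entropyPower lam f := by
  rw [entropyPower, entropyPower]
  split_ifs with h
  · have h1 : (fun x => -(ENNReal.ofReal (scale κ f x)).log) =
        fun x => (fun y => -(ENNReal.ofReal (f y)).log + ((-Real.log κ : ℝ) : EReal)) (κ * x) := by
      ext x
      simp only [scale]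
      rw [ENNReal.ofReal_mul hκ.le, ENNReal.log_mul_add, ENNReal.log_ofReal_of_pos hκ,
        EReal.neg_add (Or.inl (EReal.coe_ne_bot _)) (Or.inl (EReal.coe_ne_top _)), EReal.coe_neg,
        sub_eq_add_neg, add_comm]
    have h2 : Measurable fun y => -(ENNReal.ofReal (f y)).log := hf.ennreal_ofReal.ennreal_log.neg
    rw [h1, mean_scale hκ (fun y => -(ENNReal.ofReal (f y)).log + ((-Real.log κ : ℝ) : EReal)),
      mean_add_const hf hf1 h2, EReal.exp_add, EReal.exp_coe,
      Real.exp_neg, Real.exp_log hκ, mul_comm]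
  · have h1 : ∀ x, ENNReal.ofReal (scale κ f x) ^ (lam - 1) * ENNReal.ofReal (scale κ f x) =
        ENNReal.ofReal (κ ^ (lam - 1)) * ((fun y => ENNReal.ofReal (f y) ^ (lam - 1)) (κ * x) *
          ENNReal.ofReal (scale κ f x)) := by
      intro x
      dsimp only
      rw [← mul_assoc]
      congr 1
      rw [scale, ENNReal.ofReal_mul hκ.le, ENNReal.mul_rpow_of_ne_top ENNReal.ofReal_ne_top
        ENNReal.ofReal_ne_top, ENNReal.ofReal_rpow_of_pos hκ]
    simp_rw [h1]
    rw [lintegral_const_mul' _ _ ENNReal.ofReal_ne_top,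
      lintegral_mul_scale hκ fun y => ENNReal.ofReal (f y) ^ (lam - 1)]
    rw [ofReal_mul_rpow (Real.rpow_pos_of_pos hκ _), ← Real.rpow_mul hκ.le,
      show (lam - 1) * (1 / (1 - lam)) = -1 by
        have : (1 : ℝ) - lam ≠ 0 := sub_ne_zero.2 (Ne.symm h)
        field_simp; ring, Real.rpow_neg_one]

theorem essSup_absCumulative_scale_le (hκ : 0 < κ) (γ : ℝ) (hf : Measurable f) :
    essSup (absCumulative γ (scale κ f)) (volume.restrict {x | 0 < scale κ f x}) ≤
      ENNReal.ofReal (κ ^ (-γ)) *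
        essSup (absCumulative γ f) (volume.restrict {x | 0 < f x}) := by
  refine essSup_le_of_ae_le _ ?_
  have h1 := ENNReal.ae_le_essSup (μ := volume.restrict {x | 0 < f x}) (absCumulative γ f)
  have h2 := (quasiMeasurePreserving_mul_left hκ).ae (ae_imp_of_ae_restrict h1)
  have hm : Measurable (scale κ f) := measurable_const.mul (hf.comp (measurable_const_mul κ))
  rw [Filter.EventuallyLE, ae_restrict_iff' (measurableSet_pos hm)]
  filter_upwards [h2] with x hx hx0
  rw [absCumulative_scale hκ]
  gcongr
  exact hx ((mul_pos_iff_of_pos_left hκ).1 hx0)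

theorem cumulativeDeviation_scale (hκ : 0 < κ) {γ : ℝ} (hγ : 0 < γ) (q : ℝ≥0∞)
    (hf : Measurable f) (hf1 : ∫⁻ x, ENNReal.ofReal (f x) = 1) :
    cumulativeDeviation q γ (scale κ f) = ENNReal.ofReal κ⁻¹ * cumulativeDeviation q γ f := by
  have hκγ := Real.rpow_pos_of_pos hκ (-γ)
  rw [cumulativeDeviation, cumulativeDeviation]
  split_ifs with h0 htop
  · have h1 : (fun x => (absCumulative γ (scale κ f) x).log) =
        fun x => (fun y => (absCumulative γ f y).log + ((Real.log (κ ^ (-γ)) : ℝ) : EReal))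
          (κ * x) := by
      ext x
      dsimp only
      rw [absCumulative_scale hκ, ENNReal.log_mul_add, ENNReal.log_ofReal_of_pos hκγ, add_comm]
    rw [h1, mean_scale hκ (fun y => (absCumulative γ f y).log + ((Real.log (κ ^ (-γ)) : ℝ) : EReal)),
      mean_add_const hf hf1 (measurable_absCumulative γ f).ennreal_log, EReal.exp_add,
      EReal.exp_coe, Real.exp_log hκγ, ENNReal.mul_rpow_of_nonneg _ _ (one_div_nonneg.2 hγ.le),
      ENNReal.ofReal_rpow_of_pos hκγ, ← Real.rpow_mul hκ.le,
      show -γ * (1 / γ) = -1 by field_simp, Real.rpow_neg_one, mul_comm]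
  · have h1 := essSup_absCumulative_scale_le hκ γ hf
    -- The reverse inequality is the same one for the inverse dilation.
    have h2 := essSup_absCumulative_scale_le (f := scale κ f) (inv_pos.2 hκ) γ
      (measurable_const.mul (hf.comp (measurable_const_mul κ)))
    rw [scale_scale, inv_mul_cancel₀ hκ.ne', scale_one] at h2
    have h3 : essSup (absCumulative γ (scale κ f)) (volume.restrict {x | 0 < scale κ f x}) =
        ENNReal.ofReal (κ ^ (-γ)) *
          essSup (absCumulative γ f) (volume.restrict {x | 0 < f x}) := by
      refine le_antisymm h1 ((mul_le_mul_right h2 _).trans (le_of_eq ?_))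
      rw [← mul_assoc, ← ENNReal.ofReal_mul hκγ.le, Real.inv_rpow hκ.le,
        mul_inv_cancel₀ hκγ.ne', ENNReal.ofReal_one, one_mul]
    rw [h3, ENNReal.mul_rpow_of_nonneg _ _ (one_div_nonneg.2 hγ.le),
      ENNReal.ofReal_rpow_of_pos hκγ, ← Real.rpow_mul hκ.le,
      show -γ * (1 / γ) = -1 by field_simp, Real.rpow_neg_one]
  · have hq : 0 < q.toReal := ENNReal.toReal_pos h0 htop
    have h1 : absCumulativeMoment q.toReal γ (scale κ f) =
        ENNReal.ofReal ((κ ^ (-γ)) ^ q.toReal) * absCumulativeMoment q.toReal γ f := by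
      rw [absCumulativeMoment, absCumulativeMoment,
        ← lintegral_mul_scale hκ (fun x => absCumulative γ f x ^ q.toReal),
        ← lintegral_const_mul' _ _ ENNReal.ofReal_ne_top]
      refine lintegral_congr fun x => ?_
      rw [absCumulative_scale hκ, ENNReal.mul_rpow_of_nonneg _ _ hq.le,
        ENNReal.ofReal_rpow_of_pos hκγ, mul_assoc]
    rw [h1, ENNReal.mul_rpow_of_nonneg _ _ (by positivity),
      ENNReal.ofReal_rpow_of_pos (by positivity), ← Real.rpow_mul hκ.le, ← Real.rpow_mul hκ.le,
      show -γ * q.toReal * (1 / (q.toReal * γ)) = -1 by field_simp, Real.rpow_neg_one]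

end scale

/-! ### Reduction to densities of normalized deviation -/

/-- Both functionals are multiplied by `κ⁻¹` under the dilation by `κ`, so their quotient is
invariant. A density of positive finite deviation is dilated to the deviation of `f₀`, where `hn`
compares entropies. Infinite deviation is trivial, and zero deviation is covered by `hz`. -/
theorem sharp_of_normalized {q : ℝ≥0∞} {γ lam K κ₀ : ℝ} {ρ f₀ : ℝ → ℝ} (hγ : 0 < γ) (hκ₀ : 0 < κ₀)
    (hρ : ρ = scale κ₀ f₀) (h₀ : IsC1Density f₀)
    (hN0 : entropyPower lam f₀ ≠ 0) (hNt : entropyPower lam f₀ ≠ ∞)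
    (hD0 : cumulativeDeviation q γ f₀ ≠ 0) (hDt : cumulativeDeviation q γ f₀ ≠ ∞)
    (hK : cumulativeDeviation q γ f₀ / entropyPower lam f₀ = ENNReal.ofReal K)
    (hz : ∀ f, IsC1Density f → cumulativeDeviation q γ f = 0 → entropyPower lam f = 0)
    (hn : ∀ f, IsC1Density f → cumulativeDeviation q γ f = cumulativeDeviation q γ f₀ →
      entropyPower lam f ≤ entropyPower lam f₀ ∧
        (entropyPower lam f = entropyPower lam f₀ → f =ᵐ[volume] f₀)) :
    0 < K ∧ (IsC1Density ρ ∧ entropyPower lam ρ ≠ 0 ∧ entropyPower lam ρ ≠ ∞ ∧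
      cumulativeDeviation q γ ρ / entropyPower lam ρ = ENNReal.ofReal K) ∧
    ∀ f : ℝ → ℝ, IsC1Density f →
      ENNReal.ofReal K * entropyPower lam f ≤ cumulativeDeviation q γ f ∧
      (entropyPower lam f ≠ 0 → entropyPower lam f ≠ ∞ →
        ENNReal.ofReal K ≤ cumulativeDeviation q γ f / entropyPower lam f ∧
        (cumulativeDeviation q γ f / entropyPower lam f = ENNReal.ofReal K ↔
          ∃ κ : ℝ, 0 < κ ∧ f =ᵐ[volume] fun x => κ * ρ (κ * x))) := by
  have hDs : ∀ f, IsC1Density f → ∀ κ : ℝ, 0 < κ → cumulativeDeviation q γ (scale κ f) =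
      ENNReal.ofReal κ⁻¹ * cumulativeDeviation q γ f := fun f hf κ hκ =>
    cumulativeDeviation_scale hκ hγ q hf.measurable hf.mass_one
  have hNs : ∀ f, IsC1Density f → ∀ κ : ℝ, 0 < κ → entropyPower lam (scale κ f) =
      ENNReal.ofReal κ⁻¹ * entropyPower lam f := fun f hf κ hκ =>
    entropyPower_scale hκ lam hf.measurable hf.mass_one
  have hratio : ∀ κ : ℝ, 0 < κ → cumulativeDeviation q γ (scale κ f₀) /
      entropyPower lam (scale κ f₀) = ENNReal.ofReal K := fun κ hκ => by
    rw [hDs _ h₀ κ hκ, hNs _ h₀ κ hκ, ENNReal.mul_div_mul_left _ _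
      (ENNReal.ofReal_pos.2 (inv_pos.2 hκ)).ne' ENNReal.ofReal_ne_top, hK]
  have hKpos : 0 < K := by
    rw [← ENNReal.ofReal_pos, ← hK]
    exact ENNReal.div_pos hD0 hNt
  have hKN : ENNReal.ofReal K * entropyPower lam f₀ = cumulativeDeviation q γ f₀ := by
    rw [← hK, ENNReal.div_mul_cancel hN0 hNt]
  -- the normalizing dilation
  have hnorm : ∀ f, IsC1Density f → cumulativeDeviation q γ f ≠ 0 → cumulativeDeviation q γ f ≠ ∞ →
      ∃ κ : ℝ, 0 < κ ∧ cumulativeDeviation q γ f = ENNReal.ofReal κ * cumulativeDeviation q γ f₀ ∧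
        entropyPower lam f ≤ ENNReal.ofReal κ * entropyPower lam f₀ ∧
        (entropyPower lam f = ENNReal.ofReal κ * entropyPower lam f₀ →
          f =ᵐ[volume] scale κ⁻¹ f₀) := by
    intro f hf hf0 hft
    -- The dilation of `f` by this quotient has the deviation of `f₀`.
    set κ := (cumulativeDeviation q γ f / cumulativeDeviation q γ f₀).toReal with hκdef
    have hfin : cumulativeDeviation q γ f / cumulativeDeviation q γ f₀ ≠ ∞ :=
      ENNReal.div_ne_top hft hD0
    have hκ : 0 < κ := ENNReal.toReal_pos (ENNReal.div_pos hf0 hDt).ne' hfin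
    have hκe : ENNReal.ofReal κ = cumulativeDeviation q γ f / cumulativeDeviation q γ f₀ :=
      ENNReal.ofReal_toReal hfin
    have hinv : ENNReal.ofReal κ * ENNReal.ofReal κ⁻¹ = 1 := by
      rw [← ENNReal.ofReal_mul hκ.le, mul_inv_cancel₀ hκ.ne', ENNReal.ofReal_one]
    have hDf : cumulativeDeviation q γ f = ENNReal.ofReal κ * cumulativeDeviation q γ f₀ := by
      rw [hκe, ENNReal.div_mul_cancel hD0 hDt]
    obtain ⟨h1, h2⟩ := hn (scale κ f) (hf.scale hκ) (by
      rw [hDs f hf κ hκ, hDf, ← mul_assoc, mul_comm (ENNReal.ofReal κ⁻¹), hinv, one_mul])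
    have hNf : entropyPower lam f = ENNReal.ofReal κ * entropyPower lam (scale κ f) := by
      rw [hNs f hf κ hκ, ← mul_assoc, hinv, one_mul]
    refine ⟨κ, hκ, hDf, ?_, fun h => ?_⟩
    · rw [hNf]; gcongr
    · rw [hNf] at h
      have h3 := h2 ((ENNReal.mul_right_inj (ENNReal.ofReal_pos.2 hκ).ne'
        ENNReal.ofReal_ne_top).1 h)
      have h4 := (quasiMeasurePreserving_mul_left (inv_pos.2 hκ)).ae h3
      filter_upwards [h4] with x hx
      have h5 : scale κ⁻¹ (scale κ f) x = scale κ⁻¹ f₀ x := by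
        simp only [scale] at hx ⊢
        rw [hx]
      rwa [scale_scale, inv_mul_cancel₀ hκ.ne', scale_one] at h5
  have hineq : ∀ f, IsC1Density f →
      ENNReal.ofReal K * entropyPower lam f ≤ cumulativeDeviation q γ f := by
    intro f hf
    by_cases hf0 : cumulativeDeviation q γ f = 0
    · rw [hf0, hz f hf hf0, mul_zero]
    by_cases hft : cumulativeDeviation q γ f = ∞
    · rw [hft]; exact le_top
    obtain ⟨κ, hκ, h1, h2, -⟩ := hnorm f hf hf0 hft
    calc ENNReal.ofReal K * entropyPower lam f
        ≤ ENNReal.ofReal K * (ENNReal.ofReal κ * entropyPower lam f₀) := by gcongr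
      _ = cumulativeDeviation q γ f := by rw [h1, ← hKN]; ring
  refine ⟨hKpos, ?_, fun f hf => ⟨hineq f hf, fun hNf0 hNft => ⟨?_, ?_⟩⟩⟩
  · rw [hρ]
    refine ⟨h₀.scale hκ₀, ?_, ?_, hratio κ₀ hκ₀⟩
    · rw [hNs _ h₀ κ₀ hκ₀]
      exact mul_ne_zero (ENNReal.ofReal_pos.2 (inv_pos.2 hκ₀)).ne' hN0
    · rw [hNs _ h₀ κ₀ hκ₀]
      exact ENNReal.mul_ne_top ENNReal.ofReal_ne_top hNt
  · rw [ENNReal.le_div_iff_mul_le (Or.inl hNf0) (Or.inl hNft)]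
    exact hineq f hf
  · constructor
    · intro heq
      have hDf : cumulativeDeviation q γ f = ENNReal.ofReal K * entropyPower lam f := by
        rw [← heq, ENNReal.div_mul_cancel hNf0 hNft]
      have hKp := (ENNReal.ofReal_pos.2 hKpos).ne'
      obtain ⟨κ, hκ, h1, -, h3⟩ := hnorm f hf (hDf ▸ mul_ne_zero hKp hNf0)
        (hDf ▸ ENNReal.mul_ne_top ENNReal.ofReal_ne_top hNft)
      have h4 : entropyPower lam f = ENNReal.ofReal κ * entropyPower lam f₀ := by
        refine (ENNReal.mul_right_inj hKp ENNReal.ofReal_ne_top).1 ?_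
        rw [← hDf, h1, ← hKN]; ring
      -- The density `f` is the dilation of `f₀` by `κ⁻¹`, and `ρ` that by `κ₀`.
      refine ⟨κ⁻¹ / κ₀, by positivity, ?_⟩
      refine (h3 h4).trans (Filter.Eventually.of_forall fun x => ?_)
      change scale κ⁻¹ f₀ x = scale (κ⁻¹ / κ₀) ρ x
      rw [hρ, scale_scale, div_mul_cancel₀ _ hκ₀.ne']
    · rintro ⟨κ, hκ, hfκ⟩
      have h1 : (fun x => κ * ρ (κ * x)) = scale (κ * κ₀) f₀ := by
        rw [← scale_scale, ← hρ]; rfl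
      rw [h1] at hfκ
      rw [cumulativeDeviation_congr_ae hfκ, entropyPower_congr_ae hfκ]
      exact hratio _ (mul_pos hκ hκ₀)

/-! ### Entropies of the densities generated by profiles -/

section entropy

variable {γ s lam : ℝ} {f v f₀ : ℝ → ℝ}

theorem ofReal_rpow_sub_one_mul (hs : 0 < s) (x : ℝ) :
    ENNReal.ofReal x ^ (s - 1) * ENNReal.ofReal x = ENNReal.ofReal x ^ s := by
  rcases le_or_gt x 0 with h | h
  · rw [ENNReal.ofReal_of_nonpos h, mul_zero, ENNReal.zero_rpow_of_pos hs]
  · conv_lhs => rw [← ENNReal.rpow_one (ENNReal.ofReal x), ← ENNReal.rpow_mul, one_mul]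
    rw [← ENNReal.rpow_add _ _ (ENNReal.ofReal_pos.2 h).ne' ENNReal.ofReal_ne_top, sub_add_cancel]

/-- At an escort density `f₀ ^ (lam - 1) = v ^ ((lam - 1) / γ) = v ^ (s - 1)`, and `f₀ dx` is `v
dy`. -/
theorem IsEscort.lintegral_rpow (hf : IsEscort γ v f₀) (hv : IsProfile γ v) (hγ : 0 < γ)
    (hs0 : 0 < s) (hs : γ * s = lam + γ - 1) :
    ∫⁻ x, ENNReal.ofReal (f₀ x) ^ (lam - 1) * ENNReal.ofReal (f₀ x) =
      2 * ∫⁻ y in Ioi 0, ENNReal.ofReal (v y) ^ s := by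
  have hm : Measurable fun y : ℝ≥0∞ => ENNReal.ofReal (v y.toReal) ^ (s - 1) :=
    (hv.measurable.comp ENNReal.measurable_toReal).ennreal_ofReal.pow_const _
  have h1 := hf.lintegral_comp_absCumulative hv hγ hm
  have h2 : ∫⁻ y in Ioi 0, ENNReal.ofReal (v y) ^ s = ∫⁻ y in Ioi 0,
      ENNReal.ofReal (v (ENNReal.ofReal y).toReal) ^ (s - 1) * ENNReal.ofReal (v y) := by
    refine setLIntegral_congr_fun measurableSet_Ioi fun y hy => ?_
    rw [ENNReal.toReal_ofReal (le_of_lt hy), ofReal_rpow_sub_one_mul hs0]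
  rw [h2, ← h1]
  refine lintegral_congr_ae ?_
  filter_upwards [Measure.ae_ne volume (0 : ℝ)] with x hx
  by_cases hfx : f₀ x = 0
  · simp [hfx]
  · obtain ⟨z, hz, hW, hfz⟩ := hf.absCumulative_eq hv hγ hx hfx
    congr 1
    rw [hW, ENNReal.toReal_ofReal hz.1.le, hfz,
      ENNReal.ofReal_rpow_of_pos (Real.rpow_pos_of_pos hz.2 _), ENNReal.ofReal_rpow_of_pos hz.2,
      ← Real.rpow_mul hz.2.le]
    congr 2
    field_simp
    linarith

/-- The maximum entropy principle for `f₀`, in the case of an exponent above one. -/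
theorem entropyPower_le_of_one_lt (hγ : 0 < γ) (hs1 : 1 < s) (hs : γ * s = lam + γ - 1)
    (hv : IsProfile γ v) (hf₀ : IsEscort γ v f₀) (hf : IsC1Density f)
    (hM : 2 * ∫⁻ y in Ioi 0, ENNReal.ofReal (v y) ^ s ≠ ∞)
    (hW : ∀ᵐ x, 0 < f x → absCumulative γ f x ≠ ∞)
    (hle : 2 * ∫⁻ y in Ioi 0, ENNReal.ofReal (v y) ^ s ≤ ∫⁻ x in {x | 0 < f x},
        ENNReal.ofReal (v (absCumulative γ f x).toReal) ^ (s - 1) * ENNReal.ofReal (f x)) :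
    entropyPower lam f ≤ entropyPower lam f₀ ∧
      (entropyPower lam f = entropyPower lam f₀ → f =ᵐ[volume] f₀) := by
  have hlam : 1 < lam := by nlinarith
  obtain ⟨h1, h2⟩ := (lintegral_bernoulli_of_one_lt hs1 hs hf.measurable hv.measurable hv.nonneg
    hW).2 hM hle
  rw [entropyPower, entropyPower, if_neg hlam.ne', if_neg hlam.ne',
    hf₀.lintegral_rpow hv hγ (by linarith) hs]
  refine ⟨?_, fun heq => ?_⟩
  -- For `lam > 1` the outer exponent is negative: the lower bound on the integral becomes an upper
  -- bound on the entropy power.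
  · rw [show 1 / (1 - lam) = -(1 / (lam - 1)) by rw [← one_div_neg_eq_neg_one_div, neg_sub], ENNReal.rpow_neg, ENNReal.rpow_neg,
      ENNReal.inv_le_inv]
    exact ENNReal.rpow_le_rpow h1 (one_div_nonneg.2 (by linarith))
  have h3 := ENNReal.rpow_left_injective
    (show 1 / (1 - lam) ≠ 0 from one_div_ne_zero (by linarith)) heq
  refine hf.ae_eq_of_ae_eq_profile hv hγ hf₀ ?_
  filter_upwards [h2 h3, hW] with x hx hWx hx0
  exact ⟨hWx hx0, hx hx0⟩

/-- The maximum entropy principle for `f₀`, in the case of an exponent below one. -/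
theorem entropyPower_le_of_lt_one (hγ : 0 < γ) (hs0 : 0 < s) (hs1 : s < 1)
    (hs : γ * s = lam + γ - 1) (hv : IsProfile γ v) (hf₀ : IsEscort γ v f₀) (hf : IsC1Density f)
    (hM : 2 * ∫⁻ y in Ioi 0, ENNReal.ofReal (v y) ^ s ≠ ∞)
    (hW : ∀ᵐ x, 0 < f x → absCumulative γ f x ≠ ∞ ∧ 0 < v (absCumulative γ f x).toReal)
    (hle : ∫⁻ x in {x | 0 < f x},
        ENNReal.ofReal (v (absCumulative γ f x).toReal) ^ (s - 1) * ENNReal.ofReal (f x) ≤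
      2 * ∫⁻ y in Ioi 0, ENNReal.ofReal (v y) ^ s) :
    entropyPower lam f ≤ entropyPower lam f₀ ∧
      (entropyPower lam f = entropyPower lam f₀ → f =ᵐ[volume] f₀) := by
  have hlam : lam < 1 := by nlinarith
  obtain ⟨h1, h2⟩ := lintegral_bernoulli_of_lt_one hs0 hs1 hs hf.measurable hv.measurable hW hM hle
  rw [entropyPower, entropyPower, if_neg hlam.ne, if_neg hlam.ne,
    hf₀.lintegral_rpow hv hγ hs0 hs]
  refine ⟨ENNReal.rpow_le_rpow h1 (one_div_nonneg.2 (by linarith)), fun heq => ?_⟩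
  have h3 := ENNReal.rpow_left_injective
    (show 1 / (1 - lam) ≠ 0 from one_div_ne_zero (by linarith)) heq
  refine hf.ae_eq_of_ae_eq_profile hv hγ hf₀ ?_
  filter_upwards [h2 h3, hW] with x hx hWx hx0
  exact ⟨(hWx hx0).1, hx hx0⟩

theorem mean_of_nonneg {φ : ℝ → EReal} (hφ : ∀ᵐ x, 0 < f x → 0 ≤ φ x) :
    mean φ f = ((∫⁻ x, (φ x).toENNReal * ENNReal.ofReal (f x) : ℝ≥0∞) : EReal) := by
  have h : ∫⁻ x, (-φ x).toENNReal * ENNReal.ofReal (f x) = 0 := by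
    rw [← lintegral_zero (μ := (volume : Measure ℝ))]
    refine lintegral_congr_ae ?_
    filter_upwards [hφ] with x hx
    by_cases h0 : 0 < f x
    · rw [EReal.toENNReal_of_nonpos (EReal.neg_le_zero.2 (hx h0)), zero_mul]
    · rw [ENNReal.ofReal_of_nonpos (not_lt.1 h0), mul_zero]
  rw [mean, h, EReal.coe_ennreal_zero, sub_zero]

theorem mean_of_nonpos {φ : ℝ → EReal} (hφ : ∀ᵐ x, 0 < f x → φ x ≤ 0) :
    mean φ f = -((∫⁻ x, (-φ x).toENNReal * ENNReal.ofReal (f x) : ℝ≥0∞) : EReal) := by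
  have h : ∫⁻ x, (φ x).toENNReal * ENNReal.ofReal (f x) = 0 := by
    rw [← lintegral_zero (μ := (volume : Measure ℝ))]
    refine lintegral_congr_ae ?_
    filter_upwards [hφ] with x hx
    by_cases h0 : 0 < f x
    · rw [EReal.toENNReal_of_nonpos (hx h0), zero_mul]
    · rw [ENNReal.ofReal_of_nonpos (not_lt.1 h0), mul_zero]
  rw [mean, h, EReal.coe_ennreal_zero, zero_sub]

/-- Here `-log f₀ = (c(W) - A) / γ`, and `C` is the mean of `c(W)`. -/
theorem IsEscort.entropyPower_one (hf₀ : IsEscort γ v f₀) (hv : IsProfile γ v) (hγ : 0 < γ)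
    {A C : ℝ} {c : ℝ → ℝ} (hcm : Measurable c) (hC : 0 ≤ C) (hc0 : ∀ y ∈ core v, 0 ≤ c y)
    (hvc : ∀ y ∈ core v, v y = Real.exp (A - c y))
    (hCe : 2 * ∫⁻ y in Ioi 0, ENNReal.ofReal (c y) * ENNReal.ofReal (v y) = ENNReal.ofReal C) :
    entropyPower 1 f₀ = EReal.exp (((C - A) / γ : ℝ) : EReal) := by
  rw [entropyPower, if_pos rfl]
  congr 1
  have hd := hf₀.isC1Density hv hγ
  have hWm := (measurable_absCumulative γ f₀).ennreal_toReal
  have h1 : mean (fun x => -(ENNReal.ofReal (f₀ x)).log) f₀ =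
      mean (fun x => ((c (absCumulative γ f₀ x).toReal / γ : ℝ) : EReal) + ((-A / γ : ℝ) : EReal))
        f₀ := by
    refine mean_congr_ae (Filter.EventuallyEq.refl _ _) ?_
    filter_upwards [Measure.ae_ne volume (0 : ℝ)] with x hx hfx
    obtain ⟨z, hz, hW, hfz⟩ := hf₀.absCumulative_eq hv hγ hx hfx.ne'
    rw [ENNReal.log_ofReal_of_pos hfx, hW, ENNReal.toReal_ofReal hz.1.le, hfz,
      Real.log_rpow hz.2, hvc z hz, Real.log_exp, ← EReal.coe_neg, ← EReal.coe_add,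
      EReal.coe_eq_coe_iff]
    field_simp
    ring
  have hm : Measurable fun x => ((c (absCumulative γ f₀ x).toReal / γ : ℝ) : EReal) :=
    ((hcm.comp hWm).div_const γ).coe_real_ereal
  rw [h1, mean_add_const hd.measurable hd.mass_one hm, mean_of_nonneg]
  · have h2 : ∫⁻ x, (((c (absCumulative γ f₀ x).toReal / γ : ℝ) : EReal)).toENNReal *
        ENNReal.ofReal (f₀ x) = ENNReal.ofReal (C / γ) := by
      simp only [EReal.real_coe_toENNReal]
      have hφ : Measurable fun y : ℝ≥0∞ => ENNReal.ofReal (c y.toReal / γ) :=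
        ((hcm.comp ENNReal.measurable_toReal).div_const γ).ennreal_ofReal
      rw [hf₀.lintegral_comp_absCumulative hv hγ hφ, div_eq_inv_mul,
        ENNReal.ofReal_mul (by positivity), ← hCe, mul_left_comm,
        ← lintegral_const_mul' _ _ ENNReal.ofReal_ne_top]
      congr 1
      refine setLIntegral_congr_fun measurableSet_Ioi fun y hy => ?_
      rw [ENNReal.toReal_ofReal (le_of_lt hy), div_eq_inv_mul, ENNReal.ofReal_mul (by positivity),
        mul_assoc]
    rw [h2, EReal.coe_ennreal_ofReal, max_eq_left (by positivity), ← EReal.coe_add]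
    congr 1
    ring
  · filter_upwards [Measure.ae_ne volume (0 : ℝ)] with x hx hfx
    obtain ⟨z, hz, hW, -⟩ := hf₀.absCumulative_eq hv hγ hx hfx.ne'
    rw [hW, ENNReal.toReal_ofReal hz.1.le]
    exact EReal.coe_nonneg.2 (div_nonneg (hc0 z hz) hγ.le)

/-- The maximum entropy principle for `f₀` and the Shannon entropy. -/
theorem entropyPower_le_of_eq_one (hγ : 0 < γ) (hv : IsProfile γ v) (hf₀ : IsEscort γ v f₀)
    (hf : IsC1Density f)
    {A C : ℝ} {c : ℝ → ℝ} (hcm : Measurable c) (hC : 0 ≤ C) (hc0 : ∀ y ∈ core v, 0 ≤ c y)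
    (hvc : ∀ y ∈ core v, v y = Real.exp (A - c y))
    (hCe : 2 * ∫⁻ y in Ioi 0, ENNReal.ofReal (c y) * ENNReal.ofReal (v y) = ENNReal.ofReal C)
    (hW : ∀ᵐ x, 0 < f x → absCumulative γ f x ≠ ∞ ∧ (absCumulative γ f x).toReal ∈ core v)
    (hle : ∫⁻ x in {x | 0 < f x}, ENNReal.ofReal (c (absCumulative γ f x).toReal) *
      ENNReal.ofReal (f x) ≤ ENNReal.ofReal C) :
    entropyPower 1 f ≤ entropyPower 1 f₀ ∧
      (entropyPower 1 f = entropyPower 1 f₀ → f =ᵐ[volume] f₀) := by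
  obtain ⟨h1, h2⟩ := mean_neg_log_le hγ hf.measurable hf.mass_one hv.measurable hv.mass hcm hC
    (hW.mono fun x hx hx0 => hc0 _ (hx hx0).2)
    (hW.mono fun x hx hx0 => ⟨(hx hx0).1, hvc _ (hx hx0).2⟩) hle
  rw [hf₀.entropyPower_one hv hγ hcm hC hc0 hvc hCe, entropyPower, if_pos rfl]
  refine ⟨EReal.exp_monotone h1, fun heq => ?_⟩
  refine hf.ae_eq_of_ae_eq_profile hv hγ hf₀ ?_
  filter_upwards [h2 (EReal.exp_strictMono.injective heq), hW] with x hx hWx hx0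
  exact ⟨(hWx hx0).1, hx hx0⟩

end entropy

/-! ### Gamma and Beta integrals -/

/-- The substitution `t = b * y ^ q`, which brings all integrals against stretched Gaussians to
Gamma or Beta form. -/
theorem lintegral_rpow_comp_rpow {q b : ℝ} (hq : 0 < q) (hb : 0 < b) (r : ℝ) (g : ℝ → ℝ≥0∞) :
    ∫⁻ y in Ioi 0, ENNReal.ofReal (y ^ r) * g (b * y ^ q) =
      ENNReal.ofReal (1 / q * b ^ (-((r + 1) / q))) *
        ∫⁻ t in Ioi 0, ENNReal.ofReal (t ^ ((r + 1) / q - 1)) * g t := by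
  have himg : (fun t : ℝ => (t / b) ^ (1 / q)) '' Ioi 0 = Ioi 0 := by
    ext y
    constructor
    · rintro ⟨t, ht, rfl⟩
      exact Real.rpow_pos_of_pos (div_pos ht hb) _
    · intro hy
      refine ⟨b * y ^ q, mul_pos hb (Real.rpow_pos_of_pos hy _), ?_⟩
      dsimp only
      rw [mul_div_cancel_left₀ _ hb.ne', ← Real.rpow_mul (le_of_lt hy), mul_one_div_cancel hq.ne',
        Real.rpow_one]
  have hinj : InjOn (fun t : ℝ => (t / b) ^ (1 / q)) (Ioi 0) := by
    intro t ht u hu htu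
    have h1 := (Real.rpow_left_inj (div_pos ht hb).le (div_pos hu hb).le
      (one_div_pos.2 hq).ne').1 htu
    exact (div_left_inj' hb.ne').1 h1
  have hder : ∀ t ∈ Ioi (0 : ℝ), HasDerivWithinAt (fun t : ℝ => (t / b) ^ (1 / q))
      (1 / b * (1 / q) * (t / b) ^ (1 / q - 1)) (Ioi 0) t := fun t ht =>
    (((hasDerivAt_id t).div_const b).rpow_const
      (Or.inl (div_pos ht hb).ne')).hasDerivWithinAt
  have h1 := lintegral_image_eq_lintegral_abs_deriv_mul measurableSet_Ioi hder hinj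
    fun y => ENNReal.ofReal (y ^ r) * g (b * y ^ q)
  rw [himg] at h1
  rw [h1, ← lintegral_const_mul' _ _ ENNReal.ofReal_ne_top]
  refine setLIntegral_congr_fun measurableSet_Ioi fun t ht => ?_
  have htb := div_pos ht hb
  rw [← Real.rpow_mul htb.le, ← Real.rpow_mul htb.le, one_div_mul_cancel hq.ne', Real.rpow_one,
    mul_div_cancel₀ _ hb.ne', ← mul_assoc, ← mul_assoc, abs_of_pos (by positivity),
    ← ENNReal.ofReal_mul (by positivity), ← ENNReal.ofReal_mul (by positivity)]
  congr 2
  rw [mul_assoc, ← Real.rpow_add htb, show 1 / q - 1 + 1 / q * r = (r + 1) / q - 1 by ring,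
    Real.div_rpow (le_of_lt ht) hb.le, Real.rpow_sub_one hb.ne', Real.rpow_neg hb.le]
  field_simp

theorem lintegral_rpow_mul_exp_neg {a : ℝ} (ha : 0 < a) :
    ∫⁻ t in Ioi 0, ENNReal.ofReal (t ^ (a - 1)) * ENNReal.ofReal (Real.exp (-t)) =
      ENNReal.ofReal (Real.Gamma a) := by
  rw [Real.Gamma_eq_integral ha, ofReal_integral_eq_lintegral_ofReal
    (Real.GammaIntegral_convergent ha) ((ae_restrict_iff' measurableSet_Ioi).2
      (Filter.Eventually.of_forall fun t ht =>
        mul_nonneg (Real.exp_pos _).le (Real.rpow_nonneg (le_of_lt ht) _)))]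
  refine setLIntegral_congr_fun measurableSet_Ioi fun t ht => ?_
  rw [← ENNReal.ofReal_mul (Real.rpow_nonneg (le_of_lt ht) _), mul_comm]

theorem lintegral_beta {a c : ℝ} (ha : 0 < a) (hc : 0 < c) :
    ∫⁻ t in Ioo 0 1, ENNReal.ofReal (t ^ (a - 1) * (1 - t) ^ (c - 1)) =
      ENNReal.ofReal (ProbabilityTheory.beta a c) := by
  have hB := ProbabilityTheory.beta_pos ha hc
  have h1 := ProbabilityTheory.lintegral_betaPDF_eq_one ha hc
  rw [ProbabilityTheory.lintegral_betaPDF] at h1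
  rw [← mul_one (ENNReal.ofReal (ProbabilityTheory.beta a c)), ← h1,
    ← lintegral_const_mul' _ _ ENNReal.ofReal_ne_top]
  refine lintegral_congr fun t => ?_
  rw [← ENNReal.ofReal_mul hB.le]
  congr 1
  field_simp

theorem lintegral_rpow_mul_one_sub {a c : ℝ} (ha : 0 < a) (hc : 0 < c) :
    ∫⁻ t in Ioi 0, ENNReal.ofReal (t ^ (a - 1)) * ENNReal.ofReal (max 0 (1 - t) ^ c) =
      ENNReal.ofReal (ProbabilityTheory.beta a (c + 1)) := by
  rw [← lintegral_beta ha (by linarith), ← lintegral_indicator measurableSet_Ioi,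
    ← lintegral_indicator measurableSet_Ioo]
  refine lintegral_congr fun t => ?_
  by_cases ht : t ∈ Ioo (0 : ℝ) 1
  · rw [indicator_of_mem ht, indicator_of_mem (show t ∈ Ioi 0 from ht.1),
      max_eq_right (by linarith [ht.2]), ← ENNReal.ofReal_mul (Real.rpow_nonneg ht.1.le _),
      add_sub_cancel_right]
  · rw [indicator_of_notMem ht]
    by_cases h0 : t ∈ Ioi 0
    · have h1 : 1 ≤ t := by by_contra h; exact ht ⟨h0, not_le.1 h⟩
      rw [indicator_of_mem h0, max_eq_left (by linarith), Real.zero_rpow hc.ne',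
        ENNReal.ofReal_zero, mul_zero]
    · rw [indicator_of_notMem h0]

/-- The substitution `t = u / (1 - u)`; the condition `a < c` is convergence at infinity. -/
theorem lintegral_rpow_mul_one_add {a c : ℝ} (ha : 0 < a) (hc : a < c) :
    ∫⁻ t in Ioi 0, ENNReal.ofReal (t ^ (a - 1)) * ENNReal.ofReal ((1 + t) ^ (-c)) =
      ENNReal.ofReal (ProbabilityTheory.beta a (c - a)) := by
  have himg : (fun u : ℝ => u / (1 - u)) '' Ioo 0 1 = Ioi 0 := by
    ext t
    constructor
    · rintro ⟨u, hu, rfl⟩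
      exact div_pos hu.1 (by linarith [hu.2])
    · intro ht
      have ht' : (0 : ℝ) < t := ht
      refine ⟨t / (1 + t), ⟨by positivity, (div_lt_one (by positivity)).2 (by linarith)⟩, ?_⟩
      dsimp only
      field_simp
      ring
  have hinj : InjOn (fun u : ℝ => u / (1 - u)) (Ioo 0 1) := by
    intro u hu w hw huw
    have h1 : (1 : ℝ) - u ≠ 0 := by linarith [hu.2]
    have h2 : (1 : ℝ) - w ≠ 0 := by linarith [hw.2]
    dsimp only at huw
    rw [div_eq_div_iff h1 h2] at huw
    linarith
  have hder : ∀ u ∈ Ioo (0 : ℝ) 1, HasDerivWithinAt (fun u : ℝ => u / (1 - u))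
      ((1 - u) ^ (-2 : ℝ)) (Ioo 0 1) u := fun u hu => by
    have h1 : (0 : ℝ) < 1 - u := by linarith [hu.2]
    have h2 := ((hasDerivAt_id u).div ((hasDerivAt_id u).const_sub 1) h1.ne').hasDerivWithinAt
      (s := Ioo 0 1)
    have h3 : (1 - u) ^ (-2 : ℝ) = (1 * (1 - id u) - id u * -1) / (1 - id u) ^ 2 := by
      rw [Real.rpow_neg h1.le, id, Real.rpow_two]
      field_simp
      ring
    rw [h3]
    exact h2
  have h1 := lintegral_image_eq_lintegral_abs_deriv_mul measurableSet_Ioo hder hinj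
    fun t => ENNReal.ofReal (t ^ (a - 1)) * ENNReal.ofReal ((1 + t) ^ (-c))
  rw [himg] at h1
  rw [h1, ← lintegral_beta ha (by linarith)]
  refine setLIntegral_congr_fun measurableSet_Ioo fun u hu => ?_
  have hu1 : (0 : ℝ) < 1 - u := by linarith [hu.2]
  have hu0 := hu.1
  rw [abs_of_pos (Real.rpow_pos_of_pos hu1 _), ← ENNReal.ofReal_mul (by positivity),
    ← ENNReal.ofReal_mul (by positivity)]
  congr 1
  have h2 : 1 + u / (1 - u) = (1 - u)⁻¹ := by field_simp; ring
  rw [h2, Real.div_rpow hu0.le hu1.le, Real.inv_rpow hu1.le, ← Real.rpow_neg hu1.le, neg_neg,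
    show u ^ (a - 1) / (1 - u) ^ (a - 1) = u ^ (a - 1) * (1 - u) ^ (-(a - 1)) by
      rw [Real.rpow_neg hu1.le]; rfl]
  rw [show (1 - u) ^ (-2 : ℝ) * (u ^ (a - 1) * (1 - u) ^ (-(a - 1)) * (1 - u) ^ c) =
    u ^ (a - 1) * ((1 - u) ^ (-2 : ℝ) * (1 - u) ^ (-(a - 1)) * (1 - u) ^ c) by ring,
    ← Real.rpow_add hu1, ← Real.rpow_add hu1]
  congr 2
  ring

/-- The substitution `y = exp (-t)` gives Euler's integral. -/
theorem lintegral_neg_log_rpow {c : ℝ} (hc : -1 < c) :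
    ∫⁻ y in Ioi 0, ENNReal.ofReal (if y < 1 then (-Real.log y) ^ c else 0) =
      ENNReal.ofReal (Real.Gamma (c + 1)) := by
  have himg : (fun t : ℝ => Real.exp (-t)) '' Ioi 0 = Ioo 0 1 := by
    ext y
    constructor
    · rintro ⟨t, ht, rfl⟩
      have ht' : (0 : ℝ) < t := ht
      exact ⟨Real.exp_pos _, by rw [← Real.exp_zero]; exact Real.exp_lt_exp.2 (by linarith)⟩
    · intro hy
      exact ⟨-Real.log y, neg_pos.2 (Real.log_neg hy.1 hy.2), by
        dsimp only; rw [neg_neg, Real.exp_log hy.1]⟩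
  have hinj : InjOn (fun t : ℝ => Real.exp (-t)) (Ioi 0) := fun t _ u _ htu =>
    neg_injective (Real.exp_injective htu)
  have hder : ∀ t ∈ Ioi (0 : ℝ), HasDerivWithinAt (fun t : ℝ => Real.exp (-t))
      (Real.exp (-t) * (-1)) (Ioi 0) t := fun t _ => (hasDerivAt_neg t).exp.hasDerivWithinAt
  have h1 := lintegral_image_eq_lintegral_abs_deriv_mul measurableSet_Ioi hder hinj
    fun y => ENNReal.ofReal ((-Real.log y) ^ c)
  rw [himg] at h1
  have h2 := lintegral_rpow_mul_exp_neg (a := c + 1) (by linarith)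
  have h3 : ∫⁻ y in Ioi 0, ENNReal.ofReal (if y < 1 then (-Real.log y) ^ c else 0) =
      ∫⁻ y in Ioo 0 1, ENNReal.ofReal ((-Real.log y) ^ c) := by
    rw [← lintegral_indicator measurableSet_Ioi, ← lintegral_indicator measurableSet_Ioo]
    refine lintegral_congr fun y => ?_
    by_cases hy : y ∈ Ioo (0 : ℝ) 1
    · rw [indicator_of_mem hy, indicator_of_mem (show y ∈ Ioi 0 from hy.1), if_pos hy.2]
    · rw [indicator_of_notMem hy]
      by_cases h0 : y ∈ Ioi 0
      · rw [indicator_of_mem h0, if_neg fun h => hy ⟨h0, h⟩, ENNReal.ofReal_zero]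
      · rw [indicator_of_notMem h0]
  rw [h3, h1, ← h2]
  refine setLIntegral_congr_fun measurableSet_Ioi fun t ht => ?_
  rw [Real.log_exp, neg_neg, mul_neg_one, abs_neg, abs_of_pos (Real.exp_pos _), mul_comm,
    add_sub_cancel_right]

/-! ### The stretched Gaussian profile -/

section gauss

variable {q s : ℝ}

theorem stretchedGaussian_one (q x : ℝ) :
    stretchedGaussian q 1 x = gaussConst q 1 * Real.exp (-(|x| ^ q)) := by
  rw [stretchedGaussian, tsallisExp, if_pos (by norm_num)]

theorem stretchedGaussian_of_ne (hs : s ≠ 1) (q x : ℝ) :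
    stretchedGaussian q s x =
      gaussConst q s * max 0 (1 + (1 - s) * |x| ^ q) ^ (1 / (s - 1)) := by
  rw [stretchedGaussian, tsallisExp, if_neg (fun h => hs (by linarith)),
    show 1 - (2 - s) = s - 1 by ring]
  ring_nf

theorem gaussConst_pos (hq : 0 < q) (hs : 1 - s < q * s) : 0 < gaussConst q s := by
  have hs0 : 0 < s := by nlinarith
  rw [gaussConst]
  split_ifs with h1 h2
  · have := Real.Gamma_pos_of_pos (one_div_pos.2 hq)
    positivity
  · have h3 : 0 < |1 - s| := abs_pos.2 (sub_ne_zero.2 (Ne.symm h1))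
    have h4 : 0 < s / |1 - s| + (1 - 1 / q) := by
      rw [abs_of_nonneg (by linarith)]
      have : s < 1 := lt_of_le_of_ne h2 h1
      have h5 : 1 / q < s / (1 - s) := by
        rw [div_lt_div_iff₀ hq (by linarith)]; linarith
      linarith
    have := ProbabilityTheory.beta_pos (one_div_pos.2 hq) h4
    have := Real.rpow_pos_of_pos h3 (1 / q)
    positivity
  · have h3 : 0 < |1 - s| := abs_pos.2 (sub_ne_zero.2 (Ne.symm h1))
    have h4 : 0 < s / |1 - s| + 0 := by positivity
    have := ProbabilityTheory.beta_pos (one_div_pos.2 hq) h4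
    have := Real.rpow_pos_of_pos h3 (1 / q)
    positivity

theorem beta_add_one_left {a c : ℝ} (ha : 0 < a) (hc : 0 < c) :
    ProbabilityTheory.beta (a + 1) c = a / (a + c) * ProbabilityTheory.beta a c := by
  have h1 := Real.Gamma_pos_of_pos (add_pos ha hc)
  rw [ProbabilityTheory.beta, ProbabilityTheory.beta, Real.Gamma_add_one ha.ne',
    show a + 1 + c = a + c + 1 by ring, Real.Gamma_add_one (add_pos ha hc).ne']
  field_simp

theorem beta_add_one_sub_one {a c : ℝ} (ha : 0 < a) (hc : 0 < c - 1) :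
    ProbabilityTheory.beta (a + 1) (c - 1) = a / (c - 1) * ProbabilityTheory.beta a c := by
  have h1 := Real.Gamma_pos_of_pos hc
  have h2 := Real.Gamma_add_one hc.ne'
  rw [sub_add_cancel] at h2
  have h3 := Real.Gamma_pos_of_pos (show 0 < a + c by linarith)
  rw [ProbabilityTheory.beta, ProbabilityTheory.beta, Real.Gamma_add_one ha.ne',
    show a + 1 + (c - 1) = a + c by ring, h2]
  field_simp

theorem lintegral_rpow_mul_stretchedGaussian (hq : 0 < q) (hs : 1 - s < q * s) {b : ℝ} (hb : 0 < b)
    {g : ℝ → ℝ} (hg : ∀ y, 0 < y → stretchedGaussian q s y = gaussConst q s * g (b * y ^ q))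
    {B r : ℝ}
    (hB : ∫⁻ t in Ioi 0, ENNReal.ofReal (t ^ ((r + 1) / q - 1)) * ENNReal.ofReal (g t) =
      ENNReal.ofReal B) :
    2 * ∫⁻ y in Ioi 0, ENNReal.ofReal (y ^ r) * ENNReal.ofReal (stretchedGaussian q s y) =
      ENNReal.ofReal (2 * gaussConst q s * (1 / q * b ^ (-((r + 1) / q))) * B) := by
  have ha := gaussConst_pos hq hs
  have h1 := lintegral_rpow_comp_rpow hq hb r fun t => ENNReal.ofReal (g t)
  rw [hB] at h1
  have h2 : ∫⁻ y in Ioi 0, ENNReal.ofReal (y ^ r) * ENNReal.ofReal (stretchedGaussian q s y) =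
      ENNReal.ofReal (gaussConst q s) *
        ∫⁻ y in Ioi 0, ENNReal.ofReal (y ^ r) * ENNReal.ofReal (g (b * y ^ q)) := by
    rw [← lintegral_const_mul' _ _ ENNReal.ofReal_ne_top]
    refine setLIntegral_congr_fun measurableSet_Ioi fun y hy => ?_
    rw [hg y hy, ENNReal.ofReal_mul ha.le, mul_left_comm]
  have hc : 0 ≤ 1 / q * b ^ (-((r + 1) / q)) := by positivity
  rw [h2, h1, ENNReal.ofReal_mul (mul_nonneg (by positivity) hc),
    ENNReal.ofReal_mul (mul_nonneg zero_le_two ha.le), ENNReal.ofReal_mul zero_le_two,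
    ENNReal.ofReal_ofNat]
  ring

/-- After `t = b * y ^ q` the mass and the `q`-th moment are Gamma or Beta integrals whose first
parameters are `1 / q` and `1 / q + 1`. Their ratio comes from the recurrence of the Gamma function.
-/
theorem lintegral_stretchedGaussian (hq : 0 < q) (hs : 1 - s < q * s) :
    2 * ∫⁻ y in Ioi 0, ENNReal.ofReal (stretchedGaussian q s y) = 1 ∧
    2 * ∫⁻ y in Ioi 0, ENNReal.ofReal (y ^ q) * ENNReal.ofReal (stretchedGaussian q s y) =
      ENNReal.ofReal (1 / (q * s + s - 1)) := by
  have hs0 : 0 < s := by nlinarith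
  have hq1 : 0 < 1 / q := one_div_pos.2 hq
  have hqq : (q + 1) / q = 1 / q + 1 := by field_simp; ring
  -- Common form of the three regimes: `b` is `1 - s`, `1` or `s - 1`, and `g` is a power of `1 +
  -- t`, the exponential of `-t`, or a power of the positive part of `1 - t`.
  suffices h : ∃ b : ℝ, 0 < b ∧ ∃ g : ℝ → ℝ,
      (∀ y, 0 < y → stretchedGaussian q s y = gaussConst q s * g (b * y ^ q)) ∧ ∃ B₀ B₁ : ℝ,
      0 < B₀ ∧
      ∫⁻ t in Ioi 0, ENNReal.ofReal (t ^ (1 / q - 1)) * ENNReal.ofReal (g t) = ENNReal.ofReal B₀ ∧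
      ∫⁻ t in Ioi 0, ENNReal.ofReal (t ^ (1 / q + 1 - 1)) * ENNReal.ofReal (g t) =
        ENNReal.ofReal B₁ ∧
      gaussConst q s = q * b ^ (1 / q) / (2 * B₀) ∧ B₁ = b / (q * s + s - 1) * B₀ by
    obtain ⟨b, hb, g, hg, B₀, B₁, hB0, h₀, h₁, ha, hB⟩ := h
    constructor
    · have h2 := lintegral_rpow_mul_stretchedGaussian hq hs hb hg (r := 0)
        (by rw [zero_add]; exact h₀)
      simp only [Real.rpow_zero, ENNReal.ofReal_one, one_mul] at h2
      have hbq := Real.rpow_pos_of_pos hb (1 / q)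
      rw [h2, ha, zero_add, Real.rpow_neg hb.le, ← ENNReal.ofReal_one]
      congr 1
      field_simp
    · rw [lintegral_rpow_mul_stretchedGaussian hq hs hb hg (r := q) (by rw [hqq]; exact h₁), hB, ha,
        hqq, neg_add, Real.rpow_add hb, Real.rpow_neg hb.le, Real.rpow_neg_one]
      have hbq := Real.rpow_pos_of_pos hb (1 / q)
      have : 0 < q * s + s - 1 := by linarith
      congr 1
      field_simp
  rcases lt_trichotomy s 1 with h | h | h
  · have h1s : 0 < 1 - s := by linarith
    -- For `s < 1` the hypothesis `hs` says exactly that the `q`-th moment of the heavy-tailed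
    -- profile converges.
    have h5 : 1 / q < s / (1 - s) := by rw [div_lt_div_iff₀ hq h1s]; linarith
    have h6 : 1 / (1 - s) = s / (1 - s) + 1 := by field_simp; ring
    have hc : 1 / q < 1 / (1 - s) := by linarith
    have hc' : 1 / q + 1 < 1 / (1 - s) := by linarith
    have he : s / |1 - s| + (1 - 1 / q) = 1 / (1 - s) - 1 / q := by
      rw [abs_of_pos h1s, h6]; ring
    refine ⟨1 - s, h1s, fun t => (1 + t) ^ (-(1 / (1 - s))), fun y hy => ?_, _, _,
      ProbabilityTheory.beta_pos hq1 (sub_pos.2 hc), lintegral_rpow_mul_one_add hq1 hc,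
      lintegral_rpow_mul_one_add (by linarith) hc', ?_, ?_⟩
    · rw [stretchedGaussian_of_ne h.ne, abs_of_pos hy, max_eq_right (by positivity),
        ← one_div_neg_eq_neg_one_div, neg_sub]
    · rw [gaussConst, if_neg h.ne, if_pos h.le, he, abs_of_pos h1s]
    · rw [show 1 / (1 - s) - (1 / q + 1) = 1 / (1 - s) - 1 / q - 1 by ring,
        beta_add_one_sub_one hq1 (by linarith)]
      congr 1
      have h7 : 0 < q * s + s - 1 := by linarith
      have h8 : 1 / (1 - s) - 1 / q - 1 = (q * s + s - 1) / (q * (1 - s)) := by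
        field_simp; ring
      rw [h8]
      field_simp
  · subst h
    refine ⟨1, one_pos, fun t => Real.exp (-t), fun y hy => ?_, _, _,
      Real.Gamma_pos_of_pos hq1, lintegral_rpow_mul_exp_neg hq1,
      lintegral_rpow_mul_exp_neg (by linarith), ?_, ?_⟩
    · rw [stretchedGaussian_one, abs_of_pos hy, one_mul]
    · rw [gaussConst, if_pos rfl, Real.one_rpow, mul_one]
    · rw [Real.Gamma_add_one hq1.ne', show q * 1 + 1 - 1 = q by ring]
  · have h1s : 0 < s - 1 := by linarith
    have h6 : 1 / (s - 1) + 1 = s / (s - 1) := by field_simp; ring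
    refine ⟨s - 1, h1s, fun t => max 0 (1 - t) ^ (1 / (s - 1)), fun y hy => ?_, _, _,
      ProbabilityTheory.beta_pos hq1 (by positivity),
      lintegral_rpow_mul_one_sub hq1 (one_div_pos.2 h1s),
      lintegral_rpow_mul_one_sub (by linarith) (one_div_pos.2 h1s), ?_, ?_⟩
    · rw [stretchedGaussian_of_ne h.ne', abs_of_pos hy]
      congr 3
      ring
    · rw [gaussConst, if_neg h.ne', if_neg (not_le.2 h), h6, add_zero, abs_sub_comm,
        abs_of_pos h1s]
    · rw [beta_add_one_left hq1 (by positivity), h6]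
      congr 1
      have h7 : 0 < q * s + s - 1 := by linarith
      have h8 : 1 / q + s / (s - 1) = (q * s + s - 1) / (q * (s - 1)) := by
        field_simp; ring
      rw [h8]
      field_simp

end gauss

/-! ### The three profiles -/

theorem ennreal_rpow_le_rpow_of_nonpos {x y : ℝ≥0∞} (h : x ≤ y) {p : ℝ} (hp : p ≤ 0) :
    y ^ p ≤ x ^ p := by
  rw [← neg_neg p, ENNReal.rpow_neg y, ENNReal.rpow_neg x, ENNReal.inv_le_inv]
  exact ENNReal.rpow_le_rpow h (neg_nonneg.2 hp)

/-- On `(0, z]` the profile lies between `v z > 0` and `a`, so each of its powers is bounded there.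
-/
theorem cumul_rpow_ne_top {v : ℝ → ℝ} (hv : AntitoneOn v (Ioi 0)) {a : ℝ} (ha : ∀ y, v y ≤ a)
    (p : ℝ) {z : ℝ} (hz : z ∈ core v) : cumul (fun y => ENNReal.ofReal (v y) ^ p) z ≠ ∞ := by
  have hvz := ENNReal.ofReal_pos.2 hz.2
  have ha0 := hvz.trans_le (ENNReal.ofReal_le_ofReal (ha z))
  have hle : cumul (fun y => ENNReal.ofReal (v y) ^ p) z ≤
      ∫⁻ _ in Ioc 0 z, (ENNReal.ofReal a ^ p + ENNReal.ofReal (v z) ^ p) := by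
    refine setLIntegral_mono measurable_const fun t ht => ?_
    have h1 : ENNReal.ofReal (v z) ≤ ENNReal.ofReal (v t) :=
      ENNReal.ofReal_le_ofReal (hv ht.1 hz.1 ht.2)
    have h2 : ENNReal.ofReal (v t) ≤ ENNReal.ofReal a := ENNReal.ofReal_le_ofReal (ha t)
    rcases le_total 0 p with hp | hp
    · exact (ENNReal.rpow_le_rpow h2 hp).trans le_self_add
    · exact (ennreal_rpow_le_rpow_of_nonpos h1 hp).trans le_add_self
  refine ne_top_of_le_ne_top ?_ hle
  rw [lintegral_const, Measure.restrict_apply MeasurableSet.univ, univ_inter, Real.volume_Ioc]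
  exact ENNReal.mul_ne_top (ENNReal.add_ne_top.2
    ⟨ENNReal.rpow_ne_top_of_ne_zero ha0.ne' ENNReal.ofReal_ne_top,
      ENNReal.rpow_ne_top_of_ne_zero hvz.ne' ENNReal.ofReal_ne_top⟩) ENNReal.ofReal_ne_top

/-! ### The stretched Gaussian profile -/

section gauss

variable {q s : ℝ}

theorem stretchedGaussian_nonneg (hq : 0 < q) (hs : 1 - s < q * s) (y : ℝ) :
    0 ≤ stretchedGaussian q s y := by
  have ha := gaussConst_pos hq hs
  by_cases h : s = 1
  · subst h; rw [stretchedGaussian_one]; positivity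
  · rw [stretchedGaussian_of_ne h]; positivity

theorem stretchedGaussian_pos_iff (hq : 0 < q) (hs : 1 - s < q * s) (y : ℝ) :
    0 < stretchedGaussian q s y ↔ 0 < 1 + (1 - s) * |y| ^ q := by
  have ha := gaussConst_pos hq hs
  by_cases h : s = 1
  · subst h
    rw [stretchedGaussian_one, sub_self, zero_mul, add_zero]
    exact iff_of_true (by positivity) one_pos
  · rw [stretchedGaussian_of_ne h, mul_pos_iff_of_pos_left ha]
    constructor
    · intro h1
      by_contra h2
      rw [max_eq_left (not_lt.1 h2), Real.zero_rpow (one_div_ne_zero (sub_ne_zero.2 h))] at h1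
      exact lt_irrefl _ h1
    · intro h1
      rw [max_eq_right h1.le]
      exact Real.rpow_pos_of_pos h1 _

theorem core_stretchedGaussian (hq : 0 < q) (hs : 1 - s < q * s) :
    core (stretchedGaussian q s) = {y | 0 < y ∧ 0 < 1 + (1 - s) * |y| ^ q} := by
  ext y
  exact and_congr_right fun _ => stretchedGaussian_pos_iff hq hs y

theorem continuous_abs_rpow (hq : 0 < q) : Continuous fun y : ℝ => |y| ^ q :=
  continuous_abs.rpow_const fun _ => Or.inr hq.le

theorem measurable_stretchedGaussian (hq : 0 < q) : Measurable (stretchedGaussian q s) := by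
  have h1 := (continuous_abs_rpow hq).measurable
  by_cases h : s = 1
  · subst h
    rw [funext (stretchedGaussian_one q)]
    exact (Real.measurable_exp.comp h1.neg).const_mul _
  · rw [funext (stretchedGaussian_of_ne h q)]
    exact ((measurable_const.max ((h1.const_mul _).const_add 1)).pow_const _).const_mul _

theorem stretchedGaussian_le_of_abs_le (hq : 0 < q) (hs : 1 - s < q * s) {x y : ℝ}
    (h : |x| ≤ |y|) : stretchedGaussian q s y ≤ stretchedGaussian q s x := by
  have ha := gaussConst_pos hq hs
  have hxy : |x| ^ q ≤ |y| ^ q := Real.rpow_le_rpow (abs_nonneg x) h hq.le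
  have hx0 : 0 ≤ |x| ^ q := by positivity
  rcases lt_trichotomy s 1 with h1 | h1 | h1
  · rw [stretchedGaussian_of_ne h1.ne, stretchedGaussian_of_ne h1.ne]
    have h2 : 0 < 1 - s := by linarith
    refine mul_le_mul_of_nonneg_left (Real.rpow_le_rpow_of_nonpos ?_ ?_ ?_) ha.le
    · exact lt_max_of_lt_right (by positivity)
    · gcongr
    · exact one_div_nonpos.2 (by linarith)
  · subst h1
    rw [stretchedGaussian_one, stretchedGaussian_one]
    gcongr
  · rw [stretchedGaussian_of_ne h1.ne', stretchedGaussian_of_ne h1.ne']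
    refine mul_le_mul_of_nonneg_left (Real.rpow_le_rpow (le_max_left _ _) ?_ ?_) ha.le
    · exact max_le_max_left _ (by nlinarith)
    · exact one_div_nonneg.2 (by linarith)

theorem isProfile_stretchedGaussian (γ : ℝ) (hq : 0 < q) (hs : 1 - s < q * s) :
    IsProfile γ (stretchedGaussian q s) := by
  have hanti : AntitoneOn (stretchedGaussian q s) (Ioi 0) := fun x hx y hy hxy =>
    stretchedGaussian_le_of_abs_le hq hs (by rwa [abs_of_pos hx, abs_of_pos hy])
  refine ⟨measurable_stretchedGaussian hq, stretchedGaussian_nonneg hq hs, ?_, hanti, ?_,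
    (lintegral_stretchedGaussian hq hs).1, fun z hz => cumul_rpow_ne_top hanti
      (fun y => stretchedGaussian_le_of_abs_le hq hs (x := 0) (by simp)) _ hz⟩
  · rw [core_stretchedGaussian hq hs]
    exact isOpen_Ioi.inter (isOpen_lt continuous_const
      (((continuous_abs_rpow hq).const_mul _).const_add _))
  · rw [core_stretchedGaussian hq hs]
    have h1 : ContDiffOn ℝ 1 (fun y : ℝ => y ^ q) {y | 0 < y ∧ 0 < 1 + (1 - s) * |y| ^ q} :=
      contDiffOn_id.rpow_const_of_ne fun y hy => hy.1.ne'
    by_cases h : s = 1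
    · subst h
      refine (contDiffOn_const (c := gaussConst q 1)).mul (h1.neg.exp) |>.congr fun y hy => ?_
      rw [stretchedGaussian_one, abs_of_pos hy.1]
    · have h2 : ContDiffOn ℝ 1 (fun y : ℝ => (1 + (1 - s) * y ^ q) ^ (1 / (s - 1)))
          {y | 0 < y ∧ 0 < 1 + (1 - s) * |y| ^ q} := by
        refine ContDiffOn.rpow_const_of_ne (contDiffOn_const.add (contDiffOn_const.mul h1))
          fun y hy => ?_
        have h3 := hy.2
        rw [abs_of_pos hy.1] at h3
        exact h3.ne'
      refine (contDiffOn_const (c := gaussConst q s)).mul h2 |>.congr fun y hy => ?_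
      have h3 := hy.2
      rw [stretchedGaussian_of_ne h, max_eq_right h3.le, abs_of_pos hy.1]

/-- This is why the stretched Gaussian is extremal: its power `s - 1` is affine in `y ^ q`, up to a
positive part, so the cross term in the Bernoulli inequality is governed by the `q`-th moment. -/
theorem ofReal_stretchedGaussian_rpow (hq : 0 < q) (hs : 1 - s < q * s) (h : s ≠ 1) {y : ℝ}
    (hy : 0 ≤ y) : ENNReal.ofReal (stretchedGaussian q s y) ^ (s - 1) =
      ENNReal.ofReal (gaussConst q s ^ (s - 1)) * ENNReal.ofReal (1 + (1 - s) * y ^ q) := by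
  have ha := gaussConst_pos hq hs
  rcases le_or_gt (1 + (1 - s) * y ^ q) 0 with h1 | h1
  · have hs1 : 1 < s := by
      by_contra h2
      have : 0 ≤ y ^ q := by positivity
      nlinarith
    rw [stretchedGaussian_of_ne h, abs_of_nonneg hy, max_eq_left h1,
      Real.zero_rpow (one_div_ne_zero (sub_ne_zero.2 h)), mul_zero, ENNReal.ofReal_zero,
      ENNReal.zero_rpow_of_pos (by linarith), ENNReal.ofReal_of_nonpos h1, mul_zero]
  · rw [stretchedGaussian_of_ne h, abs_of_nonneg hy, max_eq_right h1.le,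
      ENNReal.ofReal_rpow_of_pos (by positivity), ← ENNReal.ofReal_mul (by positivity),
      Real.mul_rpow ha.le (by positivity), ← Real.rpow_mul h1.le,
      one_div_mul_cancel (sub_ne_zero.2 h), Real.rpow_one]

/-- Writing `v ^ s` as `v ^ (s - 1) * v` reduces this to the mass and the moment, through `1 + (1 -
s) / (q * s + s - 1) = q * s / (q * s + s - 1)`. -/
theorem lintegral_stretchedGaussian_rpow (hq : 0 < q) (hs : 1 - s < q * s) (h : s ≠ 1) :
    2 * ∫⁻ y in Ioi 0, ENNReal.ofReal (stretchedGaussian q s y) ^ s =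
      ENNReal.ofReal (gaussConst q s ^ (s - 1) * (q * s / (q * s + s - 1))) := by
  have hs0 : 0 < s := by nlinarith
  have hm0 : 0 < q * s + s - 1 := by linarith
  have ha := Real.rpow_pos_of_pos (gaussConst_pos hq hs) (s - 1)
  obtain ⟨hmass, hmom⟩ := lintegral_stretchedGaussian hq hs
  have hgm := (measurable_stretchedGaussian (s := s) hq).ennreal_ofReal
  have h1 : ∫⁻ y in Ioi 0, ENNReal.ofReal (stretchedGaussian q s y) ^ s =
      ENNReal.ofReal (gaussConst q s ^ (s - 1)) * ∫⁻ y in Ioi 0,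
        ENNReal.ofReal (1 + (1 - s) * y ^ q) * ENNReal.ofReal (stretchedGaussian q s y) := by
    rw [← lintegral_const_mul' _ _ ENNReal.ofReal_ne_top]
    refine setLIntegral_congr_fun measurableSet_Ioi fun y hy => ?_
    rw [← ofReal_rpow_sub_one_mul hs0, ofReal_stretchedGaussian_rpow hq hs h (le_of_lt hy),
      mul_assoc]
  rw [h1, ENNReal.ofReal_mul ha.le, mul_left_comm]
  congr 1
  have h2 : ∀ c : ℝ, 0 ≤ c → 2 * ∫⁻ y in Ioi 0, ENNReal.ofReal (c * y ^ q) *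
      ENNReal.ofReal (stretchedGaussian q s y) = ENNReal.ofReal (c / (q * s + s - 1)) := by
    intro c hc
    rw [div_eq_mul_one_div, ENNReal.ofReal_mul hc, ← hmom, mul_left_comm,
      ← lintegral_const_mul' _ _ ENNReal.ofReal_ne_top]
    congr 1
    refine lintegral_congr fun y => ?_
    rw [ENNReal.ofReal_mul hc, mul_assoc]
  rcases lt_or_gt_of_ne h with h3 | h3
  · have h4 : ∫⁻ y in Ioi 0, ENNReal.ofReal (1 + (1 - s) * y ^ q) *
        ENNReal.ofReal (stretchedGaussian q s y) =
        ∫⁻ y in Ioi 0, (ENNReal.ofReal (stretchedGaussian q s y) +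
          ENNReal.ofReal ((1 - s) * y ^ q) * ENNReal.ofReal (stretchedGaussian q s y)) := by
      refine setLIntegral_congr_fun measurableSet_Ioi fun y hy => ?_
      have : (0 : ℝ) ≤ y ^ q := Real.rpow_nonneg (le_of_lt hy) _
      have : 0 ≤ (1 - s) * y ^ q := mul_nonneg (by linarith) this
      rw [ENNReal.ofReal_add zero_le_one this, ENNReal.ofReal_one, add_mul, one_mul]
    rw [h4, lintegral_add_left hgm, mul_add, hmass, h2 _ (by linarith), ← ENNReal.ofReal_one,
      ← ENNReal.ofReal_add zero_le_one (div_nonneg (by linarith) hm0.le)]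
    congr 1
    rw [eq_div_iff hm0.ne', add_mul, div_mul_cancel₀ _ hm0.ne']
    ring
  -- For `s > 1` the coefficient of `y ^ q` is negative. The moment term is added to the other side
  -- and cancelled at the end.
  · have h4 : ∫⁻ y in Ioi 0, ENNReal.ofReal (stretchedGaussian q s y) = ∫⁻ y in Ioi 0,
        (ENNReal.ofReal (1 + (1 - s) * y ^ q) * ENNReal.ofReal (stretchedGaussian q s y) +
          ENNReal.ofReal ((s - 1) * y ^ q) * ENNReal.ofReal (stretchedGaussian q s y)) := by
      refine setLIntegral_congr_fun measurableSet_Ioi fun y hy => ?_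
      have hyq : (0 : ℝ) ≤ y ^ q := Real.rpow_nonneg (le_of_lt hy) _
      by_cases h5 : 0 < stretchedGaussian q s y
      · rw [stretchedGaussian_pos_iff hq hs, abs_of_pos hy] at h5
        rw [← add_mul, ← ENNReal.ofReal_add h5.le (mul_nonneg (by linarith) hyq),
          show 1 + (1 - s) * y ^ q + (s - 1) * y ^ q = 1 by ring, ENNReal.ofReal_one, one_mul]
      · simp [ENNReal.ofReal_of_nonpos (not_lt.1 h5)]
    have hm : Measurable fun y : ℝ => ENNReal.ofReal ((s - 1) * y ^ q) *
        ENNReal.ofReal (stretchedGaussian q s y) := by fun_prop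
    rw [h4, lintegral_add_right _ hm, mul_add, h2 _ (by linarith)] at hmass
    have h5 : ENNReal.ofReal (q * s / (q * s + s - 1)) +
        ENNReal.ofReal ((s - 1) / (q * s + s - 1)) = 1 := by
      rw [← ENNReal.ofReal_add (by positivity) (div_nonneg (by linarith) hm0.le), ← add_div,
        show q * s + (s - 1) = q * s + s - 1 by ring, div_self hm0.ne', ENNReal.ofReal_one]
    exact (ENNReal.add_left_inj ENNReal.ofReal_ne_top).1 (hmass.trans h5.symm)

end gauss

/-! ### The logarithmic profile -/

section log

variable {s : ℝ}

theorem logDensity_eq (s y : ℝ) : logDensity s y =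
    1 / (2 * Real.Gamma (s / (s - 1))) * max 0 (-Real.log |y|) ^ (1 / (s - 1)) := rfl

theorem logConst_pos (hs : 1 < s) : 0 < 1 / (2 * Real.Gamma (s / (s - 1))) := by
  have : 0 < s - 1 := by linarith
  have := Real.Gamma_pos_of_pos (show 0 < s / (s - 1) by positivity)
  positivity

theorem core_logDensity (hs : 1 < s) : core (logDensity s) = Ioo 0 1 := by
  have h1 : 1 / (s - 1) ≠ 0 := one_div_ne_zero (by linarith)
  ext y
  refine and_congr_right fun hy => ?_
  rw [logDensity_eq, mul_pos_iff_of_pos_left (logConst_pos hs), abs_of_pos hy]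
  constructor
  · intro h
    by_contra h2
    rw [max_eq_left (neg_nonpos.2 (Real.log_nonneg (not_lt.1 h2))), Real.zero_rpow h1] at h
    exact lt_irrefl _ h
  · intro h
    have := neg_pos.2 (Real.log_neg hy h)
    rw [max_eq_right this.le]
    exact Real.rpow_pos_of_pos this _

theorem logDensity_of_mem (s : ℝ) {y : ℝ} (hy : y ∈ Ioo (0 : ℝ) 1) :
    logDensity s y = 1 / (2 * Real.Gamma (s / (s - 1))) * (-Real.log y) ^ (1 / (s - 1)) := by
  rw [logDensity_eq, abs_of_pos hy.1, max_eq_right (neg_pos.2 (Real.log_neg hy.1 hy.2)).le]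

theorem logDensity_of_one_le (hs : 1 < s) {y : ℝ} (hy : 1 ≤ |y|) : logDensity s y = 0 := by
  rw [logDensity_eq, max_eq_left (neg_nonpos.2 (Real.log_nonneg hy)),
    Real.zero_rpow (one_div_ne_zero (by linarith)), mul_zero]

/-- Integrals of powers of `-log` against the logarithmic density. -/
theorem lintegral_neg_log_mul_logDensity (hs : 1 < s) {c : ℝ} (hc : 0 ≤ c) :
    2 * ∫⁻ y in Ioi 0, ENNReal.ofReal ((-Real.log y) ^ c) * ENNReal.ofReal (logDensity s y) =
      ENNReal.ofReal (Real.Gamma (s / (s - 1) + c) / Real.Gamma (s / (s - 1))) := by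
  have hs1 : 0 < s - 1 := by linarith
  have hC := logConst_pos hs
  have hG := Real.Gamma_pos_of_pos (show 0 < s / (s - 1) by positivity)
  have h1 := lintegral_neg_log_rpow (c := c + 1 / (s - 1)) (by
    have : 0 < 1 / (s - 1) := by positivity
    linarith)
  have h2 : ∫⁻ y in Ioi 0, ENNReal.ofReal ((-Real.log y) ^ c) * ENNReal.ofReal (logDensity s y) =
      ENNReal.ofReal (1 / (2 * Real.Gamma (s / (s - 1)))) *
        ∫⁻ y in Ioi 0, ENNReal.ofReal (if y < 1 then (-Real.log y) ^ (c + 1 / (s - 1)) else 0) := by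
    rw [← lintegral_const_mul' _ _ ENNReal.ofReal_ne_top]
    refine setLIntegral_congr_fun measurableSet_Ioi fun y hy => ?_
    by_cases hy1 : y < 1
    · have hl := neg_pos.2 (Real.log_neg hy hy1)
      rw [logDensity_of_mem s ⟨hy, hy1⟩, if_pos hy1, Real.rpow_add hl,
        ← ENNReal.ofReal_mul (by positivity), ← ENNReal.ofReal_mul (by positivity)]
      congr 1
      ring
    · rw [if_neg hy1, logDensity_of_one_le hs (by rw [abs_of_pos hy]; exact not_lt.1 hy1)]
      simp
  rw [h2, h1, ← ENNReal.ofReal_mul hC.le, ← ENNReal.ofReal_ofNat, ← ENNReal.ofReal_mul (by simp)]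
  congr 1
  rw [show c + 1 / (s - 1) + 1 = s / (s - 1) + c by field_simp; ring]
  field_simp

theorem measurable_logDensity (s : ℝ) : Measurable (logDensity s) := by
  have : Measurable fun y : ℝ => Real.log |y| := Real.measurable_log.comp measurable_id.abs
  exact ((measurable_const.max this.neg).pow_const _).const_mul _

/-- The profile is unbounded at the origin, so finiteness of the escort map takes a separate
argument. -/
theorem isProfile_logDensity (γ : ℝ) (hs : 1 < s) : IsProfile γ (logDensity s) := by
  have hs1 : 0 < s - 1 := by linarith
  have hC := logConst_pos hs
  have hanti : AntitoneOn (logDensity s) (Ioi 0) := fun x hx y hy hxy => by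
    have hx' : 0 < x := hx
    rw [logDensity_eq, logDensity_eq, abs_of_pos hx', abs_of_pos (hx'.trans_le hxy)]
    gcongr
  refine ⟨measurable_logDensity s, fun y => ?_, ?_, hanti, ?_, ?_, fun z hz => ?_⟩
  · rw [logDensity_eq]; positivity
  · rw [core_logDensity hs]; exact isOpen_Ioo
  · rw [core_logDensity hs]
    have h1 : ContDiffOn ℝ 1 (fun y : ℝ => (-Real.log y) ^ (1 / (s - 1))) (Ioo 0 1) :=
      (contDiffOn_id.log fun y hy => hy.1.ne').neg.rpow_const_of_ne fun y hy =>
        (neg_pos.2 (Real.log_neg hy.1 hy.2)).ne'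
    exact ((contDiffOn_const (c := 1 / (2 * Real.Gamma (s / (s - 1))))).mul h1).congr
      fun y hy => logDensity_of_mem s hy
  · have h1 := lintegral_neg_log_mul_logDensity hs le_rfl
    have hG := Real.Gamma_pos_of_pos (show 0 < s / (s - 1) by positivity)
    simpa [hG.ne'] using h1
  · rw [core_logDensity hs] at hz
    have hvz : 0 < logDensity s z := ((core_logDensity hs).symm ▸ hz : z ∈ core (logDensity s)).2
    -- A nonpositive power is bounded on `(0, z]` by its value at `z`; a positive power is a power
    -- of `-log`, integrable by the Gamma integral.
    rcases le_or_gt ((γ - 1) / γ) 0 with hp | hp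
    · refine ne_top_of_le_ne_top ?_ (setLIntegral_mono (measurable_const
        (a := ENNReal.ofReal (logDensity s z) ^ ((γ - 1) / γ))) fun t ht =>
          ennreal_rpow_le_rpow_of_nonpos
            (ENNReal.ofReal_le_ofReal (hanti ht.1 hz.1 ht.2)) hp)
      rw [lintegral_const, Measure.restrict_apply MeasurableSet.univ, univ_inter, Real.volume_Ioc]
      exact ENNReal.mul_ne_top (ENNReal.rpow_ne_top_of_ne_zero (ENNReal.ofReal_pos.2 hvz).ne'
        ENNReal.ofReal_ne_top) ENNReal.ofReal_ne_top
    · set p := (γ - 1) / γ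
      have h1 := lintegral_neg_log_rpow (c := 1 / (s - 1) * p) (by
        have : 0 < 1 / (s - 1) * p := by positivity
        linarith)
      have h2 : cumul (fun y => ENNReal.ofReal (logDensity s y) ^ p) z ≤
          ENNReal.ofReal ((1 / (2 * Real.Gamma (s / (s - 1)))) ^ p) *
          ∫⁻ y in Ioi 0, ENNReal.ofReal (if y < 1 then (-Real.log y) ^ (1 / (s - 1) * p)
            else 0) := by
        rw [← lintegral_const_mul' _ _ ENNReal.ofReal_ne_top]
        refine le_trans (le_of_eq ?_) (lintegral_mono_set fun t (ht : t ∈ Ioc 0 z) => ht.1)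
        refine setLIntegral_congr_fun measurableSet_Ioc fun t ht => ?_
        have ht1 : t < 1 := ht.2.trans_lt hz.2
        have hl := neg_pos.2 (Real.log_neg ht.1 ht1)
        rw [if_pos ht1, logDensity_of_mem s ⟨ht.1, ht1⟩, ← ENNReal.ofReal_mul (by positivity),
          ENNReal.ofReal_rpow_of_pos (by positivity), Real.mul_rpow hC.le (by positivity),
          ← Real.rpow_mul hl.le]
      rw [h1] at h2
      exact ne_top_of_le_ne_top (ENNReal.mul_ne_top ENNReal.ofReal_ne_top ENNReal.ofReal_ne_top) h2

/-- The logarithmic analogue of the affine identity: the cross term becomes the mean of the negative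
part of `log W`. -/
theorem ofReal_logDensity_rpow (hs : 1 < s) {y : ℝ} (hy : 0 < y) :
    ENNReal.ofReal (logDensity s y) ^ (s - 1) =
      ENNReal.ofReal ((1 / (2 * Real.Gamma (s / (s - 1)))) ^ (s - 1)) *
        ENNReal.ofReal (-Real.log y) := by
  have hs1 : 0 < s - 1 := by linarith
  have hC := logConst_pos hs
  rcases lt_or_ge y 1 with h | h
  · have hl := neg_pos.2 (Real.log_neg hy h)
    rw [logDensity_of_mem s ⟨hy, h⟩, ENNReal.ofReal_rpow_of_pos (by positivity),
      ← ENNReal.ofReal_mul (by positivity), Real.mul_rpow hC.le (by positivity),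
      ← Real.rpow_mul hl.le, one_div_mul_cancel hs1.ne', Real.rpow_one]
  · rw [logDensity_of_one_le hs (by rwa [abs_of_pos hy]), ENNReal.ofReal_zero,
      ENNReal.zero_rpow_of_pos hs1,
      ENNReal.ofReal_of_nonpos (neg_nonpos.2 (Real.log_nonneg h)), mul_zero]

theorem lintegral_logDensity (hs : 1 < s) :
    2 * ∫⁻ y in Ioi 0, ENNReal.ofReal (-Real.log y) * ENNReal.ofReal (logDensity s y) =
      ENNReal.ofReal (s / (s - 1)) ∧
    2 * ∫⁻ y in Ioi 0, ENNReal.ofReal (logDensity s y) ^ s =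
      ENNReal.ofReal ((1 / (2 * Real.Gamma (s / (s - 1)))) ^ (s - 1) * (s / (s - 1))) := by
  have hs1 : 0 < s - 1 := by linarith
  have hC := logConst_pos hs
  have h1 := lintegral_neg_log_mul_logDensity hs zero_le_one
  have hG := Real.Gamma_pos_of_pos (show 0 < s / (s - 1) by positivity)
  simp only [Real.rpow_one] at h1
  rw [Real.Gamma_add_one (by positivity), mul_div_cancel_right₀ _ hG.ne'] at h1
  refine ⟨h1, ?_⟩
  rw [ENNReal.ofReal_mul (by positivity), ← h1, mul_left_comm,
    ← lintegral_const_mul' _ _ ENNReal.ofReal_ne_top]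
  congr 1
  refine setLIntegral_congr_fun measurableSet_Ioi fun y hy => ?_
  rw [← ofReal_rpow_sub_one_mul (by linarith), ofReal_logDensity_rpow hs hy, mul_assoc]

end log

/-! ### The uniform profile -/

section uniform

theorem uniform_eq (y : ℝ) : (Ioo (-(1 / 2)) (1 / 2)).indicator (1 : ℝ → ℝ) y =
    if |y| < 1 / 2 then 1 else 0 := by
  simp only [indicator_apply, mem_Ioo, abs_lt, Pi.one_apply]

theorem core_uniform : core ((Ioo (-(1 / 2)) (1 / 2)).indicator (1 : ℝ → ℝ)) = Ioo 0 (1 / 2) := by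
  ext y
  refine and_congr_right fun hy => ?_
  rw [uniform_eq, abs_of_pos hy]
  split_ifs with h
  · exact iff_of_true one_pos h
  · exact iff_of_false (lt_irrefl _) h

theorem lintegral_uniform_rpow {s : ℝ} (hs : 0 < s) : 2 * ∫⁻ y in Ioi 0,
    ENNReal.ofReal ((Ioo (-(1 / 2)) (1 / 2)).indicator (1 : ℝ → ℝ) y) ^ s = 1 := by
  have h1 : ∫⁻ y in Ioi 0, ENNReal.ofReal ((Ioo (-(1 / 2)) (1 / 2)).indicator (1 : ℝ → ℝ) y) ^ s =
      ∫⁻ y in Ioo (0 : ℝ) (1 / 2), 1 := by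
    rw [← lintegral_indicator measurableSet_Ioi, ← lintegral_indicator measurableSet_Ioo]
    refine lintegral_congr fun y => ?_
    by_cases hy : y ∈ Ioi (0 : ℝ)
    · rw [indicator_of_mem hy, uniform_eq, abs_of_pos hy]
      by_cases h : y < 1 / 2
      · rw [if_pos h, indicator_of_mem (show y ∈ Ioo (0 : ℝ) (1 / 2) from ⟨hy, h⟩),
          ENNReal.ofReal_one, ENNReal.one_rpow]
      · rw [if_neg h, indicator_of_notMem fun h' => h h'.2, ENNReal.ofReal_zero,
          ENNReal.zero_rpow_of_pos hs]
    · rw [indicator_of_notMem hy, indicator_of_notMem fun h' => hy h'.1]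
  rw [h1, setLIntegral_one, Real.volume_Ioo, ← ENNReal.ofReal_ofNat,
    ← ENNReal.ofReal_mul (by simp)]
  norm_num

theorem isProfile_uniform (γ : ℝ) :
    IsProfile γ ((Ioo (-(1 / 2)) (1 / 2)).indicator (1 : ℝ → ℝ)) := by
  have hanti : AntitoneOn ((Ioo (-(1 / 2)) (1 / 2)).indicator (1 : ℝ → ℝ)) (Ioi 0) := by
    intro x hx y hy hxy
    have hx' : 0 < x := hx
    rw [uniform_eq, uniform_eq, abs_of_pos hx', abs_of_pos (hx'.trans_le hxy)]
    split_ifs with h1 h2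
    · exact le_rfl
    · exact absurd (hxy.trans_lt h1) h2
    · exact zero_le_one
    · exact le_rfl
  refine ⟨measurable_one.indicator measurableSet_Ioo, fun y => ?_, ?_, hanti, ?_, ?_,
    fun z hz => cumul_rpow_ne_top hanti (a := 1) (fun y => ?_) _ hz⟩
  · rw [uniform_eq]; split_ifs <;> simp
  · rw [core_uniform]; exact isOpen_Ioo
  · rw [core_uniform]
    refine (contDiffOn_const (c := (1 : ℝ))).congr fun y hy => ?_
    rw [uniform_eq, abs_of_pos hy.1, if_pos hy.2]
  · simpa using lintegral_uniform_rpow one_pos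
  · rw [uniform_eq]; split_ifs <;> simp

end uniform

/-! ### Extremality of the densities generated by the three profiles -/

/-- `f₀` maximizes the entropy power among the densities of the same cumulative deviation, it is
the only maximizer, and the quotient of the two functionals at `f₀` is `K`. -/
structure IsExtremal (q : ℝ≥0∞) (γ lam K : ℝ) (f₀ : ℝ → ℝ) : Prop where
  isC1Density : IsC1Density f₀
  ratio : ∃ n d : ℝ, 0 < n ∧ 0 < d ∧ entropyPower lam f₀ = ENNReal.ofReal n ∧
    cumulativeDeviation q γ f₀ = ENNReal.ofReal d ∧ d / n = K
  eq_zero : ∀ f, IsC1Density f → cumulativeDeviation q γ f = 0 → entropyPower lam f = 0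
  le : ∀ f, IsC1Density f → cumulativeDeviation q γ f = cumulativeDeviation q γ f₀ →
    entropyPower lam f ≤ entropyPower lam f₀ ∧
      (entropyPower lam f = entropyPower lam f₀ → f =ᵐ[volume] f₀)

theorem IsExtremal.sharp {q : ℝ≥0∞} {γ lam K κ₀ : ℝ} {ρ f₀ : ℝ → ℝ} (h : IsExtremal q γ lam K f₀)
    (hγ : 0 < γ) (hκ₀ : 0 < κ₀) (hρ : ρ = scale κ₀ f₀) :
    0 < K ∧ (IsC1Density ρ ∧ entropyPower lam ρ ≠ 0 ∧ entropyPower lam ρ ≠ ∞ ∧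
      cumulativeDeviation q γ ρ / entropyPower lam ρ = ENNReal.ofReal K) ∧
    ∀ f : ℝ → ℝ, IsC1Density f →
      ENNReal.ofReal K * entropyPower lam f ≤ cumulativeDeviation q γ f ∧
      (entropyPower lam f ≠ 0 → entropyPower lam f ≠ ∞ →
        ENNReal.ofReal K ≤ cumulativeDeviation q γ f / entropyPower lam f ∧
        (cumulativeDeviation q γ f / entropyPower lam f = ENNReal.ofReal K ↔
          ∃ κ : ℝ, 0 < κ ∧ f =ᵐ[volume] fun x => κ * ρ (κ * x))) := by
  obtain ⟨n, d, hn, hd, hN, hD, hK⟩ := h.ratio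
  refine sharp_of_normalized hγ hκ₀ hρ h.isC1Density ?_ ?_ ?_ ?_ ?_ h.eq_zero h.le
  · rw [hN]; exact (ENNReal.ofReal_pos.2 hn).ne'
  · rw [hN]; exact ENNReal.ofReal_ne_top
  · rw [hD]; exact (ENNReal.ofReal_pos.2 hd).ne'
  · rw [hD]; exact ENNReal.ofReal_ne_top
  · rw [hN, hD, ← ENNReal.ofReal_div_of_pos hn, hK]

theorem IsC1Density.lintegral_pos_eq_one {f : ℝ → ℝ} (hf : IsC1Density f) :
    ∫⁻ x in {x | 0 < f x}, ENNReal.ofReal (f x) = 1 := by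
  have h := lintegral_mul_ofReal_eq hf.measurable fun _ => 1
  simp only [one_mul] at h
  rw [← h, hf.mass_one]

theorem IsC1Density.not_ae_eq_zero {f : ℝ → ℝ} (hf : IsC1Density f) (h : ∀ᵐ x, ¬ 0 < f x) :
    False := by
  have h1 : ∫⁻ x, ENNReal.ofReal (f x) = 0 := by
    rw [← lintegral_zero (μ := (volume : Measure ℝ))]
    refine lintegral_congr_ae (h.mono fun x hx => ?_)
    exact ENNReal.ofReal_of_nonpos (not_lt.1 hx)
  rw [hf.mass_one] at h1
  exact one_ne_zero h1

theorem ae_absCumulative_ne_zero (γ : ℝ) {f : ℝ → ℝ} (hf : Measurable f) :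
    ∀ᵐ x, 0 < f x → absCumulative γ f x ≠ 0 := by
  filter_upwards [ae_notMem_of_volume_eq_zero γ hf (measurableSet_singleton 0)
    (measure_mono_null inter_subset_left (by simp))] with x hx hx0 h
  exact hx hx0 (by simp [h]) (by simp [h])

theorem ae_absCumulative_ne_top {f : ℝ → ℝ} (hf : Measurable f) {γ : ℝ} {φ : ℝ≥0∞ → ℝ≥0∞}
    (hφ : Measurable φ) (hφt : φ ∞ = ∞)
    (h : ∫⁻ x, φ (absCumulative γ f x) * ENNReal.ofReal (f x) ≠ ∞) :
    ∀ᵐ x, 0 < f x → absCumulative γ f x ≠ ∞ := by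
  filter_upwards [ae_lt_top ((hφ.comp (measurable_absCumulative γ f)).mul hf.ennreal_ofReal) h]
    with x hx hx0 hW
  simp only [Pi.mul_apply, Function.comp_apply, hW, hφt] at hx
  rw [ENNReal.top_mul (ENNReal.ofReal_pos.2 hx0).ne'] at hx
  exact lt_irrefl _ hx

/-! ### Extremality for finite positive order -/

section gauss

variable {q s γ lam : ℝ} {f f₀ : ℝ → ℝ}

theorem IsEscort.absCumulativeMoment_eq (hq : 0 < q) (hsq : 1 - s < q * s) (hγ : 0 < γ)
    (hf₀ : IsEscort γ (stretchedGaussian q s) f₀) :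
    absCumulativeMoment q γ f₀ = ENNReal.ofReal (1 / (q * s + s - 1)) := by
  have hm : Measurable fun y : ℝ≥0∞ => y ^ q := measurable_id.pow_const _
  rw [absCumulativeMoment, hf₀.lintegral_comp_absCumulative (isProfile_stretchedGaussian γ hq hsq)
    hγ hm, ← (lintegral_stretchedGaussian hq hsq).2]
  congr 1
  refine setLIntegral_congr_fun measurableSet_Ioi fun y hy => ?_
  rw [ENNReal.ofReal_rpow_of_nonneg (le_of_lt hy) hq.le]

/-- The positive part of `1 - (s - 1) W ^ q` is at least the expression itself, and the mean of the
latter is fixed by the moment. Dropping the positive part costs nothing in the direction needed for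
`s > 1`. -/
theorem gaussian_moment_le (hq : 0 < q) (hsq : 1 - s < q * s) (hs1 : 1 < s) (hf : IsC1Density f)
    (hm : absCumulativeMoment q γ f = ENNReal.ofReal (1 / (q * s + s - 1)))
    (hW : ∀ᵐ x, 0 < f x → absCumulative γ f x ≠ ∞) :
    2 * ∫⁻ y in Ioi 0, ENNReal.ofReal (stretchedGaussian q s y) ^ s ≤ ∫⁻ x in {x | 0 < f x},
        ENNReal.ofReal (stretchedGaussian q s (absCumulative γ f x).toReal) ^ (s - 1) *
          ENNReal.ofReal (f x) := by
  have hm0 : 0 < q * s + s - 1 := by linarith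
  have ha := Real.rpow_pos_of_pos (gaussConst_pos hq hsq) (s - 1)
  have hs0 : 0 < s := by linarith
  rw [lintegral_stretchedGaussian_rpow hq hsq hs1.ne', ENNReal.ofReal_mul ha.le]
  have h1 : ∫⁻ x in {x | 0 < f x},
      ENNReal.ofReal (stretchedGaussian q s (absCumulative γ f x).toReal) ^ (s - 1) *
          ENNReal.ofReal (f x) = ENNReal.ofReal (gaussConst q s ^ (s - 1)) *
      ∫⁻ x in {x | 0 < f x}, ENNReal.ofReal (1 + (1 - s) * (absCumulative γ f x).toReal ^ q) *
        ENNReal.ofReal (f x) := by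
    rw [← lintegral_const_mul' _ _ ENNReal.ofReal_ne_top]
    refine lintegral_congr fun x => ?_
    rw [ofReal_stretchedGaussian_rpow hq hsq hs1.ne' ENNReal.toReal_nonneg, mul_assoc]
  rw [h1]
  gcongr
  have hWm := measurable_absCumulative γ f
  have hmeas : Measurable fun x => ENNReal.ofReal (s - 1) *
      (absCumulative γ f x ^ q * ENNReal.ofReal (f x)) :=
    ((hWm.pow_const q).mul hf.measurable.ennreal_ofReal).const_mul _
  have h2 : (1 : ℝ≥0∞) ≤ (∫⁻ x in {x | 0 < f x},
      ENNReal.ofReal (1 + (1 - s) * (absCumulative γ f x).toReal ^ q) * ENNReal.ofReal (f x)) +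
        ENNReal.ofReal ((s - 1) / (q * s + s - 1)) := by
    rw [div_eq_mul_one_div, ENNReal.ofReal_mul (by linarith), ← hm, absCumulativeMoment,
      lintegral_mul_ofReal_eq hf.measurable, ← lintegral_const_mul' _ _ ENNReal.ofReal_ne_top,
      ← lintegral_add_right _ hmeas, ← hf.lintegral_pos_eq_one]
    refine lintegral_mono_ae ((ae_restrict_iff' (measurableSet_pos hf.measurable)).2 ?_)
    filter_upwards [hW] with x hx hx0
    have hWx := hx hx0
    rw [← mul_assoc, ← add_mul]
    refine le_mul_of_one_le_left' ?_
    conv_rhs => rw [← ENNReal.ofReal_toReal hWx]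
    have hw : 0 ≤ (absCumulative γ f x).toReal ^ q := by positivity
    rw [ENNReal.toReal_ofReal ENNReal.toReal_nonneg,
      ENNReal.ofReal_rpow_of_nonneg ENNReal.toReal_nonneg hq.le,
      ← ENNReal.ofReal_mul (by linarith), ← ENNReal.ofReal_one]
    refine le_trans (ENNReal.ofReal_le_ofReal (le_of_eq ?_)) ENNReal.ofReal_add_le
    ring
  have h5 : ENNReal.ofReal (q * s / (q * s + s - 1)) +
      ENNReal.ofReal ((s - 1) / (q * s + s - 1)) = 1 := by
    rw [← ENNReal.ofReal_add (by positivity) (div_nonneg (by linarith) hm0.le), ← add_div,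
      show q * s + (s - 1) = q * s + s - 1 by ring, div_self hm0.ne', ENNReal.ofReal_one]
  rw [← h5] at h2
  exact (ENNReal.add_le_add_iff_right ENNReal.ofReal_ne_top).1 h2

/-- For `s < 1` the affine function is positive, no positive part interferes, and both sides in fact
agree. -/
theorem gaussian_moment_ge (hq : 0 < q) (hsq : 1 - s < q * s) (hs1 : s < 1) (hf : IsC1Density f)
    (hm : absCumulativeMoment q γ f = ENNReal.ofReal (1 / (q * s + s - 1)))
    (hW : ∀ᵐ x, 0 < f x → absCumulative γ f x ≠ ∞) :
    ∫⁻ x in {x | 0 < f x},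
        ENNReal.ofReal (stretchedGaussian q s (absCumulative γ f x).toReal) ^ (s - 1) *
          ENNReal.ofReal (f x) ≤
      2 * ∫⁻ y in Ioi 0, ENNReal.ofReal (stretchedGaussian q s y) ^ s := by
  have hm0 : 0 < q * s + s - 1 := by linarith
  have ha := Real.rpow_pos_of_pos (gaussConst_pos hq hsq) (s - 1)
  have hs0 : 0 < s := by nlinarith
  rw [lintegral_stretchedGaussian_rpow hq hsq hs1.ne, ENNReal.ofReal_mul ha.le]
  have h1 : ∫⁻ x in {x | 0 < f x},
      ENNReal.ofReal (stretchedGaussian q s (absCumulative γ f x).toReal) ^ (s - 1) *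
          ENNReal.ofReal (f x) = ENNReal.ofReal (gaussConst q s ^ (s - 1)) *
      ∫⁻ x in {x | 0 < f x}, (ENNReal.ofReal (f x) + ENNReal.ofReal (1 - s) *
        (absCumulative γ f x ^ q * ENNReal.ofReal (f x))) := by
    rw [← lintegral_const_mul' _ _ ENNReal.ofReal_ne_top]
    refine lintegral_congr_ae ((ae_restrict_iff' (measurableSet_pos hf.measurable)).2 ?_)
    filter_upwards [hW] with x hx hx0
    have hWx := hx hx0
    have hw : 0 ≤ (absCumulative γ f x).toReal ^ q := by positivity
    rw [ofReal_stretchedGaussian_rpow hq hsq hs1.ne ENNReal.toReal_nonneg, mul_assoc,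
      ENNReal.ofReal_add zero_le_one (mul_nonneg (by linarith) hw), ENNReal.ofReal_one,
      ENNReal.ofReal_mul (by linarith), ← ENNReal.ofReal_rpow_of_nonneg ENNReal.toReal_nonneg hq.le,
      ENNReal.ofReal_toReal hWx, add_mul, one_mul, mul_assoc]
  rw [h1, lintegral_add_left hf.measurable.ennreal_ofReal, hf.lintegral_pos_eq_one,
    lintegral_const_mul' _ _ ENNReal.ofReal_ne_top, ← lintegral_mul_ofReal_eq hf.measurable]
  rw [absCumulativeMoment] at hm
  rw [hm, ← ENNReal.ofReal_mul (by linarith), ← ENNReal.ofReal_one,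
    ← ENNReal.ofReal_add zero_le_one (by
      have : 0 ≤ 1 - s := by linarith
      positivity)]
  refine le_of_eq ?_
  congr 2
  rw [eq_div_iff hm0.ne', add_mul, mul_assoc, one_div_mul_cancel hm0.ne']
  ring

variable {Q : ℝ≥0∞}

theorem cumulativeDeviation_of_ne (hQ0 : Q ≠ 0) (hQt : Q ≠ ∞) (γ : ℝ) (f : ℝ → ℝ) :
    cumulativeDeviation Q γ f = absCumulativeMoment Q.toReal γ f ^ (1 / (Q.toReal * γ)) := by
  rw [cumulativeDeviation, if_neg hQ0, if_neg hQt]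

/-- Fixing the deviation fixes the `q`-th moment of `W`, which also makes `W` finite almost
everywhere on the support. The three tangent inequalities then apply according to the position of
`s` relative to one. -/
theorem IsEscort.isExtremal_gaussian (hQ0 : Q ≠ 0) (hQt : Q ≠ ∞) (hγ : 0 < γ)
    (hs : γ * s = lam + γ - 1) (hsq : 1 - s < Q.toReal * s)
    (hf₀ : IsEscort γ (stretchedGaussian Q.toReal s) f₀) {K : ℝ}
    (hK1 : s ≠ 1 → (1 / (Q.toReal * s + s - 1)) ^ (1 / (Q.toReal * γ)) /
      (gaussConst Q.toReal s ^ (s - 1) * (Q.toReal * s / (Q.toReal * s + s - 1))) ^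
        (1 / (1 - lam)) = K)
    (hK2 : s = 1 → (1 / Q.toReal) ^ (1 / (Q.toReal * γ)) /
      Real.exp ((1 / Q.toReal - Real.log (gaussConst Q.toReal 1)) / γ) = K) :
    IsExtremal Q γ lam K f₀ := by
  have hq : 0 < Q.toReal := ENNReal.toReal_pos hQ0 hQt
  set q := Q.toReal
  have hs0 : 0 < s := by nlinarith
  have hm0 : 0 < q * s + s - 1 := by linarith
  have ha := gaussConst_pos hq hsq
  have hv := isProfile_stretchedGaussian γ hq hsq
  have hmom := hf₀.absCumulativeMoment_eq hq hsq hγ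
  have hqg : (1 / (q * γ) : ℝ) ≠ 0 := by positivity
  have hD : cumulativeDeviation Q γ f₀ =
      ENNReal.ofReal ((1 / (q * s + s - 1)) ^ (1 / (q * γ))) := by
    rw [cumulativeDeviation_of_ne hQ0 hQt, hmom, ENNReal.ofReal_rpow_of_pos (by positivity)]
  have hcm : Measurable fun y : ℝ => |y| ^ q := (continuous_abs_rpow hq).measurable
  have hC : 0 ≤ 1 / q := by positivity
  have hvc : ∀ y ∈ core (stretchedGaussian q 1), stretchedGaussian q 1 y =
      Real.exp (Real.log (gaussConst q 1) - |y| ^ q) := fun y _ => by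
    have : 0 < gaussConst q 1 := gaussConst_pos hq (by linarith)
    rw [stretchedGaussian_one, sub_eq_add_neg, Real.exp_add, Real.exp_log this]
  have hCe : 2 * ∫⁻ y in Ioi 0, ENNReal.ofReal (|y| ^ q) *
      ENNReal.ofReal (stretchedGaussian q 1 y) = ENNReal.ofReal (1 / q) := by
    have h := (lintegral_stretchedGaussian (s := 1) hq (by linarith)).2
    rw [show q * 1 + 1 - 1 = q by ring] at h
    rw [← h]
    congr 1
    refine setLIntegral_congr_fun measurableSet_Ioi fun y hy => ?_
    rw [abs_of_pos hy]
  refine ⟨hf₀.isC1Density hv hγ, ?_, fun f hf h => ?_, fun f hf h => ?_⟩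
  · by_cases h1 : s = 1
    · have hlam : lam = 1 := by subst h1; linarith
      refine ⟨Real.exp ((1 / q - Real.log (gaussConst q 1)) / γ), _, Real.exp_pos _, ?_, ?_, hD, ?_⟩
      · positivity
      · subst h1
        rw [hlam, hf₀.entropyPower_one hv hγ hcm hC (fun y _ => by positivity) hvc hCe,
          EReal.exp_coe]
      · rw [← hK2 h1, h1, show q * 1 + 1 - 1 = q by ring]
    · have hlam : lam ≠ 1 := fun h => h1 (by
        have : γ * s = γ * 1 := by linarith
        exact mul_left_cancel₀ hγ.ne' this)
      refine ⟨_, _, ?_, ?_, ?_, hD, hK1 h1⟩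
      · positivity
      · positivity
      · rw [entropyPower, if_neg hlam, hf₀.lintegral_rpow hv hγ hs0 hs,
          lintegral_stretchedGaussian_rpow hq hsq h1, ENNReal.ofReal_rpow_of_pos (by positivity)]
  -- Zero deviation would make `W` vanish almost everywhere on the support, whereas `W` is nonzero
  -- there almost everywhere.
  · exfalso
    have hmeas : Measurable fun x => absCumulative γ f x ^ q * ENNReal.ofReal (f x) :=
      ((measurable_absCumulative γ f).pow_const _).mul hf.measurable.ennreal_ofReal
    rw [cumulativeDeviation_of_ne hQ0 hQt, ENNReal.rpow_eq_zero_iff_of_pos (by positivity),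
      absCumulativeMoment, lintegral_eq_zero_iff hmeas] at h
    refine hf.not_ae_eq_zero ?_
    filter_upwards [h, ae_absCumulative_ne_zero γ hf.measurable] with x hx hW hx0
    rcases mul_eq_zero.1 hx with h1 | h1
    · exact hW hx0 ((ENNReal.rpow_eq_zero_iff_of_pos hq).1 h1)
    · exact (ENNReal.ofReal_pos.2 hx0).ne' h1
  · rw [cumulativeDeviation_of_ne hQ0 hQt, cumulativeDeviation_of_ne hQ0 hQt] at h
    have hm := (ENNReal.rpow_left_injective hqg h).trans hmom
    have hφ : Measurable fun y : ℝ≥0∞ => y ^ q := measurable_id.pow_const _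
    have hW := ae_absCumulative_ne_top hf.measurable (γ := γ) hφ (ENNReal.top_rpow_of_pos hq)
      (by rw [absCumulativeMoment] at hm; rw [hm]; exact ENNReal.ofReal_ne_top)
    rcases lt_trichotomy s 1 with h1 | h1 | h1
    · refine entropyPower_le_of_lt_one hγ hs0 h1 hs hv hf₀ hf ?_ ?_
        (gaussian_moment_ge hq hsq h1 hf hm hW)
      · rw [lintegral_stretchedGaussian_rpow hq hsq h1.ne]; exact ENNReal.ofReal_ne_top
      · filter_upwards [hW] with x hx hx0
        refine ⟨hx hx0, (stretchedGaussian_pos_iff hq hsq _).2 ?_⟩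
        have : 0 ≤ |(absCumulative γ f x).toReal| ^ q := by positivity
        have : 0 ≤ (1 - s) * |(absCumulative γ f x).toReal| ^ q := mul_nonneg (by linarith) this
        linarith
    · subst h1
      have hlam : lam = 1 := by linarith
      subst hlam
      refine entropyPower_le_of_eq_one hγ hv hf₀ hf hcm hC (fun y _ => by positivity) hvc hCe ?_ ?_
      · filter_upwards [hW, ae_absCumulative_ne_zero γ hf.measurable] with x hx hx' hx0
        refine ⟨hx hx0, ?_⟩
        rw [core_stretchedGaussian hq hsq]
        exact ⟨ENNReal.toReal_pos (hx' hx0) (hx hx0), by simp⟩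
      · rw [show 1 / q = 1 / (q * 1 + 1 - 1) by ring_nf, ← hm, absCumulativeMoment,
          lintegral_mul_ofReal_eq hf.measurable]
        refine lintegral_mono_ae ((ae_restrict_iff' (measurableSet_pos hf.measurable)).2 ?_)
        filter_upwards [hW] with x hx hx0
        rw [abs_of_nonneg ENNReal.toReal_nonneg,
          ← ENNReal.ofReal_rpow_of_nonneg ENNReal.toReal_nonneg hq.le,
          ENNReal.ofReal_toReal (hx hx0)]
    · refine entropyPower_le_of_one_lt hγ h1 hs hv hf₀ hf ?_ hW
        (gaussian_moment_le hq hsq h1 hf hm hW)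
      rw [lintegral_stretchedGaussian_rpow hq hsq h1.ne']; exact ENNReal.ofReal_ne_top

end gauss

/-! ### Extremality for infinite order -/

section uniform

variable {s γ lam : ℝ} {f f₀ : ℝ → ℝ}

theorem cumulativeDeviation_top (γ : ℝ) (f : ℝ → ℝ) : cumulativeDeviation ∞ γ f =
    (essSup (absCumulative γ f) (volume.restrict {x | 0 < f x})) ^ (1 / γ) := by
  rw [cumulativeDeviation, if_neg ENNReal.top_ne_zero, if_pos rfl]

/-- If `W` were bounded by some `c < 1 / 2`, the mass of `f₀` would be at most `2 * c`, because `W`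
is distributed according to the uniform profile. -/
theorem IsEscort.essSup_uniform (hγ : 0 < γ)
    (hf₀ : IsEscort γ ((Ioo (-(1 / 2)) (1 / 2)).indicator (1 : ℝ → ℝ)) f₀) :
    essSup (absCumulative γ f₀) (volume.restrict {x | 0 < f₀ x}) = ENNReal.ofReal (1 / 2) := by
  have hv := isProfile_uniform γ
  have hd := hf₀.isC1Density hv hγ
  refine le_antisymm (essSup_le_of_ae_le _ ?_) ?_
  · refine (ae_restrict_iff' (measurableSet_pos hd.measurable)).2 ?_
    filter_upwards [Measure.ae_ne volume (0 : ℝ)] with x hx hx0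
    obtain ⟨z, hz, hW, -⟩ := hf₀.absCumulative_eq hv hγ hx (ne_of_gt hx0)
    rw [core_uniform] at hz
    rw [hW]
    exact ENNReal.ofReal_le_ofReal hz.2.le
  · set c := essSup (absCumulative γ f₀) (volume.restrict {x | 0 < f₀ x})
    have h1 := ae_le_essSup (f := absCumulative γ f₀) (μ := volume.restrict {x | 0 < f₀ x})
    replace h1 := (ae_restrict_iff' (measurableSet_pos hd.measurable)).1 h1
    by_contra hc
    rw [not_le] at hc
    have hct : c ≠ ∞ := hc.ne_top
    have hφ : Measurable ((Iic c).indicator (1 : ℝ≥0∞ → ℝ≥0∞)) :=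
      measurable_one.indicator measurableSet_Iic
    have h2 := hf₀.lintegral_comp_absCumulative hv hγ hφ
    have h3 : ∫⁻ x, (Iic c).indicator (1 : ℝ≥0∞ → ℝ≥0∞) (absCumulative γ f₀ x) *
        ENNReal.ofReal (f₀ x) = 1 := by
      rw [← hd.mass_one]
      refine lintegral_congr_ae ?_
      filter_upwards [h1] with x hx
      by_cases hx0 : 0 < f₀ x
      · rw [indicator_of_mem (show absCumulative γ f₀ x ∈ Iic c from hx hx0), Pi.one_apply, one_mul]
      · rw [ENNReal.ofReal_of_nonpos (not_lt.1 hx0), mul_zero]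
    have h4 : ∫⁻ y in Ioi 0, (Iic c).indicator (1 : ℝ≥0∞ → ℝ≥0∞) (ENNReal.ofReal y) *
        ENNReal.ofReal ((Ioo (-(1 / 2)) (1 / 2)).indicator (1 : ℝ → ℝ) y) ≤
        ∫⁻ y in Ioc 0 c.toReal, 1 := by
      rw [← lintegral_indicator measurableSet_Ioi, ← lintegral_indicator measurableSet_Ioc]
      refine lintegral_mono fun y => ?_
      by_cases hy : y ∈ Ioc 0 c.toReal
      · rw [indicator_of_mem hy, indicator_of_mem (show y ∈ Ioi 0 from hy.1)]
        refine mul_le_one' (indicator_le_self' (by simp) _ |>.trans (by simp)) ?_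
        rw [uniform_eq]
        split_ifs <;> simp
      · rw [indicator_of_notMem hy]
        by_cases h0 : y ∈ Ioi (0 : ℝ)
        · rw [indicator_of_mem h0, indicator_of_notMem, zero_mul]
          intro h
          exact hy ⟨h0, (ENNReal.ofReal_le_iff_le_toReal hct).1 h⟩
        · rw [indicator_of_notMem h0]
    rw [setLIntegral_one, Real.volume_Ioc, sub_zero, ENNReal.ofReal_toReal hct] at h4
    have h5 : (1 : ℝ≥0∞) ≤ 2 * c := by
      rw [← h3, h2]; gcongr
    have h6 : 2 * c < 1 := by
      calc 2 * c < 2 * ENNReal.ofReal (1 / 2) :=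
            ENNReal.mul_lt_mul_right two_ne_zero ENNReal.ofNat_ne_top hc
        _ = 1 := by
            rw [← ENNReal.ofReal_ofNat, ← ENNReal.ofReal_mul (by simp)]; norm_num
    exact absurd h5 (not_le.2 h6)

/-- The profile equals one on its core, so the cross term is the total mass; the constraint serves
only to place `W` in the core. -/
theorem IsEscort.isExtremal_uniform (hγ : 0 < γ) (hs : γ * s = lam + γ - 1) (hs0 : 0 < s)
    (hf₀ : IsEscort γ ((Ioo (-(1 / 2)) (1 / 2)).indicator (1 : ℝ → ℝ)) f₀) :
    IsExtremal ∞ γ lam ((1 / 2) ^ (1 / γ)) f₀ := by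
  have hv := isProfile_uniform γ
  have hM := lintegral_uniform_rpow hs0
  have hsup := hf₀.essSup_uniform hγ
  have hγ1 : 1 / γ ≠ 0 := by positivity
  have hvc : ∀ y ∈ core ((Ioo (-(1 / 2)) (1 / 2)).indicator (1 : ℝ → ℝ)),
      (Ioo (-(1 / 2)) (1 / 2)).indicator (1 : ℝ → ℝ) y = 1 := fun y hy => by
    rw [core_uniform] at hy
    rw [uniform_eq, abs_of_pos hy.1, if_pos hy.2]
  have hvc' : ∀ y ∈ core ((Ioo (-(1 / 2)) (1 / 2)).indicator (1 : ℝ → ℝ)),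
      (Ioo (-(1 / 2)) (1 / 2)).indicator (1 : ℝ → ℝ) y = Real.exp (0 - 0) := fun y hy => by
    rw [hvc y hy]; simp
  have hCe : 2 * ∫⁻ y in Ioi 0, ENNReal.ofReal 0 *
      ENNReal.ofReal ((Ioo (-(1 / 2)) (1 / 2)).indicator (1 : ℝ → ℝ) y) = ENNReal.ofReal 0 := by
    simp
  refine ⟨hf₀.isC1Density hv hγ, ⟨1, (1 / 2) ^ (1 / γ), one_pos, by positivity, ?_, ?_, div_one _⟩,
    fun f hf h => ?_, fun f hf h => ?_⟩
  · by_cases h1 : lam = 1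
    · rw [h1, hf₀.entropyPower_one hv hγ measurable_const le_rfl (fun _ _ => le_rfl) hvc' hCe]
      simp
    · rw [entropyPower, if_neg h1, hf₀.lintegral_rpow hv hγ hs0 hs, hM, ENNReal.one_rpow,
        ENNReal.ofReal_one]
  · rw [cumulativeDeviation_top, hsup, ENNReal.ofReal_rpow_of_pos (by norm_num)]
  · exfalso
    rw [cumulativeDeviation_top, ENNReal.rpow_eq_zero_iff_of_pos (by positivity),
      ENNReal.essSup_eq_zero_iff, Filter.EventuallyEq,
      ae_restrict_iff' (measurableSet_pos hf.measurable)] at h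
    refine hf.not_ae_eq_zero ?_
    filter_upwards [h, ae_absCumulative_ne_zero γ hf.measurable] with x hx hW hx0
    exact hW hx0 (hx hx0)
  · rw [cumulativeDeviation_top, cumulativeDeviation_top, hsup] at h
    have hE := ENNReal.rpow_left_injective hγ1 h
    have h1 := ae_le_essSup (f := absCumulative γ f) (μ := volume.restrict {x | 0 < f x})
    rw [hE] at h1
    replace h1 := (ae_restrict_iff' (measurableSet_pos hf.measurable)).1 h1
    -- The essential supremum gives only `W ≤ 1 / 2`. The values `0` and `1 / 2`, where `W` would
    -- leave the core, are taken on null subsets of the support.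
    have hW : ∀ᵐ x, 0 < f x → absCumulative γ f x ≠ ∞ ∧ (absCumulative γ f x).toReal ∈
        core ((Ioo (-(1 / 2)) (1 / 2)).indicator (1 : ℝ → ℝ)) := by
      filter_upwards [h1, ae_absCumulative_ne_zero γ hf.measurable,
        ae_notMem_of_volume_eq_zero γ hf.measurable (measurableSet_singleton (1 / 2))
          (measure_mono_null inter_subset_left (by simp))] with x hx hx' hx'' hx0
      have ht : absCumulative γ f x ≠ ∞ := ne_top_of_le_ne_top ENNReal.ofReal_ne_top (hx hx0)
      refine ⟨ht, ?_⟩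
      rw [core_uniform]
      refine ⟨ENNReal.toReal_pos (hx' hx0) ht, lt_of_le_of_ne ?_ (hx'' hx0 ht)⟩
      exact ENNReal.toReal_le_of_le_ofReal (by norm_num) (hx hx0)
    have hI : ∫⁻ x in {x | 0 < f x}, ENNReal.ofReal ((Ioo (-(1 / 2)) (1 / 2)).indicator
        (1 : ℝ → ℝ) (absCumulative γ f x).toReal) ^ (s - 1) * ENNReal.ofReal (f x) = 1 := by
      rw [← hf.lintegral_pos_eq_one]
      refine lintegral_congr_ae ((ae_restrict_iff' (measurableSet_pos hf.measurable)).2 ?_)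
      filter_upwards [hW] with x hx hx0
      rw [hvc _ (hx hx0).2, ENNReal.ofReal_one, ENNReal.one_rpow, one_mul]
    rcases lt_trichotomy s 1 with h2 | h2 | h2
    · refine entropyPower_le_of_lt_one hγ hs0 h2 hs hv hf₀ hf (hM ▸ ENNReal.one_ne_top)
        (hW.mono fun x hx hx0 => ⟨(hx hx0).1, (hx hx0).2.2⟩) ?_
      rw [hI, hM]
    · subst h2
      have hlam : lam = 1 := by linarith
      subst hlam
      exact entropyPower_le_of_eq_one hγ hv hf₀ hf measurable_const le_rfl (fun _ _ => le_rfl) hvc'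
        hCe hW (by simp)
    · refine entropyPower_le_of_one_lt hγ h2 hs hv hf₀ hf (hM ▸ ENNReal.one_ne_top)
        (hW.mono fun x hx hx0 => (hx hx0).1) ?_
      rw [hI, hM]

end uniform

/-! ### Extremality for order zero -/

section log

variable {s γ lam : ℝ} {f f₀ : ℝ → ℝ}

theorem cumulativeDeviation_zero (γ : ℝ) (f : ℝ → ℝ) : cumulativeDeviation 0 γ f =
    EReal.exp (mean (fun x => (absCumulative γ f x).log) f) ^ (1 / γ) := by
  rw [cumulativeDeviation, if_pos rfl]

theorem log_of_ne {x : ℝ≥0∞} (h0 : x ≠ 0) (ht : x ≠ ∞) :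
    x.log = ((Real.log x.toReal : ℝ) : EReal) :=
  ENNReal.log_pos_real h0 ht

theorem measurable_neg_log_toENNReal : Measurable fun y : ℝ≥0∞ => (-y.log).toENNReal :=
  (ENNReal.measurable_log.neg).ereal_toENNReal

theorem IsEscort.mean_log (hγ : 0 < γ) (hs1 : 1 < s) (hf₀ : IsEscort γ (logDensity s) f₀) :
    mean (fun x => (absCumulative γ f₀ x).log) f₀ = ((-(s / (s - 1)) : ℝ) : EReal) := by
  have hv := isProfile_logDensity γ hs1
  have hs0 : 0 < s - 1 := by linarith
  rw [mean_of_nonpos]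
  · have h := hf₀.lintegral_comp_absCumulative hv hγ measurable_neg_log_toENNReal
    have h2 : ∫⁻ y in Ioi 0, (-(ENNReal.ofReal y).log).toENNReal * ENNReal.ofReal (logDensity s y) =
        ∫⁻ y in Ioi 0, ENNReal.ofReal (-Real.log y) * ENNReal.ofReal (logDensity s y) := by
      refine setLIntegral_congr_fun measurableSet_Ioi fun y hy => ?_
      rw [ENNReal.log_ofReal_of_pos hy, ← EReal.coe_neg, EReal.real_coe_toENNReal]
    rw [h, h2, (lintegral_logDensity hs1).1, EReal.coe_ennreal_ofReal,
      max_eq_left (by positivity), EReal.coe_neg]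
  · filter_upwards [Measure.ae_ne volume (0 : ℝ)] with x hx hx0
    obtain ⟨z, hz, hW, -⟩ := hf₀.absCumulative_eq hv hγ hx hx0.ne'
    rw [core_logDensity hs1] at hz
    rw [hW, ENNReal.log_le_zero_iff, ← ENNReal.ofReal_one]
    exact ENNReal.ofReal_le_ofReal hz.2.le

/-- Restricting a density to the set where its cumulative is finite. -/
theorem absCumulative_indicator (γ : ℝ) (f : ℝ → ℝ) {x : ℝ} (hx : absCumulative γ f x ≠ ∞) :
    absCumulative γ ({t | absCumulative γ f t ≠ ∞}.indicator f) x = absCumulative γ f x := by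
  refine setLIntegral_congr_fun measurableSet_uIoc fun t ht => ?_
  have h : absCumulative γ f t ≤ absCumulative γ f x := by
    refine lintegral_mono_set ?_
    rcases le_total 0 x with h0 | h0
    · rw [uIoc_of_le h0] at ht ⊢
      rw [uIoc_of_le ht.1.le]
      exact Ioc_subset_Ioc_right ht.2
    · rw [uIoc_of_ge h0] at ht ⊢
      rw [uIoc_of_ge ht.2]
      exact Ioc_subset_Ioc_left ht.1.le
  rw [indicator_of_mem (show t ∈ {t | absCumulative γ f t ≠ ∞} from ne_top_of_le_ne_top hx h)]

theorem log_moment_eq (hs1 : 1 < s) (hf : Measurable f)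
    (hW : ∀ᵐ x, 0 < f x → absCumulative γ f x ≠ ∞) :
    ∫⁻ x in {x | 0 < f x}, ENNReal.ofReal (logDensity s (absCumulative γ f x).toReal) ^ (s - 1) *
      ENNReal.ofReal (f x) = ENNReal.ofReal ((1 / (2 * Real.Gamma (s / (s - 1)))) ^ (s - 1)) *
        ∫⁻ x, (-(absCumulative γ f x).log).toENNReal * ENNReal.ofReal (f x) := by
  rw [lintegral_mul_ofReal_eq hf, ← lintegral_const_mul' _ _ ENNReal.ofReal_ne_top]
  refine lintegral_congr_ae ((ae_restrict_iff' (measurableSet_pos hf)).2 ?_)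
  filter_upwards [hW, ae_absCumulative_ne_zero γ hf] with x hx hx' hx0
  rw [ofReal_logDensity_rpow hs1 (ENNReal.toReal_pos (hx' hx0) (hx hx0)), mul_assoc,
    log_of_ne (hx' hx0) (hx hx0), ← EReal.coe_neg, EReal.real_coe_toENNReal]

/-- The integrated Bernoulli inequality with an infinite cross term forces the entropy integral to
be infinite. Since `W` may be infinite on part of the support, `f` is first cut off to the set where
`W` is finite. This changes neither `W` there nor the integral of the negative part of `log W`, and
it does not increase the entropy integral. -/
theorem lintegral_rpow_eq_top_of_log (hs1 : 1 < s) (hs : γ * s = lam + γ - 1) (hγ : 0 < γ)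
    (hf : Measurable f)
    (h : ∫⁻ x, (-(absCumulative γ f x).log).toENNReal * ENNReal.ofReal (f x) = ∞) :
    ∫⁻ x, ENNReal.ofReal (f x) ^ (lam - 1) * ENNReal.ofReal (f x) = ∞ := by
  have hlam : 0 < lam - 1 := by nlinarith
  have hWm := measurable_absCumulative γ f
  set T := {t | absCumulative γ f t ≠ ∞} with hT
  have hTm : MeasurableSet T := hWm (measurableSet_singleton ∞).compl
  set g := T.indicator f with hg
  have hgm : Measurable g := hf.indicator hTm
  have hgW : ∀ x, 0 < g x → x ∈ T := fun x hx => by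
    by_contra h0
    rw [hg, indicator_of_notMem h0] at hx
    exact lt_irrefl _ hx
  have hWg : ∀ x ∈ T, absCumulative γ g x = absCumulative γ f x := fun x hx =>
    absCumulative_indicator γ f hx
  have hW : ∀ᵐ x, 0 < g x → absCumulative γ g x ≠ ∞ := Filter.Eventually.of_forall fun x hx => by
    rw [hWg x (hgW x hx)]; exact hgW x hx
  have h1 : ∫⁻ x, (-(absCumulative γ g x).log).toENNReal * ENNReal.ofReal (g x) = ∞ := by
    rw [← h]
    refine lintegral_congr fun x => ?_
    by_cases hx : x ∈ T
    · rw [hWg x hx, hg, indicator_of_mem hx]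
    · have : absCumulative γ f x = ∞ := not_not.1 hx
      rw [hg, indicator_of_notMem hx, this]
      simp
  obtain ⟨h2, -⟩ := lintegral_bernoulli_of_one_lt hs1 hs hgm (measurable_logDensity s)
    (isProfile_logDensity γ hs1).nonneg hW
  have hC := logConst_pos hs1
  rw [log_moment_eq hs1 hgm hW, h1, (lintegral_logDensity hs1).2, ENNReal.mul_top (by simp; positivity),
    ENNReal.mul_top (by simp; linarith), top_le_iff, ENNReal.add_eq_top] at h2
  have h3 := h2.resolve_right (ENNReal.mul_ne_top ENNReal.ofReal_ne_top ENNReal.ofReal_ne_top)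
  rw [← top_le_iff, ← h3]
  refine lintegral_mono fun x => ?_
  by_cases hx : x ∈ T
  · rw [hg, indicator_of_mem hx]
  · rw [hg, indicator_of_notMem hx]; simp

/-- Unlike for positive order, zero deviation is not excluded outright: it means that the negative
part of `log W` has infinite mean, and then the entropy power vanishes too because `lam > 1`. -/
theorem IsEscort.isExtremal_log (hγ : 0 < γ) (hs : γ * s = lam + γ - 1) (hs1 : 1 < s)
    (hf₀ : IsEscort γ (logDensity s) f₀) :
    IsExtremal 0 γ lam (Real.exp (-(s / (s - 1))) ^ (1 / γ) /
      ((1 / (2 * Real.Gamma (s / (s - 1)))) ^ (s - 1) * (s / (s - 1))) ^ (1 / (1 - lam))) f₀ := by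
  have hv := isProfile_logDensity γ hs1
  have hC := logConst_pos hs1
  have hs0 : 0 < s - 1 := by linarith
  have hlam : 1 < lam := by nlinarith
  have hmean := hf₀.mean_log hγ hs1
  have hM := (lintegral_logDensity hs1).2
  have hγ1 : 1 / γ ≠ 0 := by positivity
  refine ⟨hf₀.isC1Density hv hγ, ⟨_, _, ?_, ?_, ?_, ?_, rfl⟩, fun f hf h => ?_, fun f hf h => ?_⟩
  · positivity
  · positivity
  · rw [entropyPower, if_neg hlam.ne', hf₀.lintegral_rpow hv hγ (by linarith) hs, hM,
      ENNReal.ofReal_rpow_of_pos (by positivity)]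
  · rw [cumulativeDeviation_zero, hmean, EReal.exp_coe, ENNReal.ofReal_rpow_of_pos (Real.exp_pos _)]
  · rw [cumulativeDeviation_zero, ENNReal.rpow_eq_zero_iff_of_pos (by positivity),
      EReal.exp_eq_zero_iff, mean, sub_eq_add_neg, EReal.add_eq_bot_iff] at h
    rcases h with h | h
    · exact absurd h (EReal.coe_ennreal_ne_bot _)
    · rw [EReal.neg_eq_bot_iff, EReal.coe_ennreal_eq_top_iff] at h
      rw [entropyPower, if_neg hlam.ne', lintegral_rpow_eq_top_of_log hs1 hs hγ hf.measurable h,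
        ENNReal.top_rpow_of_neg (one_div_neg.2 (by linarith))]
  · rw [cumulativeDeviation_zero, cumulativeDeviation_zero, hmean] at h
    have hm := EReal.exp_strictMono.injective (ENNReal.rpow_left_injective hγ1 h)
    rw [mean] at hm
    set A := ∫⁻ x, (absCumulative γ f x).log.toENNReal * ENNReal.ofReal (f x) with hA
    set B := ∫⁻ x, (-(absCumulative γ f x).log).toENNReal * ENNReal.ofReal (f x) with hB
    have hBt : B ≠ ∞ := fun h0 => by
      rw [h0, EReal.coe_ennreal_top, EReal.sub_top] at hm
      exact EReal.coe_ne_bot _ hm.symm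
    have hAt : A ≠ ∞ := fun h0 => by
      rw [h0, EReal.coe_ennreal_top, ← ENNReal.ofReal_toReal hBt, EReal.coe_ennreal_ofReal,
        EReal.top_sub_coe] at hm
      exact EReal.coe_ne_top _ hm.symm
    -- The constraint fixes `A - B`, while the cross term involves `B` only. Discarding `A ≥ 0`
    -- leaves the inequality needed for `s > 1`.
    have hAB : ENNReal.ofReal (s / (s - 1)) ≤ B := by
      rw [← ENNReal.ofReal_toReal hAt, ← ENNReal.ofReal_toReal hBt, EReal.coe_ennreal_ofReal,
        EReal.coe_ennreal_ofReal, max_eq_left ENNReal.toReal_nonneg,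
        max_eq_left ENNReal.toReal_nonneg, ← EReal.coe_sub, EReal.coe_eq_coe_iff] at hm
      rw [← ENNReal.ofReal_toReal hBt]
      refine ENNReal.ofReal_le_ofReal ?_
      have : 0 ≤ A.toReal := ENNReal.toReal_nonneg
      linarith
    have hφ : Measurable fun y : ℝ≥0∞ => y.log.toENNReal := ENNReal.measurable_log.ereal_toENNReal
    have hW := ae_absCumulative_ne_top hf.measurable (γ := γ) hφ (by simp) hAt
    refine entropyPower_le_of_one_lt hγ hs1 hs hv hf₀ hf (by rw [hM]; exact ENNReal.ofReal_ne_top)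
      hW ?_
    rw [log_moment_eq hs1 hf.measurable hW, hM, ENNReal.ofReal_mul (by positivity)]
    gcongr

end log

/-! ### The optimal constants -/

section constants

variable {β lam : ℝ}

theorem optConst_top : optConst ∞ β lam = (1 / 2) ^ (1 / (1 + β - lam)) := by
  rw [optConst, if_neg ENNReal.top_ne_zero, if_pos rfl]

theorem optConst_zero (h₁ : lam - 1 < β) (hlam : 1 < lam) {s γ : ℝ} (hγ : γ = 1 + β - lam)
    (hs : s = β / γ) : Real.exp (-(s / (s - 1))) ^ (1 / γ) /
      ((1 / (2 * Real.Gamma (s / (s - 1)))) ^ (s - 1) * (s / (s - 1))) ^ (1 / (1 - lam)) =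
    optConst 0 β lam := by
  have hγ0 : 0 < γ := by linarith
  have hβ : 0 < β := by linarith
  have hs1 : s - 1 = (lam - 1) / γ := by
    rw [hs, div_sub_one hγ0.ne', hγ]; congr 1; ring
  have hl : 0 < lam - 1 := by linarith
  have hm : s / (s - 1) = β / (lam - 1) := by
    rw [hs1, hs]; field_simp
  rw [optConst, if_pos rfl, hm, hs1, ← hγ]
  set m := β / (lam - 1) with hmdef
  have hm0 : 0 < m := by positivity
  have hG := Real.Gamma_pos_of_pos hm0
  have hC : 0 < 1 / (2 * Real.Gamma m) := by positivity
  rw [show Real.exp (-m) * m ^ (γ / (lam - 1)) / (2 * Real.Gamma m) =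
      Real.exp (-m) * (m ^ (γ / (lam - 1)) * (1 / (2 * Real.Gamma m))) by ring,
    Real.mul_rpow (Real.exp_pos _).le (by positivity), Real.mul_rpow (by positivity) hC.le,
    Real.mul_rpow (by positivity) hm0.le, ← Real.rpow_mul hC.le, ← Real.rpow_mul hm0.le,
    div_eq_mul_inv, mul_inv, ← Real.rpow_neg hC.le, ← Real.rpow_neg hm0.le]
  have hl' : 1 - lam ≠ 0 := by linarith
  have e1 : -((lam - 1) / γ * (1 / (1 - lam))) = 1 / γ := by
    rw [show lam - 1 = -(1 - lam) by ring]; field_simp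
  have e2 : -(1 / (1 - lam)) = γ / (lam - 1) * (1 / γ) := by
    rw [show 1 - lam = -(lam - 1) by ring]; field_simp
  rw [e1, e2]
  ring

/-- Algebra resting on `s - 1 = (lam - 1) / γ` and `q * s + s - 1 = (q * β + lam - 1) / γ`. -/
theorem optConst_of_ne_one {Q : ℝ≥0∞} (hQ0 : Q ≠ 0) (hQt : Q ≠ ∞) (h₁ : lam - 1 < β)
    (h₂ : 1 - lam < Q.toReal * β) {s γ : ℝ} (hγ : γ = 1 + β - lam) (hs : s = β / γ)
    (h : lam ≠ 1) : (1 / (Q.toReal * s + s - 1)) ^ (1 / (Q.toReal * γ)) /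
      (gaussConst Q.toReal s ^ (s - 1) * (Q.toReal * s / (Q.toReal * s + s - 1))) ^
        (1 / (1 - lam)) = optConst Q β lam := by
  have hq : 0 < Q.toReal := ENNReal.toReal_pos hQ0 hQt
  rw [optConst, if_neg hQ0, if_neg hQt, if_neg h, triConst, ← hγ, ← hs]
  set q := Q.toReal
  have hγ0 : 0 < γ := by linarith
  have hβ : 0 < β := by nlinarith
  have hs1 : s - 1 = (lam - 1) / γ := by
    rw [hs, div_sub_one hγ0.ne', hγ]; congr 1; ring
  have hE : 0 < q * β + lam - 1 := by linarith
  have hm : q * s + s - 1 = (q * β + lam - 1) / γ := by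
    rw [add_sub_assoc, hs1, hs]; field_simp; ring
  have ha : 0 < gaussConst q s := gaussConst_pos hq (by
    have : 0 < (q * β + lam - 1) / γ := by positivity
    linarith)
  have hl : lam - 1 ≠ 0 := sub_ne_zero.2 h
  have hl' : 1 - lam ≠ 0 := sub_ne_zero.2 (Ne.symm h)
  have hqs : q * s / (q * s + s - 1) = (q * β) / (q * β + lam - 1) := by
    rw [hm, hs]; field_simp
  have e1 : (s - 1) * (1 / (1 - lam)) = -(1 / γ) := by
    rw [hs1, show lam - 1 = -(1 - lam) by ring]; field_simp
  have e2 : 1 / (1 - lam) = -(1 / (lam - 1)) := by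
    rw [show 1 - lam = -(lam - 1) by ring, one_div_neg_eq_neg_one_div]
  rw [hqs, hm, one_div_div, Real.mul_rpow (by positivity) (by positivity), ← Real.rpow_mul ha.le,
    e1, e2, Real.rpow_neg ha.le, Real.rpow_neg (by positivity), Real.div_rpow hγ0.le hE.le,
    Real.div_rpow (by positivity) hE.le, Real.rpow_add hE]
  have p1 := Real.rpow_pos_of_pos hE (1 / (lam - 1))
  have p2 := Real.rpow_pos_of_pos hE (1 / (q * γ))
  have p3 := Real.rpow_pos_of_pos (mul_pos hq hβ) (1 / (lam - 1))
  have p4 := Real.rpow_pos_of_pos ha (1 / γ)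
  field_simp

theorem optConst_of_eq_one {Q : ℝ≥0∞} (hQ0 : Q ≠ 0) (hQt : Q ≠ ∞) (hβ : 0 < β) :
    (1 / Q.toReal) ^ (1 / (Q.toReal * β)) /
      Real.exp ((1 / Q.toReal - Real.log (gaussConst Q.toReal 1)) / β) = optConst Q β 1 := by
  have hq : 0 < Q.toReal := ENNReal.toReal_pos hQ0 hQt
  rw [optConst, if_neg hQ0, if_neg hQt, if_pos rfl, gaussConst, if_pos rfl]
  set q := Q.toReal
  have hG := Real.Gamma_pos_of_pos (one_div_pos.2 hq)
  have ha : 0 < q / (2 * Real.Gamma (1 / q)) := by positivity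
  have e1 : Real.exp ((1 / q - Real.log (q / (2 * Real.Gamma (1 / q)))) / β) =
      (Real.exp (1 / q) * (q / (2 * Real.Gamma (1 / q)))⁻¹) ^ (1 / β) := by
    rw [div_eq_mul_one_div, Real.exp_mul, Real.exp_sub, Real.exp_log ha, div_eq_mul_inv]
  have e2 : (1 / q) ^ (1 / (q * β)) = (q ^ (-(1 / q))) ^ (1 / β) := by
    rw [← Real.rpow_mul hq.le, one_div q, Real.inv_rpow hq.le, ← Real.rpow_neg hq.le]
    congr 1
    field_simp
  rw [e1, e2, ← Real.div_rpow (by positivity) (by positivity)]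
  congr 1
  rw [sub_eq_add_neg, Real.rpow_add hq, Real.rpow_one, Real.exp_neg]
  have := Real.exp_pos (1 / q)
  have := Real.rpow_pos_of_pos hq (-(1 / q))
  field_simp

end constants

/-! ### Recognizing escort densities -/

section escort

variable {γ a : ℝ} {v g ρ G : ℝ → ℝ}

theorem IsProfile.escortMap_eq_integral (hv : IsProfile γ v) {z : ℝ} (hz : z ∈ core v) :
    escortMap γ v z = ∫ t in (0 : ℝ)..z, v t ^ ((γ - 1) / γ) := by
  rw [intervalIntegral.integral_of_le hz.1.le, integral_eq_lintegral_of_nonneg_ae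
    (Filter.Eventually.of_forall fun t => Real.rpow_nonneg (hv.nonneg t) _)
    (hv.measurable.pow_const _).aestronglyMeasurable, escortMap, cumul]
  congr 1
  refine setLIntegral_congr_fun measurableSet_Ioc fun t ht => ?_
  rw [ENNReal.ofReal_rpow_of_pos (hv.mem_core_of_le hz ht.1 ht.2).2]

/-- A criterion for a dilation of `ρ` to be the escort density of the profile `v = a * g`. -/
theorem IsProfile.isEscort_scale (hv : IsProfile γ v) (ha : 0 < a)
    (hvg : ∀ y ∈ core v, v y = a * g y)
    (hG : ∀ z ∈ core v, G z = ∫ t in (0 : ℝ)..z, g t ^ ((γ - 1) / γ))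
    (hρ : ∀ z ∈ core v, ρ (G z) = a * g z ^ (1 / γ)) (heven : ∀ x, ρ (-x) = ρ x)
    (hsupp : ∀ x, 0 < x → ρ x ≠ 0 → x ∈ G '' core v) (h0 : 0 ≤ ρ 0) (hγ : γ ≠ 0) :
    IsEscort γ v (scale (a ^ ((γ - 1) / γ))⁻¹ ρ) := by
  have hk := Real.rpow_pos_of_pos ha ((γ - 1) / γ)
  set k := a ^ ((γ - 1) / γ) with hkdef
  have hg : ∀ y ∈ core v, 0 < g y := fun y hy => by
    have h := hy.2
    rw [hvg y hy] at h
    exact (mul_pos_iff_of_pos_left ha).1 h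
  -- The constant `a` of the profile enters the escort weight as the factor `k`, which is why a
  -- dilation of `ρ` appears.
  have hY : ∀ z ∈ core v, escortMap γ v z = k * G z := by
    intro z hz
    rw [hv.escortMap_eq_integral hz, hG z hz, intervalIntegral.integral_of_le hz.1.le,
      intervalIntegral.integral_of_le hz.1.le, ← integral_const_mul]
    refine setIntegral_congr_fun measurableSet_Ioc fun t ht => ?_
    have htc := hv.mem_core_of_le hz ht.1 ht.2
    rw [hvg t htc, Real.mul_rpow ha.le (hg t htc).le]
  have hpos : ∀ z ∈ core v, scale k⁻¹ ρ (escortMap γ v z) = v z ^ (1 / γ) := by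
    intro z hz
    rw [scale, hY z hz, inv_mul_cancel_left₀ hk.ne', hρ z hz, hvg z hz,
      Real.mul_rpow ha.le (hg z hz).le, ← mul_assoc, hkdef, ← Real.rpow_neg ha.le]
    congr 1
    conv_lhs => rw [← Real.rpow_one a, ← Real.rpow_mul ha.le, one_mul, ← Real.rpow_add ha]
    congr 1
    field_simp
    ring
  have hev : ∀ x, scale k⁻¹ ρ (-x) = scale k⁻¹ ρ x := fun x => by
    rw [scale, scale, mul_neg, heven]
  refine ⟨hpos, fun z hz => by rw [hev, hpos z hz], fun x hx hx0 => ?_, ?_⟩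
  · have h1 : scale k⁻¹ ρ |x| ≠ 0 := by
      rcases abs_choice x with h | h
      · rwa [h]
      · rwa [h, hev]
    obtain ⟨z, hz, hzx⟩ := hsupp (k⁻¹ * |x|) (mul_pos (inv_pos.2 hk) (abs_pos.2 hx))
      (right_ne_zero_of_mul h1)
    exact ⟨z, hz, by rw [hY z hz, hzx, mul_inv_cancel_left₀ hk.ne']⟩
  · rw [scale, mul_zero]
    exact mul_nonneg (inv_pos.2 hk).le h0

theorem IsProfile.isEscort_of_comp (hv : IsProfile γ v)
    (hG : ∀ z ∈ core v, G z = ∫ t in (0 : ℝ)..z, v t ^ ((γ - 1) / γ))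
    (hρ : ∀ z ∈ core v, ρ (G z) = v z ^ (1 / γ)) (heven : ∀ x, ρ (-x) = ρ x)
    (hsupp : ∀ x, 0 < x → ρ x ≠ 0 → x ∈ G '' core v) (h0 : 0 ≤ ρ 0) (hγ : γ ≠ 0) :
    IsEscort γ v ρ := by
  have h := hv.isEscort_scale one_pos (g := v) (by simp) hG (by simpa using hρ) heven hsupp h0 hγ
  rwa [Real.one_rpow, inv_one, scale_one] at h

/-- An even profile is its own escort density if its escort weight is one. -/
theorem IsProfile.isEscort_self (hv : IsProfile γ v) (hγ : γ ≠ 0)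
    (h1 : ∀ y ∈ core v, v y ^ ((γ - 1) / γ) = 1) (heven : ∀ x, v (-x) = v x) :
    IsEscort γ v v := by
  refine hv.isEscort_of_comp (G := id) (fun z hz => ?_) (fun z hz => ?_) heven (fun x hx hx0 => ?_)
    (hv.nonneg 0) hγ
  · rw [intervalIntegral.integral_of_le hz.1.le]
    have h2 : ∫ t in Ioc 0 z, v t ^ ((γ - 1) / γ) = ∫ t in Ioc 0 z, (1 : ℝ) :=
      setIntegral_congr_fun measurableSet_Ioc fun t ht => h1 t (hv.mem_core_of_le hz ht.1 ht.2)
    rw [h2]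
    simp [hz.1.le]
  · have h2 : (1 : ℝ) = (γ - 1) / γ + 1 / γ := by field_simp; ring
    conv_lhs => rw [id, ← Real.rpow_one (v z), h2, Real.rpow_add hz.2, h1 z hz, one_mul]
  · exact ⟨x, ⟨hx, lt_of_le_of_ne (hv.nonneg x) hx0.symm⟩, rfl⟩

end escort

/-- The primitive of an even function is odd. -/
theorem integral_neg_of_even {h : ℝ → ℝ} (heven : ∀ t, h (-t) = h t) (y : ℝ) :
    ∫ t in (0 : ℝ)..-y, h t = -∫ t in (0 : ℝ)..y, h t := by
  have h1 := intervalIntegral.integral_comp_neg (a := 0) (b := y) h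
  simp only [heven, neg_zero] at h1
  rw [h1, intervalIntegral.integral_symm]

/-- An odd function positive on the positive side cannot mix the two sides, so injectivity there is
enough. -/
theorem injOn_of_odd {Φ : ℝ → ℝ} {S : Set ℝ} (hodd : ∀ x, Φ (-x) = -Φ x)
    (hS : ∀ x ∈ S, -x ∈ S) (hpos : ∀ x ∈ S, 0 < x → 0 < Φ x) (hinj : InjOn Φ (S ∩ Ioi 0)) :
    InjOn Φ S := by
  have h0 : Φ 0 = 0 := by
    have := hodd 0
    rw [neg_zero] at this
    linarith
  have hneg : ∀ x ∈ S, x < 0 → Φ x < 0 := fun x hx hx0 => by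
    have := hpos (-x) (hS x hx) (neg_pos.2 hx0)
    rw [hodd] at this
    linarith
  intro x hx y hy hxy
  rcases lt_trichotomy x 0 with h | h | h <;> rcases lt_trichotomy y 0 with h' | h' | h'
  · refine neg_injective (hinj ⟨hS x hx, neg_pos.2 h⟩ ⟨hS y hy, neg_pos.2 h'⟩ ?_)
    rw [hodd, hodd, hxy]
  · rw [h', h0] at hxy; exact absurd hxy (hneg x hx h).ne
  · exact absurd hxy ((hneg x hx h).trans (hpos y hy h')).ne
  · rw [h, h0] at hxy; exact absurd hxy (hneg y hy h').ne'
  · rw [h, h']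
  · rw [h, h0] at hxy; exact absurd hxy (hpos y hy h').ne
  · exact absurd hxy ((hneg y hy h').trans (hpos x hx h)).ne'
  · rw [h', h0] at hxy; exact absurd hxy (hpos x hx h).ne'
  · exact hinj ⟨hx, h⟩ ⟨hy, h'⟩ hxy

theorem stretchedGaussian_neg (q s x : ℝ) : stretchedGaussian q s (-x) = stretchedGaussian q s x := by
  rw [stretchedGaussian, stretchedGaussian, abs_neg]

theorem isEscort_stretchedGaussian {q s : ℝ} (hq : 0 < q) (hs : 1 - s < q * s) :
    IsEscort 1 (stretchedGaussian q s) (stretchedGaussian q s) :=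
  (isProfile_stretchedGaussian 1 hq hs).isEscort_self one_ne_zero (by simp)
    (stretchedGaussian_neg q s)

theorem isEscort_uniform {γ : ℝ} (hγ : γ ≠ 0) :
    IsEscort γ ((Ioo (-(1 / 2)) (1 / 2)).indicator (1 : ℝ → ℝ))
      ((Ioo (-(1 / 2)) (1 / 2)).indicator (1 : ℝ → ℝ)) := by
  refine (isProfile_uniform γ).isEscort_self hγ (fun y hy => ?_) fun x => ?_
  · rw [core_uniform] at hy
    rw [uniform_eq, abs_of_pos hy.1, if_pos hy.2, Real.one_rpow]
  · rw [uniform_eq, uniform_eq, abs_neg]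

/-! ### The extremal density of order zero -/

section diffEscort

variable {s γ : ℝ}

/-- On `(0, 1)` the integral defining the transform is the escort map itself. Being odd, it is
injective on `(-1, 1)`, so the chosen inverse is a genuine one. -/
theorem isEscort_diffEscort_logDensity (hs : 1 < s) (hγ : 0 < γ) :
    IsEscort γ (logDensity s) (diffEscort (1 / γ) (Ioo (-1) 1) (logDensity s)) := by
  have hv := isProfile_logDensity γ hs
  have hcore := core_logDensity hs
  set Φ : ℝ → ℝ := fun x => ∫ t in (0 : ℝ)..x, logDensity s t ^ (1 - 1 / γ) with hΦ
  have hp : 1 - 1 / γ = (γ - 1) / γ := by field_simp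
  have heven : ∀ t, logDensity s (-t) = logDensity s t := fun t => by
    rw [logDensity_eq, logDensity_eq, abs_neg]
  have hodd : ∀ x, Φ (-x) = -Φ x := integral_neg_of_even fun t => by rw [heven]
  have h00 : Φ 0 = 0 := intervalIntegral.integral_same
  have hY : ∀ z ∈ core (logDensity s), Φ z = escortMap γ (logDensity s) z := fun z hz => by
    rw [hv.escortMap_eq_integral hz, hΦ, ← hp]
  have hmono : StrictMonoOn Φ (core (logDensity s)) :=
    (hv.strictMonoOn_escortMap).congr fun z hz => (hY z hz).symm
  have hpos : ∀ z ∈ core (logDensity s), 0 < Φ z := fun z hz => by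
    rw [hY z hz]; exact hv.escortMap_pos hz
  have hsymm : ∀ x ∈ Ioo (-1 : ℝ) 1, -x ∈ Ioo (-1 : ℝ) 1 := fun x hx =>
    ⟨by linarith [hx.2], by linarith [hx.1]⟩
  have hmem : ∀ x ∈ Ioo (-1 : ℝ) 1, 0 < x → x ∈ core (logDensity s) := fun x hx hx0 => by
    rw [hcore]; exact ⟨hx0, hx.2⟩
  have hinj : InjOn Φ (Ioo (-1) 1) := injOn_of_odd hodd hsymm
    (fun x hx hx0 => hpos x (hmem x hx hx0))
    (hmono.injOn.mono fun x hx => hmem x hx.1 hx.2)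
  have hval : ∀ x ∈ Ioo (-1 : ℝ) 1, diffEscort (1 / γ) (Ioo (-1) 1) (logDensity s) (Φ x) =
      logDensity s x ^ (1 / γ) := fun x hx => by
    rw [diffEscort, if_pos (mem_image_of_mem Φ hx)]
    congr 2
    exact hinj.leftInvOn_invFunOn hx
  refine hv.isEscort_of_comp (G := Φ) (fun z hz => by rw [hΦ, ← hp])
    (fun z hz => hval z ?_) (fun x => ?_) (fun x hx hx0 => ?_) ?_ hγ.ne'
  · rw [hcore] at hz
    exact ⟨by linarith [hz.1], hz.2⟩
  · by_cases hx : x ∈ Φ '' Ioo (-1) 1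
    · obtain ⟨z, hz, rfl⟩ := hx
      rw [← hodd, hval z hz, hval _ (hsymm z hz), heven]
    · have hx' : -x ∉ Φ '' Ioo (-1) 1 := by
        rintro ⟨z, hz, hzx⟩
        exact hx ⟨-z, hsymm z hz, by rw [hodd, hzx, neg_neg]⟩
      rw [diffEscort, diffEscort, if_neg hx, if_neg hx']
  · have hx' : x ∈ Φ '' Ioo (-1) 1 := by
      by_contra h
      exact hx0 (if_neg h)
    obtain ⟨z, hz, rfl⟩ := hx'
    refine ⟨z, hmem z hz ?_, rfl⟩
    by_contra h
    rcases (not_lt.1 h).lt_or_eq with h1 | h1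
    · have := hpos (-z) (hmem _ (hsymm z hz) (neg_pos.2 h1))
      rw [hodd] at this
      linarith
    · rw [h1, h00] at hx
      exact lt_irrefl _ hx
  -- The value at the origin depends on the default value of the logarithm at zero; only its sign
  -- matters.
  · rw [diffEscort]
    split_ifs
    · exact Real.rpow_nonneg (hv.nonneg _) _
    · exact le_rfl

end diffEscort

/-! ### Generalized trigonometric densities -/

section inverse

variable {h : ℝ → ℝ} {I : Set ℝ}

theorem hasStrictDerivAt_primitive (hI : IsOpen I) (hIc : I.OrdConnected) (h0 : (0 : ℝ) ∈ I)
    (hc : ContinuousOn h I) {u : ℝ} (hu : u ∈ I) :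
    HasStrictDerivAt (fun y => ∫ t in (0 : ℝ)..y, h t) (h u) u :=
  intervalIntegral.integral_hasStrictDerivAt_right
    ((hc.mono (hIc.uIcc_subset h0 hu)).intervalIntegrable)
    (hc.stronglyMeasurableAtFilter hI u hu) (hc.continuousAt (hI.mem_nhds hu))

theorem strictMonoOn_primitive (hI : IsOpen I) (hIc : I.OrdConnected) (h0 : (0 : ℝ) ∈ I)
    (hc : ContinuousOn h I) (hpos : ∀ t ∈ I, 0 < h t) :
    StrictMonoOn (fun y => ∫ t in (0 : ℝ)..y, h t) I := by
  refine strictMonoOn_of_deriv_pos hIc.convex (fun x hx =>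
    (hasStrictDerivAt_primitive hI hIc h0 hc hx).hasDerivAt.continuousAt.continuousWithinAt)
    fun x hx => ?_
  rw [(hasStrictDerivAt_primitive hI hIc h0 hc (interior_subset hx)).hasDerivAt.deriv]
  exact hpos x (interior_subset hx)

/-- The derivative of the inverse function of a primitive. -/
theorem deriv_invFunOn_primitive (hI : IsOpen I) (hIc : I.OrdConnected) (h0 : (0 : ℝ) ∈ I)
    (hc : ContinuousOn h I) (hpos : ∀ t ∈ I, 0 < h t) {u : ℝ} (hu : u ∈ I) :
    deriv (Function.invFunOn (fun y => ∫ t in (0 : ℝ)..y, h t) I) (∫ t in (0 : ℝ)..u, h t) =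
      (h u)⁻¹ :=
  ((hasStrictDerivAt_primitive hI hIc h0 hc hu).to_local_left_inverse (hpos u hu).ne'
    (Filter.eventually_of_mem (hI.mem_nhds hu) fun _ hx =>
      (strictMonoOn_primitive hI hIc h0 hc hpos).injOn.leftInvOn_invFunOn hx)).hasDerivAt.deriv

open Classical in
/-- Densities given by a power of the derivative of the inverse of a primitive. -/
theorem IsProfile.isEscort_primitive {γ a k e : ℝ} {v g : ℝ → ℝ} (hv : IsProfile γ v)
    (ha : 0 < a) (hγ : γ ≠ 0) (hk : 0 < k) (hvg : ∀ y ∈ core v, v y = a * g y)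
    (hI : IsOpen I) (hIc : I.OrdConnected) (h0 : (0 : ℝ) ∈ I) (hsymm : ∀ x ∈ I, -x ∈ I)
    (hc : ContinuousOn h I) (hpos : ∀ t ∈ I, 0 < h t) (heven : ∀ t, h (-t) = h t)
    (hcore : ∀ y, y ∈ core v ↔ 0 < y ∧ k * y ∈ I)
    (hgh : ∀ y ∈ core v, h (k * y) = g y ^ ((γ - 1) / γ))
    (hge : ∀ y ∈ core v, (h (k * y))⁻¹ ^ e = g y ^ (1 / γ)) :
    IsEscort γ v (scale (a ^ ((γ - 1) / γ))⁻¹ fun y =>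
      if k * y ∈ (fun y => ∫ t in (0 : ℝ)..y, h t) '' I then
        a * deriv (Function.invFunOn (fun y => ∫ t in (0 : ℝ)..y, h t) I) (k * y) ^ e
      else 0) := by
  set F : ℝ → ℝ := fun y => ∫ t in (0 : ℝ)..y, h t with hF
  have hodd : ∀ x, F (-x) = -F x := integral_neg_of_even heven
  have hF0 : F 0 = 0 := intervalIntegral.integral_same
  have hmono := strictMonoOn_primitive hI hIc h0 hc hpos
  have hderiv : ∀ u ∈ I, deriv (Function.invFunOn F I) (F u) = (h u)⁻¹ := fun u hu =>
    deriv_invFunOn_primitive hI hIc h0 hc hpos hu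
  have hFG : ∀ z ∈ core v, k * (F (k * z) / k) = F (k * z) := fun z _ => by field_simp
  refine hv.isEscort_scale (G := fun z => F (k * z) / k) ha hvg (fun z hz => ?_) (fun z hz => ?_)
    (fun x => ?_) (fun x hx hx0 => ?_) ?_ hγ
  · have h1 := intervalIntegral.integral_comp_mul_left (a := 0) (b := z) h hk.ne'
    rw [mul_zero, smul_eq_mul] at h1
    rw [div_eq_inv_mul, hF, ← h1, intervalIntegral.integral_of_le hz.1.le,
      intervalIntegral.integral_of_le hz.1.le]
    exact setIntegral_congr_fun measurableSet_Ioc fun t ht =>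
      hgh t (hv.mem_core_of_le hz ht.1 ht.2)
  · have hz' := ((hcore z).1 hz).2
    rw [hFG z hz, if_pos (mem_image_of_mem F hz'), hderiv _ hz', hge z hz]
  · rw [mul_neg]
    by_cases hx : k * x ∈ F '' I
    · obtain ⟨u, hu, hux⟩ := hx
      rw [← hux, ← hodd, if_pos (mem_image_of_mem F hu), if_pos (mem_image_of_mem F (hsymm u hu)),
        hderiv u hu, hderiv _ (hsymm u hu), heven]
    · have hx' : -(k * x) ∉ F '' I := by
        rintro ⟨u, hu, hux⟩
        exact hx ⟨-u, hsymm u hu, by rw [hodd, hux, neg_neg]⟩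
      rw [if_neg hx, if_neg hx']
  · have hx' : k * x ∈ F '' I := by
      by_contra hn
      exact hx0 (if_neg hn)
    obtain ⟨u, hu, hux⟩ := hx'
    -- The primitive vanishes at the origin and is strictly increasing, so a positive value comes
    -- from a positive point.
    have hu0 : 0 < u := by
      rw [← hmono.lt_iff_lt h0 hu]
      change F 0 < F u
      rw [hF0, hux]
      positivity
    have huk : k * (u / k) = u := by field_simp
    refine ⟨u / k, (hcore _).2 ⟨by positivity, by rwa [huk]⟩, ?_⟩
    dsimp only
    rw [huk, hux]
    field_simp
  · rw [mul_zero, if_pos ⟨0, h0, hF0⟩]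
    have h1 := hderiv 0 h0
    rw [hF0] at h1
    rw [h1]
    have := hpos 0 h0
    positivity

end inverse

section trig

variable {q s β lam γ : ℝ}

/-- The scale is chosen so that `1 ± |triScale q β lam * y| ^ q` is the base `1 + (1 - s) |y| ^ q`
of the stretched Gaussian. -/
theorem triScale_mul_rpow (hq : 0 < q) (hγ0 : 0 < γ) (hγ : γ = 1 + β - lam) (hs : s = β / γ)
    (y : ℝ) : |triScale q β lam * y| ^ q = |1 - s| * |y| ^ q := by
  have h1 : (lam - 1) / (1 + β - lam) = -(1 - s) := by
    rw [hs, ← hγ]; field_simp; linarith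
  rw [triScale, h1, abs_neg, abs_mul, abs_of_nonneg (by positivity), Real.mul_rpow (by positivity)
    (abs_nonneg y), ← Real.rpow_mul (abs_nonneg _), one_div_mul_cancel hq.ne', Real.rpow_one]

theorem triScale_pos (hγ0 : 0 < γ) (hγ : γ = 1 + β - lam) (h : lam ≠ 1) :
    0 < triScale q β lam := by
  rw [triScale, ← hγ]
  exact Real.rpow_pos_of_pos (abs_pos.2 (div_ne_zero (sub_ne_zero.2 h) hγ0.ne')) _

/-- In the rescaled variable the escort weight is the base to the power `(β - lam) / (lam - 1)`, the
integrand of `arsinhGen` for `lam < 1` and of `arcsinGen` for `lam > 1`. Hence the escort map is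
that function up to scale; the derivative of its inverse is the reciprocal weight, whose power `1 /
(lam - β)` is `g ^ (1 / γ)`. -/
theorem isEscort_trigDensity (hq : 0 < q) (hγ0 : 0 < γ) (hγ : γ = 1 + β - lam) (hs : s = β / γ)
    (hsq : 1 - s < q * s) (h1 : lam ≠ 1) (hβ : β ≠ lam) :
    IsEscort γ (stretchedGaussian q s)
      (scale (gaussConst q s ^ ((γ - 1) / γ))⁻¹ (trigDensity q β lam)) := by
  have hv := isProfile_stretchedGaussian γ hq hsq
  have ha := gaussConst_pos hq hsq
  have hk := triScale_pos (q := q) hγ0 hγ h1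
  have hkq := triScale_mul_rpow hq hγ0 hγ hs
  have hcore := core_stretchedGaussian hq hsq
  have htc : triConst q β lam = gaussConst q s := by rw [triConst, ← hγ, ← hs]
  have hs1 : s - 1 = (lam - 1) / γ := by
    rw [hs]; field_simp; linarith
  have hl : lam - 1 ≠ 0 := sub_ne_zero.2 h1
  have hl' : 1 - lam ≠ 0 := sub_ne_zero.2 h1.symm
  have hb : lam - β ≠ 0 := sub_ne_zero.2 hβ.symm
  have hb' : β - lam ≠ 0 := sub_ne_zero.2 hβ
  have hsne : s ≠ 1 := fun h => by
    rw [h, sub_self, eq_comm, div_eq_zero_iff] at hs1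
    exact hs1.elim hl hγ0.ne'
  have hγ1 : γ - 1 = β - lam := by linarith
  have e0 : 1 / (s - 1) * (1 / γ) = 1 / (lam - 1) := by rw [hs1]; field_simp
  have hvg : ∀ y ∈ core (stretchedGaussian q s), stretchedGaussian q s y =
      gaussConst q s * (1 + (1 - s) * |y| ^ q) ^ (1 / (s - 1)) := fun y hy => by
    rw [hcore] at hy
    rw [stretchedGaussian_of_ne hsne, max_eq_right hy.2.le]
  have hbase : ∀ y ∈ core (stretchedGaussian q s), 0 < 1 + (1 - s) * |y| ^ q := fun y hy => by
    rw [hcore] at hy; exact hy.2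
  rcases lt_or_gt_of_ne h1 with hlt | hgt
  · have hs_lt : 0 < 1 - s := by
      have : s - 1 < 0 := by rw [hs1]; exact div_neg_of_neg_of_pos (by linarith) hγ0
      linarith
    have hpos : ∀ t : ℝ, 0 < 1 + |t| ^ q := fun t => by positivity
    have hbk : ∀ y, 1 + |triScale q β lam * y| ^ q = 1 + (1 - s) * |y| ^ q := fun y => by
      rw [hkq, abs_of_pos hs_lt]
    have h := hv.isEscort_primitive (h := fun t => (1 + |t| ^ q) ^ (-(1 / ((1 - lam) / (β - lam)))))
      (I := univ) (e := 1 / (lam - β)) ha hγ0.ne' hk hvg isOpen_univ ordConnected_univ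
      (mem_univ _) (fun _ _ => mem_univ _)
      ((continuous_const.add (continuous_abs_rpow hq)).rpow_const fun t =>
        Or.inl (hpos t).ne').continuousOn
      (fun t _ => Real.rpow_pos_of_pos (hpos t) _) (fun t => by rw [abs_neg])
      (fun y => ?_) (fun y hy => ?_) (fun y hy => ?_)
    · convert h using 2
      funext y
      rw [trigDensity, if_pos hlt, htc, ← image_univ]
      rfl
    · rw [hcore]
      refine and_congr_right fun _ => iff_of_true ?_ (mem_univ _)
      positivity
    · rw [hbk, ← Real.rpow_mul (hbase y hy).le]
      congr 1
      rw [hs1, hγ1]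
      field_simp
      ring
    · rw [hbk, ← Real.rpow_neg (hbase y hy).le, neg_neg, ← Real.rpow_mul (hbase y hy).le,
        ← Real.rpow_mul (hbase y hy).le, e0]
      congr 1
      rw [one_div_div, show β - lam = -(lam - β) by ring, show 1 - lam = -(lam - 1) by ring]
      field_simp
  · have hs_gt : 0 < s - 1 := by rw [hs1]; exact div_pos (by linarith) hγ0
    have hpos : ∀ t ∈ Ioo (-1 : ℝ) 1, 0 < 1 - |t| ^ q := fun t ht => by
      have := Real.rpow_lt_one (abs_nonneg t) (abs_lt.2 ht) hq
      linarith
    have hbk : ∀ y, 1 - |triScale q β lam * y| ^ q = 1 + (1 - s) * |y| ^ q := fun y => by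
      rw [hkq, abs_sub_comm, abs_of_pos hs_gt]; ring
    have h := hv.isEscort_primitive (h := fun t => (1 - |t| ^ q) ^ (-(1 / ((lam - 1) / (lam - β)))))
      (I := Ioo (-1) 1) (e := 1 / (lam - β)) ha hγ0.ne' hk hvg isOpen_Ioo ordConnected_Ioo
      (by simp) (fun x hx => ⟨by linarith [hx.2], by linarith [hx.1]⟩)
      ((continuous_const.sub (continuous_abs_rpow hq)).continuousOn.rpow_const fun t ht =>
        Or.inl (hpos t ht).ne')
      (fun t ht => Real.rpow_pos_of_pos (hpos t ht) _) (fun t => by rw [abs_neg])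
      (fun y => ?_) (fun y hy => ?_) (fun y hy => ?_)
    · convert h using 2
      funext y
      rw [trigDensity, if_neg (not_lt.2 hgt.le), htc]
      rfl
    · rw [hcore]
      refine and_congr_right fun _ => ?_
      rw [← hbk, mem_Ioo, ← abs_lt, sub_pos]
      constructor
      · intro h2
        by_contra h3
        exact absurd (Real.one_le_rpow (not_lt.1 h3) hq.le) (not_le.2 h2)
      · intro h2
        exact Real.rpow_lt_one (abs_nonneg _) h2 hq
    · rw [hbk, ← Real.rpow_mul (hbase y hy).le]
      congr 1
      rw [hs1, hγ1]
      field_simp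
      ring
    · rw [hbk, ← Real.rpow_neg (hbase y hy).le, neg_neg, ← Real.rpow_mul (hbase y hy).le,
        ← Real.rpow_mul (hbase y hy).le, e0]
      congr 1
      field_simp

end trig

/-! ### The extremal density for `lam = 1` -/

section gamma

variable {q β : ℝ}

theorem incGamma_eq (ε : ℝ) (q : ℝ) {w : ℝ} (hw : 0 ≤ w) :
    incGamma ε (1 / q) w = (∫⁻ t in Ioc 0 w, ENNReal.ofReal (t ^ (1 / q - 1)) *
      ENNReal.ofReal (Real.exp (-(ε * t)))).toReal := by
  rw [incGamma, intervalIntegral.integral_of_le hw, integral_eq_lintegral_of_nonneg_ae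
    ((ae_restrict_iff' measurableSet_Ioc).2 (Filter.Eventually.of_forall fun t ht =>
      mul_nonneg (Real.rpow_nonneg ht.1.le _) (Real.exp_pos _).le))
    (by fun_prop)]
  congr 1
  refine setLIntegral_congr_fun measurableSet_Ioc fun t ht => ?_
  rw [ENNReal.ofReal_mul (Real.rpow_nonneg ht.1.le _)]

/-- The substitution `t = c * y ^ q`, truncated at the upper end by an indicator, exhibits the
incomplete Gamma function as a primitive of a stretched exponential, which is the shape of the
escort weight. -/
theorem incGamma_mul_rpow (hq : 0 < q) (ε : ℝ) {c z : ℝ} (hc : 0 < c) (hz : 0 ≤ z) :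
    incGamma ε (1 / q) (c * z ^ q) =
      q * c ^ (1 / q) * ∫ y in (0 : ℝ)..z, Real.exp (-(ε * (c * |y| ^ q))) := by
  have hw : 0 ≤ c * z ^ q := by positivity
  have h1 := lintegral_rpow_comp_rpow hq hc 0
    ((Iic (c * z ^ q)).indicator fun t => ENNReal.ofReal (Real.exp (-(ε * t))))
  have h2 : ∫⁻ t in Ioi 0, ENNReal.ofReal (t ^ ((0 + 1) / q - 1)) *
      (Iic (c * z ^ q)).indicator (fun t => ENNReal.ofReal (Real.exp (-(ε * t)))) t =
      ∫⁻ t in Ioc 0 (c * z ^ q), ENNReal.ofReal (t ^ (1 / q - 1)) *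
      ENNReal.ofReal (Real.exp (-(ε * t))) := by
    rw [zero_add, ← lintegral_indicator measurableSet_Ioi, ← lintegral_indicator measurableSet_Ioc]
    refine lintegral_congr fun t => ?_
    simp only [indicator_apply, mem_Ioi, mem_Ioc, mem_Iic]
    by_cases ht : 0 < t <;> by_cases ht' : t ≤ c * z ^ q <;> simp [ht, ht']
  have h3 : ∫⁻ y in Ioi 0, ENNReal.ofReal (y ^ (0 : ℝ)) *
      (Iic (c * z ^ q)).indicator (fun t => ENNReal.ofReal (Real.exp (-(ε * t)))) (c * y ^ q) =
      ∫⁻ y in Ioc 0 z, ENNReal.ofReal (Real.exp (-(ε * (c * |y| ^ q)))) := by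
    rw [← lintegral_indicator measurableSet_Ioi, ← lintegral_indicator measurableSet_Ioc]
    refine lintegral_congr fun y => ?_
    simp only [indicator_apply, mem_Ioi, mem_Ioc, mem_Iic]
    by_cases hy : 0 < y
    · have : c * y ^ q ≤ c * z ^ q ↔ y ≤ z := by
        rw [mul_le_mul_iff_right₀ hc, Real.rpow_le_rpow_iff hy.le hz hq]
      simp [hy, this, abs_of_pos hy]
    · simp [hy]
  have h4 : ∫ y in (0 : ℝ)..z, Real.exp (-(ε * (c * |y| ^ q))) =
      (∫⁻ y in Ioc 0 z, ENNReal.ofReal (Real.exp (-(ε * (c * |y| ^ q))))).toReal := by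
    have hcont : Continuous fun y : ℝ => Real.exp (-(ε * (c * |y| ^ q))) :=
      Real.continuous_exp.comp (((continuous_abs_rpow hq).const_mul c).const_mul ε).neg
    rw [intervalIntegral.integral_of_le hz, integral_eq_lintegral_of_nonneg_ae
      (Filter.Eventually.of_forall fun t => (Real.exp_pos _).le) hcont.aestronglyMeasurable]
  rw [h2, h3, zero_add] at h1
  have hcq := Real.rpow_pos_of_pos hc (1 / q)
  rw [incGamma_eq ε q hw, h4, h1, ENNReal.toReal_mul, ENNReal.toReal_ofReal (by positivity),
    Real.rpow_neg hc.le]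
  field_simp

/-- For `lam = 1` one has `γ = β`, and the escort weight is the exponential of `-((β - 1) / β) * |y|
^ q`, decaying or growing with the sign of `β - 1`. Its primitive is an incomplete Gamma function at
`c * y ^ q`. -/
theorem isEscort_gammaDensity (hq : 0 < q) (hβ : 0 < β) (h1 : β ≠ 1) :
    IsEscort β (stretchedGaussian q 1)
      (scale (gaussConst q 1 ^ ((β - 1) / β))⁻¹ (gammaDensity q β)) := by
  have hsq : 1 - (1 : ℝ) < q * 1 := by linarith
  have hv := isProfile_stretchedGaussian β hq hsq
  have ha := gaussConst_pos hq hsq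
  have hcore : core (stretchedGaussian q 1) = Ioi 0 := by
    rw [core_stretchedGaussian hq hsq]; ext y; simp
  have htc : triConst q β 1 = gaussConst q 1 := by
    rw [triConst, show 1 + β - 1 = β by ring, div_self hβ.ne']
  have hb1 : β - 1 ≠ 0 := sub_ne_zero.2 h1
  set c := |1 - 1 / β| with hcdef
  have hc : 0 < c := abs_pos.2 (by
    rw [one_sub_div hβ.ne']; exact div_ne_zero hb1 hβ.ne')
  -- Matches the exponent in `gammaDensity` with the power `1 / γ = 1 / β` of the profile.
  have hcβ : c / |β - 1| = 1 / β := by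
    rw [hcdef, one_sub_div hβ.ne', abs_div, abs_of_pos hβ]
    have := abs_pos.2 hb1
    field_simp
  set ε : ℝ := ((SignType.sign (β - 1) : SignType) : ℝ) with hεdef
  have hε : ε * c = (β - 1) / β := by
    rw [hcdef, hεdef, one_sub_div hβ.ne', abs_div, abs_of_pos hβ, ← mul_div_assoc,
      sign_mul_abs]
  have hcont : Continuous fun y : ℝ => Real.exp (-(ε * (c * |y| ^ q))) :=
    Real.continuous_exp.comp (((continuous_abs_rpow hq).const_mul c).const_mul ε).neg
  set G : ℝ → ℝ := fun z => ∫ y in (0 : ℝ)..z, Real.exp (-(ε * (c * |y| ^ q))) with hGdef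
  have hG0 : G 0 = 0 := intervalIntegral.integral_same
  have hmono : StrictMonoOn G univ := strictMonoOn_primitive isOpen_univ ordConnected_univ
    (mem_univ _) hcont.continuousOn fun t _ => Real.exp_pos _
  have hK : 0 < q * c ^ (1 / q) := mul_pos hq (Real.rpow_pos_of_pos hc _)
  have hinc : ∀ z, 0 ≤ z → incGamma ε (1 / q) (c * z ^ q) = q * c ^ (1 / q) * G z := fun z hz =>
    incGamma_mul_rpow hq ε hc hz
  have hroot : ∀ w, 0 ≤ w → ∃ z, 0 ≤ z ∧ w = c * z ^ q := fun w hw =>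
    ⟨(w / c) ^ (1 / q), by positivity, by
      rw [← Real.rpow_mul (by positivity), one_div_mul_cancel hq.ne', Real.rpow_one,
        mul_div_cancel₀ _ hc.ne']⟩
  have hinj : InjOn (incGamma ε (1 / q)) (Ici 0) := by
    intro w hw w' hw' hww
    obtain ⟨z, hz, rfl⟩ := hroot w hw
    obtain ⟨z', hz', rfl⟩ := hroot w' hw'
    rw [hinc z hz, hinc z' hz'] at hww
    rw [hmono.injOn (mem_univ z) (mem_univ z') (mul_left_cancel₀ hK.ne' hww)]
  have hval : ∀ z, 0 ≤ z → gammaDensity q β (G z) =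
      gaussConst q 1 * Real.exp (-(c * z ^ q / |β - 1|)) := fun z hz => by
    have hGz : 0 ≤ G z := by
      rw [← hG0]; exact hmono.monotoneOn (mem_univ _) (mem_univ _) hz
    have hmem : c * z ^ q ∈ Ici (0 : ℝ) := by
      have : 0 ≤ c * z ^ q := by positivity
      exact this
    rw [gammaDensity, abs_of_nonneg hGz, ← hcdef, ← hεdef, ← hinc z hz,
      if_pos (mem_image_of_mem _ hmem), hinj.leftInvOn_invFunOn hmem, htc]
  refine hv.isEscort_scale (G := G) (g := fun y => Real.exp (-(|y| ^ q))) ha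
    (fun y _ => stretchedGaussian_one q y) (fun z hz => ?_) (fun z hz => ?_) (fun x => ?_)
    (fun x hx hx0 => ?_) ?_ hβ.ne'
  · refine intervalIntegral.integral_congr fun y _ => ?_
    rw [← Real.exp_mul, ← hε]
    congr 1
    ring
  · have hz0 : 0 < z := hz.1
    rw [hval z hz0.le, ← Real.exp_mul, mul_div_right_comm, hcβ, abs_of_pos hz0]
    congr 2
    ring
  · rw [gammaDensity, gammaDensity, abs_neg]
  · have hx' : q * |1 - 1 / β| ^ (1 / q) * |x| ∈ incGamma ε (1 / q) '' Ici 0 := by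
      by_contra hn
      exact hx0 (if_neg hn)
    obtain ⟨w, hw, hwx⟩ := hx'
    obtain ⟨z, hz, rfl⟩ := hroot w hw
    rw [hinc z hz, abs_of_pos hx] at hwx
    have hGx : G z = x := mul_left_cancel₀ hK.ne' hwx
    refine ⟨z, ?_, hGx⟩
    rw [hcore]
    refine lt_of_le_of_ne hz fun h => ?_
    rw [← h, hG0] at hGx
    exact hx.ne hGx
  · rw [gammaDensity]
    split_ifs
    · rw [htc]; positivity
    · exact le_rfl

end gamma

/-- All three families have the same profile, the stretched Gaussian of exponent `s`; they differ
only in the closed form of its escort map. -/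
theorem exists_isEscort_minDensity {q : ℝ≥0∞} {β lam s γ : ℝ} (hq0 : q ≠ 0) (hqt : q ≠ ∞)
    (hγ0 : 0 < γ) (hγ : γ = 1 + β - lam) (hs : s = β / γ) (hsq : 1 - s < q.toReal * s) :
    ∃ κ₀ : ℝ, 0 < κ₀ ∧
      IsEscort γ (stretchedGaussian q.toReal s) (scale κ₀⁻¹ (minDensity q β lam)) := by
  have hq : 0 < q.toReal := ENNReal.toReal_pos hq0 hqt
  have ha := Real.rpow_pos_of_pos (gaussConst_pos hq hsq) ((γ - 1) / γ)
  rw [minDensity, if_neg hq0, if_neg hqt]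
  split_ifs with h1 h2
  · have hγ1 : γ = 1 := by rw [hγ, h1]; ring
    have hsl : s = lam := by rw [hs, hγ1, div_one, h1]
    refine ⟨1, one_pos, ?_⟩
    rw [inv_one, scale_one, hγ1, ← hsl]
    exact isEscort_stretchedGaussian hq hsq
  · have hγβ : γ = β := by rw [hγ, h2]; ring
    have hs1 : s = 1 := by rw [hs, hγβ, div_self (hγβ ▸ hγ0.ne')]
    rw [hs1] at ha ⊢
    rw [hγβ] at ha ⊢
    exact ⟨_, ha, isEscort_gammaDensity hq (hγβ ▸ hγ0) fun h => h1 (by rw [h, h2])⟩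
  · exact ⟨_, ha, isEscort_trigDensity hq hγ0 hγ hs hsq h2 h1⟩

end CumulativeMoments

/-! ### The sharp inequality -/

theorem mainTheorem1 (q : ENNReal) (β lam : ℝ) (h₁ : lam - 1 < β)
    (h₂ : (q = ⊤ ∧ 0 < β) ∨ (q ≠ ⊤ ∧ 1 - lam < q.toReal * β)) :
    0 < CumulativeMoments.optConst q β lam ∧
    (CumulativeMoments.IsC1Density (CumulativeMoments.minDensity q β lam) ∧
      CumulativeMoments.entropyPower lam (CumulativeMoments.minDensity q β lam) ≠ 0 ∧
      CumulativeMoments.entropyPower lam (CumulativeMoments.minDensity q β lam) ≠ ⊤ ∧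
      CumulativeMoments.cumulativeDeviation q (1 + β - lam)
          (CumulativeMoments.minDensity q β lam) /
        CumulativeMoments.entropyPower lam (CumulativeMoments.minDensity q β lam) =
          ENNReal.ofReal (CumulativeMoments.optConst q β lam)) ∧
    ∀ f : ℝ → ℝ, CumulativeMoments.IsC1Density f →
      ENNReal.ofReal (CumulativeMoments.optConst q β lam) *
          CumulativeMoments.entropyPower lam f ≤
        CumulativeMoments.cumulativeDeviation q (1 + β - lam) f ∧
      (CumulativeMoments.entropyPower lam f ≠ 0 →
        CumulativeMoments.entropyPower lam f ≠ ⊤ →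
        ENNReal.ofReal (CumulativeMoments.optConst q β lam) ≤
            CumulativeMoments.cumulativeDeviation q (1 + β - lam) f /
              CumulativeMoments.entropyPower lam f ∧
        (CumulativeMoments.cumulativeDeviation q (1 + β - lam) f /
              CumulativeMoments.entropyPower lam f =
            ENNReal.ofReal (CumulativeMoments.optConst q β lam) ↔
          ∃ κ : ℝ, 0 < κ ∧
            f =ᵐ[MeasureTheory.volume]
              fun x => κ * CumulativeMoments.minDensity q β lam (κ * x))) := by
  open CumulativeMoments in
  have hγ0 : 0 < 1 + β - lam := by linarith
  obtain ⟨γ, hγ⟩ : ∃ γ, γ = 1 + β - lam := ⟨_, rfl⟩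
  obtain ⟨s, hs⟩ : ∃ s, s = β / γ := ⟨_, rfl⟩
  rw [← hγ] at hγ0 ⊢
  -- Here `s` is the entropy exponent in the variable `y`; it lies on the same side of one as `lam`.
  have hsγ : γ * s = lam + γ - 1 := by
    rw [hs, mul_div_cancel₀ _ hγ0.ne']; linarith
  rcases h₂ with ⟨rfl, hβ⟩ | ⟨hqt, h₂⟩
  · have hρ : minDensity ∞ β lam = (Ioo (-(1 / 2)) (1 / 2)).indicator 1 := by
      rw [minDensity, if_neg ENNReal.top_ne_zero, if_pos rfl]
    have h := (isEscort_uniform hγ0.ne').isExtremal_uniform hγ0 hsγ (hs ▸ div_pos hβ hγ0)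
    rw [hγ, ← optConst_top, ← hγ] at h
    exact h.sharp hγ0 one_pos (by rw [hρ, scale_one])
  rcases eq_or_ne q 0 with rfl | hq0
  · have hlam : 1 < lam := by
      rw [ENNReal.toReal_zero, zero_mul] at h₂; linarith
    have hs1 : 1 < s := by
      rw [hs, one_lt_div hγ0]; linarith
    have hρ : minDensity 0 β lam = diffEscort (1 / γ) (Ioo (-1) 1) (logDensity s) := by
      rw [minDensity, if_pos rfl, ← hγ, ← hs]
    have h := (isEscort_diffEscort_logDensity hs1 hγ0).isExtremal_log hγ0 hsγ hs1
    rw [optConst_zero h₁ hlam hγ hs] at h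
    exact h.sharp hγ0 one_pos (by rw [hρ, scale_one])
  · have hq : 0 < q.toReal := ENNReal.toReal_pos hq0 hqt
    -- The second parameter condition divided by `γ`, which is the condition for the profile to have
    -- a finite `q`-th moment.
    have hsq : 1 - s < q.toReal * s := by
      have h1 : 1 - s = (1 - lam) / γ := by rw [hs]; field_simp; linarith
      have h2 : q.toReal * s = q.toReal * β / γ := by rw [hs, mul_div_assoc]
      rw [h1, h2]
      gcongr
    obtain ⟨κ₀, hκ₀, hf₀⟩ := exists_isEscort_minDensity hq0 hqt hγ0 hγ hs hsq
    have h := hf₀.isExtremal_gaussian (K := optConst q β lam) hq0 hqt hγ0 hsγ hsq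
      (fun h => optConst_of_ne_one hq0 hqt h₁ h₂ hγ hs fun hl => h (by
        rw [hs, hγ, hl, show 1 + β - 1 = β by ring]
        exact div_self (by rintro rfl; simp [hγ, hl] at hγ0)))
      (fun h => by
        have hl : lam = 1 := by rw [h] at hsγ; linarith
        have hγβ : γ = β := by rw [hγ, hl]; ring
        rw [hγβ, hl]
        exact optConst_of_eq_one hq0 hqt (hγβ ▸ hγ0))
    exact h.sharp hγ0 hκ₀ (by rw [scale_scale, mul_inv_cancel₀ hκ₀.ne', scale_one])
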